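/- Let $F$ be a probability distribution on $\mathbb R$ with $F((-\infty,0])=0$ and continuous distribution function $F(y)$, and suppose $F(y)=Cy^a+o(y^a)$ as $y\downarrow 0$ for some constants $C,a>0$. Let $G$ be the measure on $[0,\infty)$ with $G([0,x])=-\ln(1-F(x))$ (read as $\infty$ if $F(x)=1$), let $\lambda$ be Lebesgue measure on $(0,\infty)$, and for each $n$ let $\Phi_n$ be a Poisson point process on the first quadrant with intensity measure $n\lambda\times G$ (the processes for different $n$ may live on different probability spaces). Let $q=F^{-1}(1-e^{-1})$, $R=(0,1)\times(0,q)$ and $S=(0,1)\times(0,\infty)$. For $W\in\{R,S\}$ let $\widetilde\Phi_n^W$ be the point process obtained from $\Phi_n\cap W$ by moving each point $(x,y)$ to the left edge of its vertical strip of width $1/n$, i.e. to $(\lfloor nx\rfloor/n,\,y)$. For a set of points $A\subset\mathbb R^2$ let $\mathcal C(A)$ be the set of lower faces of its convex hull, i.e. the non-degenerate faces (edges) with an inner normal vector $(s,1)$, $s\in\mathbb R$, and let $\mathcal C^+(A)\subset\mathcal C(A)$ be the set of lower-left faces, i.e. those with $s>0$. Write $X_n=\mathcal O_P(1)$ if $\mathbb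 P(|X_n|\ge c_n)\to0$ for every sequence $c_n\to\infty$. Then for each $W\in\{R,S\}$ the sets $\mathcal C(\Phi_n\cap R)$ and $\mathcal C(\widetilde\Phi_n^W)$ are almost surely finite for every $n$, and $$|\mathcal C^+(\Phi_n\cap R)|-|\mathcal C^+(\widetilde\Phi_n^W)|=\mathcal O_P(1),\qquad |\mathcal C(\Phi_n\cap R)|-|\mathcal C(\widetilde\Phi_n^W)|=\mathcal O_P(1).$$ In particular, let $C_0,C_1,\dots$ be i.i.d. with distribution $F$ and let $Z_n$ be the number of zeros of the tropical polynomial $x\mapsto\min_{0\le i\le n}(C_i+ix)$, i.e. of points $x\in\mathbb R$ at which the minimum is achieved at least twice. Then $Z_n$ and $|\mathcal C(\Phi_n\cap R)|$ have the same asymptotics: for all real sequences $(m_n)$ and $(s_n)$ with $s_n\to\infty$ and every probability measure $L$ on $\mathbb R$, $(Z_n-m_n)/s_n$ converges in distribution to $L$ if and only if $(|\mathcal C(\Phi_n\cap R)|-m_n)/s_n$ does. -/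

import Mathlib

open MeasureTheory ProbabilityTheory Filter Set
open scoped Topology ENNReal

noncomputable section

namespace TropicalHull

/-! ### The atom distribution, its quantile function and its hazard measure -/

/-- The quantile function `F⁻¹ u = inf {x | u ≤ F x}` of a probability measure on `ℝ`,
used for `0 < u < 1`. -/
def quantile (F : Measure ℝ) (u : ℝ) : ℝ := sInf {x : ℝ | u ≤ cdf F x}

/-- The measure `G` on `[0, ∞)` with `G [0, x] = - log (1 - F x)`, built as the image of Lebesgue
measure on `(0, ∞)` under `t ↦ F⁻¹ (1 - exp (-t))`. The defining property of `G` is proved in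
`hazardMeasure_Icc` below. -/
def hazardMeasure (F : Measure ℝ) : Measure ℝ :=
  (volume.restrict (Ioi (0 : ℝ))).map (fun t => quantile F (1 - Real.exp (-t)))

/-! ### Poisson point processes -/

/-- `Φ` is a (simple) Poisson point process with intensity measure `μ`, seen as a random set of
points: the number of points in a measurable set `B` with `μ B < ∞` is Poisson with mean `μ B`,
and the numbers of points in pairwise disjoint such sets are independent. -/
structure IsPoissonPointProcess {Ω S : Type*} [MeasurableSpace Ω] [MeasurableSpace S]
    (Φ : Ω → Set S) (μ : Measure S) (P : Measure Ω) : Prop where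
  hasLaw_count : ∀ B : Set S, MeasurableSet B → μ B < ⊤ →
    HasLaw (fun ω => (Φ ω ∩ B).encard)
      ((poissonMeasure (μ B).toNNReal).map (Nat.cast : ℕ → ℕ∞)) P
  iIndepFun_count : ∀ (k : ℕ) (B : Fin k → Set S), (∀ i, MeasurableSet (B i)) →
    (∀ i, μ (B i) < ⊤) → Pairwise (fun i j => Disjoint (B i) (B j)) →
    iIndepFun (fun i ω => (Φ ω ∩ B i).encard) P

/-- The intensity `n λ × G` on the first quadrant, `λ` being Lebesgue measure. -/
def intensity (F : Measure ℝ) (n : ℕ) : Measure (ℝ × ℝ) :=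
  (n : ℝ≥0∞) • (volume.restrict (Ioi (0 : ℝ))).prod (hazardMeasure F)

/-- The rectangle `(0, 1) × (0, F⁻¹ (1 - 1/e))`. -/
def rectangle (F : Measure ℝ) : Set (ℝ × ℝ) :=
  Ioo 0 1 ×ˢ Ioo 0 (quantile F (1 - Real.exp (-1)))

/-- The infinite strip `(0, 1) × (0, ∞)`. -/
def strip : Set (ℝ × ℝ) := Ioo 0 1 ×ˢ Ioi 0

/-- The map that moves a point of the vertical strip `[i/n, (i+1)/n) × ℝ` horizontally to the left
edge `x = i/n` of that strip. -/
def toLeftEdge (n : ℕ) (p : ℝ × ℝ) : ℝ × ℝ := (((⌊(n : ℝ) * p.1⌋ : ℤ) : ℝ) / n, p.2)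

/-! ### Faces of the lower convex hull -/

/-- The face of the convex hull of `S` on which the linear form `(x, y) ↦ s x + y` attains its
minimum; it is empty if the minimum is not attained. -/
def supportFace (S : Set (ℝ × ℝ)) (s : ℝ) : Set (ℝ × ℝ) :=
  {p ∈ convexHull ℝ S | ∀ q ∈ convexHull ℝ S, s * p.1 + p.2 ≤ s * q.1 + q.2}

/-- The lower faces (edges) of the convex hull of `S`: the nondegenerate faces with an inner normal
vector `(s, 1)`, `s ∈ ℝ`. -/
def lowerFaces (S : Set (ℝ × ℝ)) : Set (Set (ℝ × ℝ)) :=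
  {E | E.Nontrivial ∧ ∃ s : ℝ, E = supportFace S s}

/-- The lower left faces of the convex hull of `S`: the nondegenerate faces with an inner normal
vector `(s, 1)`, `s > 0`, equivalently `(1, α)` with `α = 1 / s > 0`. -/
def lowerLeftFaces (S : Set (ℝ × ℝ)) : Set (Set (ℝ × ℝ)) :=
  {E | E.Nontrivial ∧ ∃ s : ℝ, 0 < s ∧ E = supportFace S s}

/-! ### Tropical polynomials -/

/-- The tropical (min-plus) polynomial `x ↦ min_{0 ≤ i ≤ n} (c i + i x)`. -/
def tropicalPoly (n : ℕ) (c : ℕ → ℝ) (x : ℝ) : ℝ :=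
  (Finset.range (n + 1)).inf' Finset.nonempty_range_add_one (fun i => c i + i * x)

/-- The zeros of a tropical polynomial: the points at which the minimum is achieved at least
twice. -/
def tropicalZeros (n : ℕ) (c : ℕ → ℝ) : Set ℝ :=
  {x | ∃ i ≤ n, ∃ j ≤ n, i ≠ j ∧ c i + i * x = tropicalPoly n c x ∧
    c j + j * x = tropicalPoly n c x}

/-! ### Stochastic boundedness -/

/-- `X n = O_P(b n)`: for every sequence `c n → ∞`, `ℙ(|X n| ≥ b n * c n) → 0`. The variable `X n`
may live on its own probability space. -/
def IsBigOInProbability {Ω : ℕ → Type*} [∀ n, MeasurableSpace (Ω n)]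
    (P : ∀ n, Measure (Ω n)) (X : ∀ n, Ω n → ℝ) (b : ℕ → ℝ) : Prop :=
  ∀ c : ℕ → ℝ, Tendsto c atTop atTop →
    Tendsto (fun n => P n {ω | b n * c n ≤ |X n ω|}) atTop (𝓝 0)

/-! ### The defining property of the hazard measure -/

theorem quantile_le_iff (F : Measure ℝ) {u x : ℝ} (h0 : 0 < u) (h1 : u < 1) :
    quantile F u ≤ x ↔ u ≤ cdf F x := by
  have hne : {x : ℝ | u ≤ cdf F x}.Nonempty :=
    ((tendsto_cdf_atTop F).eventually (eventually_ge_nhds h1)).exists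
  obtain ⟨a, ha⟩ := ((tendsto_cdf_atBot F).eventually (eventually_lt_nhds h0)).exists
  have hbdd : BddBelow {x : ℝ | u ≤ cdf F x} := by
    refine ⟨a, fun y hy => ?_⟩
    by_contra hlt
    exact absurd ((hy.trans (monotone_cdf F (not_le.mp hlt).le)).trans_lt ha) (lt_irrefl _)
  constructor
  · intro h
    have hright : Tendsto (cdf F) (𝓝[>] x) (𝓝 (cdf F x)) :=
      ((cdf F).right_continuous x).tendsto.mono_left (nhdsWithin_mono x Ioi_subset_Ici_self)
    refine ge_of_tendsto hright ?_
    filter_upwards [self_mem_nhdsWithin] with y hy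
    obtain ⟨z, hz, hzy⟩ := (csInf_lt_iff hbdd hne).mp (lt_of_le_of_lt h hy)
    exact le_trans hz (monotone_cdf F hzy.le)
  · intro h
    exact csInf_le hbdd h

theorem hazardMeasure_Iic (F : Measure ℝ) (x : ℝ) :
    hazardMeasure F (Iic x) =
      if cdf F x < 1 then ENNReal.ofReal (-Real.log (1 - cdf F x)) else ⊤ := by
  have hu : ∀ t : ℝ, 0 < t → 0 < 1 - Real.exp (-t) ∧ 1 - Real.exp (-t) < 1 := fun t ht =>
    ⟨by simpa using ht, by simpa using Real.exp_pos (-t)⟩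
  have hmeas : AEMeasurable (fun t => quantile F (1 - Real.exp (-t)))
      (volume.restrict (Ioi (0 : ℝ))) := by
    refine aemeasurable_restrict_of_monotoneOn measurableSet_Ioi ?_
    intro s hs t ht hst
    obtain ⟨a, b⟩ := hu s hs
    obtain ⟨a', b'⟩ := hu t ht
    refine (quantile_le_iff F a b).mpr (le_trans ?_ ((quantile_le_iff F a' b').mp le_rfl))
    have : Real.exp (-t) ≤ Real.exp (-s) := Real.exp_le_exp.mpr (by linarith)
    linarith
  have hpre : (fun t => quantile F (1 - Real.exp (-t))) ⁻¹' Iic x ∩ Ioi (0 : ℝ) =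
      {t | 0 < t ∧ 1 - Real.exp (-t) ≤ cdf F x} := by
    ext t
    simp only [mem_inter_iff, mem_preimage, mem_Iic, mem_Ioi, mem_ofPred_eq]
    constructor
    · rintro ⟨h, ht⟩
      exact ⟨ht, (quantile_le_iff F (hu t ht).1 (hu t ht).2).mp h⟩
    · rintro ⟨ht, h⟩
      exact ⟨(quantile_le_iff F (hu t ht).1 (hu t ht).2).mpr h, ht⟩
  rw [hazardMeasure, Measure.map_apply_of_aemeasurable hmeas measurableSet_Iic,
    Measure.restrict_apply' measurableSet_Ioi, hpre]
  split_ifs with h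
  · have : {t | 0 < t ∧ 1 - Real.exp (-t) ≤ cdf F x} = Ioc 0 (-Real.log (1 - cdf F x)) := by
      ext t
      simp only [mem_ofPred_eq, mem_Ioc, and_congr_right_iff]
      intro _
      rw [le_neg, Real.log_le_iff_le_exp (by linarith)]
      constructor <;> intro h <;> linarith
    rw [this, Real.volume_Ioc, sub_zero]
  · have : {t | 0 < t ∧ 1 - Real.exp (-t) ≤ cdf F x} = Ioi 0 := by
      ext t
      simp only [mem_ofPred_eq, mem_Ioi, and_iff_left_iff_imp]
      intro _
      have := Real.exp_pos (-t)
      linarith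
    rw [this, Real.volume_Ioi]

/-- For a distribution on `(0, ∞)`, `G [0, x] = - log (1 - F x)`, read as `∞` if `F x = 1`. -/
theorem hazardMeasure_Icc (F : Measure ℝ) [IsProbabilityMeasure F] (hF : F (Iic 0) = 0) (x : ℝ) :
    hazardMeasure F (Icc 0 x) =
      if cdf F x < 1 then ENNReal.ofReal (-Real.log (1 - cdf F x)) else ⊤ := by
  have h0 : hazardMeasure F (Iio 0) = 0 := by
    refine measure_mono_null Iio_subset_Iic_self ?_
    have : cdf F 0 = 0 := by rw [cdf_eq_real, measureReal_def, hF, ENNReal.toReal_zero]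
    rw [hazardMeasure_Iic, this]
    simp
  rw [← hazardMeasure_Iic]
  refine le_antisymm (measure_mono Icc_subset_Iic_self) ?_
  have hsub : Iic x ⊆ Icc 0 x ∪ Iio 0 := fun y hy => by
    rcases lt_or_ge y 0 with h | h
    · exact Or.inr h
    · exact Or.inl ⟨h, hy⟩
  calc hazardMeasure F (Iic x) ≤ hazardMeasure F (Icc 0 x ∪ Iio 0) := measure_mono hsub
    _ ≤ hazardMeasure F (Icc 0 x) + hazardMeasure F (Iio 0) := measure_union_le _ _
    _ = hazardMeasure F (Icc 0 x) := by rw [h0, add_zero]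

end TropicalHull

end

/-! A lower edge corresponds to a parameter `s` at which `s x + y` has two minimisers
(`lowerFaces_eq`, `injOn_supportFace`), so edges are counted through `slopes`. Stretching abscissae
by `n` turns `Φ_n` into a Poisson process with intensity `λ × G` on a strip of width `n`, and the
discretisation moves each point horizontally by at most `1`. The question is how many edges such a
bounded perturbation can create or destroy, uniformly in `n`.

Since `G [0, y]` is of order `y ^ a`, the hull at abscissa `X` has height about `X ^ (-1/a)` and
edges with `s` about `X ^ (-1 - 1/a)`. The relevant points lie in a box of width `X ^ (1 + η)` and
height of order `X ^ (-1/a + η)`. In that box a pair at bounded horizontal distance has probability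
about `X ^ (1 - 2)`, and a triple whose orientation a bounded shift could reverse about `X ^ (2 -
3)`, up to small powers. Along `X = 2 ^ k` these bounds and that for a missing low point are
summable, so with probability close to `1` all scales from a fixed one on are good
(`exists_allGood`). At a good scale every edge survives with the same endpoints
(`exists_slope_transfer`), so edges of small positive slope inject both ways
(`ncard_small_slopes_le`). Edges of large slope have endpoints at bounded abscissa and are
stochastically boundedly many (`ncard_large_slopes_le`). The reflection `x ↦ n - n x` handles `s <
0`, and `s = 0` costs at most one edge. Only low points matter at good scales, so cutting at the top
of the rectangle is harmless.

For the tropical polynomial, discretising on the whole strip leaves only the lowest point of each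
column relevant. These minima are i.i.d. with law `F`, because `exp (-G [0, t]) = 1 - F t`
(`hasLaw_columnMin`). The discretised hull therefore has the law of the zero set for `n`
coefficients. The last coefficient changes the count by a stochastically bounded amount
(`exists_graphPoints_succ_bound`), and Slutsky's theorem transfers the limit laws. -/

noncomputable section

namespace TropicalHull

/-! ### Slopes of the lower faces -/

/-- The points of `A` that minimise the linear form `(x, y) ↦ s x + y` over `A`. -/
def minimizers (A : Set (ℝ × ℝ)) (s : ℝ) : Set (ℝ × ℝ) :=
  {p ∈ A | ∀ q ∈ A, s * p.1 + p.2 ≤ s * q.1 + q.2}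

/-- The parameters `s` for which `(x, y) ↦ s x + y` has at least two minimisers over `A`. -/
def slopes (A : Set (ℝ × ℝ)) : Set ℝ := {s | (minimizers A s).Nontrivial}

theorem minimizers_eq {A : Set (ℝ × ℝ)} {s : ℝ} {p q : ℝ × ℝ} (hp : p ∈ minimizers A s)
    (hq : q ∈ minimizers A s) : s * p.1 + p.2 = s * q.1 + q.2 :=
  le_antisymm (hp.2 q hq.1) (hq.2 p hp.1)

theorem le_on_convexHull {A : Set (ℝ × ℝ)} {s m : ℝ} (h : ∀ q ∈ A, m ≤ s * q.1 + q.2) :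
    ∀ q ∈ convexHull ℝ A, m ≤ s * q.1 + q.2 := by
  have hconv : Convex ℝ {q : ℝ × ℝ | m ≤ s * q.1 + q.2} := by
    intro x hx y hy a b ha hb hab
    simp only [mem_ofPred_eq, Prod.fst_add, Prod.smul_fst, smul_eq_mul, Prod.snd_add,
      Prod.smul_snd] at *
    have e1 : m = a * m + b * m := by rw [← add_mul, hab, one_mul]
    linarith [mul_le_mul_of_nonneg_left hx ha, mul_le_mul_of_nonneg_left hy hb]
  exact fun q hq => convexHull_min h hconv hq

theorem minimizers_subset_supportFace (A : Set (ℝ × ℝ)) (s : ℝ) :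
    minimizers A s ⊆ supportFace A s := fun _ hp =>
  ⟨subset_convexHull ℝ A hp.1, le_on_convexHull hp.2⟩

/-- The points whose value is at least `m`, and which lie in the hull of the minimisers if the value
is exactly `m`, form a convex set containing `A`: a proper convex combination attains the minimum
only if both of its ends do. -/
theorem supportFace_subset (A : Set (ℝ × ℝ)) (s : ℝ) :
    supportFace A s ⊆ convexHull ℝ (minimizers A s) := by
  rintro p ⟨hp, hmin⟩
  set m := s * p.1 + p.2 with hm
  have key : ∀ q ∈ convexHull ℝ A, (m ≤ s * q.1 + q.2) ∧
      (s * q.1 + q.2 = m → q ∈ convexHull ℝ (minimizers A s)) := by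
    have hA : ∀ q ∈ A, m ≤ s * q.1 + q.2 := fun q hq => hmin q (subset_convexHull ℝ A hq)
    refine fun q hq => convexHull_min (t := {q : ℝ × ℝ | (m ≤ s * q.1 + q.2) ∧
      (s * q.1 + q.2 = m → q ∈ convexHull ℝ (minimizers A s))}) ?_ ?_ hq
    · exact fun q hq => ⟨hA q hq, fun h => subset_convexHull ℝ _
        ⟨hq, fun r hr => h.le.trans (hA r hr)⟩⟩
    · rintro x ⟨hx, hx'⟩ y ⟨hy, hy'⟩ a b ha hb hab
      have e : s * (a • x + b • y).1 + (a • x + b • y).2 =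
          a * (s * x.1 + x.2) + b * (s * y.1 + y.2) := by
        simp only [Prod.fst_add, Prod.smul_fst, smul_eq_mul, Prod.snd_add, Prod.smul_snd]; ring
      have e1 : m = a * m + b * m := by rw [← add_mul, hab, one_mul]
      have h1 := mul_le_mul_of_nonneg_left hx ha
      have h2 := mul_le_mul_of_nonneg_left hy hb
      refine ⟨by rw [e]; linarith, fun h => ?_⟩
      rw [e] at h
      rcases ha.eq_or_lt with rfl | ha
      · obtain rfl : b = 1 := by linarith
        simpa using hy' (by linarith)
      rcases hb.eq_or_lt with rfl | hb
      · obtain rfl : a = 1 := by linarith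
        simpa using hx' (by linarith)
      · exact convex_convexHull ℝ _ (hx' (mul_left_cancel₀ ha.ne' (by linarith)))
          (hy' (mul_left_cancel₀ hb.ne' (by linarith))) ha.le hb.le hab
  exact (key p hp).2 rfl

theorem supportFace_nontrivial_iff (A : Set (ℝ × ℝ)) (s : ℝ) :
    (supportFace A s).Nontrivial ↔ s ∈ slopes A := by
  refine ⟨fun h => ?_, fun h => h.mono (minimizers_subset_supportFace A s)⟩
  by_contra hs
  have : (minimizers A s).Subsingleton := not_nontrivial_iff.mp hs
  have h2 := h.mono (supportFace_subset A s)
  rcases this.eq_empty_or_singleton with h3 | ⟨x, h3⟩ <;> rw [h3] at h2 <;> simp at h2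

/-- Two distinct points of a face differ by a non-vertical vector, and its direction determines `s`.
-/
theorem injOn_supportFace (A : Set (ℝ × ℝ)) : InjOn (supportFace A) (slopes A) := by
  intro s hs t ht hst
  obtain ⟨p, hp, q, hq, hpq⟩ := (supportFace_nontrivial_iff A s).mpr hs
  have hp' := hst ▸ hp
  have hq' := hst ▸ hq
  have e1 := le_antisymm (hp.2 q hq.1) (hq.2 p hp.1)
  have e2 := le_antisymm (hp'.2 q hq.1) (hq'.2 p hp.1)
  by_contra hne
  have : (s - t) * (p.1 - q.1) = 0 := by linarith
  rcases mul_eq_zero.mp this with h | h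
  · exact hne (by linarith)
  · have h1 : p.1 = q.1 := by linarith
    exact hpq (Prod.ext h1 (by rw [h1] at e1; linarith))

theorem lowerFaces_eq (A : Set (ℝ × ℝ)) : lowerFaces A = supportFace A '' slopes A := by
  ext E
  constructor
  · rintro ⟨hE, s, rfl⟩
    exact ⟨s, (supportFace_nontrivial_iff A s).mp hE, rfl⟩
  · rintro ⟨s, hs, rfl⟩
    exact ⟨(supportFace_nontrivial_iff A s).mpr hs, s, rfl⟩

theorem lowerLeftFaces_eq (A : Set (ℝ × ℝ)) :
    lowerLeftFaces A = supportFace A '' (slopes A ∩ Ioi 0) := by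
  ext E
  constructor
  · rintro ⟨hE, s, h0, rfl⟩
    exact ⟨s, ⟨(supportFace_nontrivial_iff A s).mp hE, h0⟩, rfl⟩
  · rintro ⟨s, hs, rfl⟩
    exact ⟨(supportFace_nontrivial_iff A s).mpr hs.1, s, hs.2, rfl⟩

theorem ncard_lowerFaces (A : Set (ℝ × ℝ)) : (lowerFaces A).ncard = (slopes A).ncard := by
  rw [lowerFaces_eq, (injOn_supportFace A).ncard_image]

theorem ncard_lowerLeftFaces (A : Set (ℝ × ℝ)) :
    (lowerLeftFaces A).ncard = (slopes A ∩ Ioi 0).ncard := by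
  rw [lowerLeftFaces_eq, ((injOn_supportFace A).mono inter_subset_left).ncard_image]

theorem finite_lowerFaces {A : Set (ℝ × ℝ)} (h : (slopes A).Finite) : (lowerFaces A).Finite := by
  rw [lowerFaces_eq]; exact h.image _

/-- A horizontal affine change of coordinates rescales the slopes. -/
theorem slopes_affine (A : Set (ℝ × ℝ)) {α : ℝ} (hα : α ≠ 0) (β : ℝ) :
    slopes ((fun p : ℝ × ℝ => (α * p.1 + β, p.2)) '' A) = (fun s => s / α) '' slopes A := by
  set f : ℝ × ℝ → ℝ × ℝ := fun p => (α * p.1 + β, p.2) with hf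
  have hinj : Function.Injective f := by
    intro p q h
    simp only [hf, Prod.mk.injEq, add_left_inj, mul_eq_mul_left_iff, hα, or_false] at h
    exact Prod.ext h.1 h.2
  have hmin : ∀ s, minimizers (f '' A) (s / α) = f '' minimizers A s := by
    intro s
    have hval : ∀ p, s / α * (f p).1 + (f p).2 = s * p.1 + p.2 + s / α * β := by
      intro p; simp only [hf]; field_simp; ring
    ext x
    constructor
    · rintro ⟨⟨p, hp, rfl⟩, h⟩
      refine ⟨p, ⟨hp, fun q hq => ?_⟩, rfl⟩
      have := h (f q) ⟨q, hq, rfl⟩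
      rw [hval, hval] at this; linarith
    · rintro ⟨p, ⟨hp, h⟩, rfl⟩
      refine ⟨⟨p, hp, rfl⟩, ?_⟩
      rintro _ ⟨q, hq, rfl⟩
      rw [hval, hval]; linarith [h q hq]
  ext t
  have ht : t = (t * α) / α := by field_simp
  constructor
  · intro h
    refine ⟨t * α, ?_, ht.symm⟩
    rw [slopes, mem_ofPred_eq, ht, hmin] at h
    exact (image_nontrivial hinj).mp h
  · rintro ⟨s, hs, rfl⟩
    show (minimizers (f '' A) (s / α)).Nontrivial
    rw [hmin]
    exact (image_nontrivial hinj).mpr hs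

/-- The number of slopes is at most the number of abscissae of the minimisers. -/
theorem ncard_slopes_le {A : Set (ℝ × ℝ)} {D E : Set ℝ} (hD : D ⊆ slopes A) (hE : E.Finite)
    (h : ∀ s ∈ D, ∀ p ∈ minimizers A s, p.1 ∈ E) : D.Finite ∧ D.ncard ≤ E.ncard := by
  have hleft : ∀ s ∈ D, ∃ p ∈ minimizers A s, ∃ q ∈ minimizers A s, p.1 < q.1 := by
    intro s hs
    obtain ⟨p, hp, q, hq, hne⟩ := hD hs
    rcases lt_trichotomy p.1 q.1 with h1 | h1 | h1
    · exact ⟨p, hp, q, hq, h1⟩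
    · have := minimizers_eq hp hq
      exact absurd (Prod.ext h1 (by rw [h1] at this; linarith)) hne
    · exact ⟨q, hq, p, hp, h1⟩
  choose! p hp q hq hlt using hleft
  -- Each slope is charged to the abscissa of its left minimiser. Two slopes with the same left
  -- abscissa coincide, by comparing each left minimiser with the right minimiser of the other
  -- slope.
  have hcomp : ∀ s ∈ D, ∀ t ∈ D, (p s).1 = (p t).1 → s ≤ t := by
    intro s hs t ht hst
    have e1 := (hp t ht).2 _ (hq s hs).1
    have e2 := minimizers_eq (hp s hs) (hq s hs)
    have e3 := (hp s hs).2 _ (hp t ht).1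
    have hl := hlt s hs
    have : 0 ≤ (t - s) * ((q s).1 - (p s).1) := by rw [hst] at e2 e3 ⊢; linarith
    by_contra hc
    push Not at hc
    nlinarith
  have hinj : InjOn (fun s => (p s).1) D := fun s hs t ht hst =>
    le_antisymm (hcomp s hs t ht hst) (hcomp t ht s hs hst.symm)
  have hmaps : MapsTo (fun s => (p s).1) D E := fun s hs => h s hs _ (hp s hs)
  exact ⟨hE.of_injOn hmaps hinj, ncard_le_ncard_of_injOn _ hmaps hinj hE⟩

theorem finite_slopes {A : Set (ℝ × ℝ)} (h : (Prod.fst '' A).Finite) : (slopes A).Finite :=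
  (ncard_slopes_le subset_rfl h fun _ _ p hp => ⟨p, hp.1, rfl⟩).1

/-- Replacing every slope set by its positive, zero and negative parts. -/
theorem ncard_split_sign {T : Set ℝ} (hT : T.Finite) :
    (T ∩ Ioi 0).ncard + (T ∩ Iio 0).ncard ≤ T.ncard ∧
      T.ncard ≤ (T ∩ Ioi 0).ncard + (T ∩ Iio 0).ncard + 1 := by
  have hdisj : Disjoint (T ∩ Ioi 0) (T ∩ Iio 0) := by
    rw [Set.disjoint_left]
    rintro x ⟨_, h⟩ ⟨_, h'⟩
    exact lt_asymm (show (0:ℝ) < x from h) h'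
  rw [← ncard_union_eq hdisj (hT.subset inter_subset_left) (hT.subset inter_subset_left)]
  constructor
  · exact ncard_le_ncard (union_subset inter_subset_left inter_subset_left) hT
  · refine le_trans (ncard_le_ncard (t := insert 0 (T ∩ Ioi 0 ∪ T ∩ Iio 0)) ?_ ?_)
      (ncard_insert_le _ _)
    · intro x hx
      rcases lt_trichotomy x 0 with h | h | h
      · exact Or.inr (Or.inr ⟨hx, h⟩)
      · exact Or.inl h
      · exact Or.inr (Or.inl ⟨hx, h⟩)
    · exact ((hT.subset inter_subset_left).union (hT.subset inter_subset_left)).insert _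

/-! ### Comparison of the hulls of two horizontal perturbations of a point set -/

/-- Twice the signed area of the triangle `p q r`. -/
def area (p q r : ℝ × ℝ) : ℝ := p.1 * (q.2 - r.2) + q.1 * (r.2 - p.2) + r.1 * (p.2 - q.2)

/-- The sum of the height differences of three points. -/
def spread (p q r : ℝ × ℝ) : ℝ := |q.2 - r.2| + |r.2 - p.2| + |p.2 - q.2|

/-- The points of `I` are in general position at scale `X`: there is a low point with abscissa in
`[X, 2 X]`, and in the box of width `Z` and height `12 Y` no two points have close abscissae and
no three points are nearly collinear. -/
structure GoodScale (I : Set (ℝ × ℝ)) (X Y Z : ℝ) : Prop where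
  exists_low : ∃ p ∈ I, X ≤ p.1 ∧ p.1 ≤ 2 * X ∧ p.2 ≤ Y
  separated : ∀ p ∈ I, ∀ q ∈ I, p ≠ q → p.1 ≤ Z → q.1 ≤ Z → p.2 ≤ 12 * Y → q.2 ≤ 12 * Y →
    6 < |p.1 - q.1|
  -- Three points at equal height have zero area and zero spread, so the strict inequality needs two
  -- different heights.
  not_collinear : ∀ p ∈ I, ∀ q ∈ I, ∀ r ∈ I, p ≠ q → q ≠ r → p ≠ r →
    q.2 ≠ r.2 → p.1 ≤ Z → q.1 ≤ Z → r.1 ≤ Z → p.2 ≤ 12 * Y → q.2 ≤ 12 * Y → r.2 ≤ 12 * Y → spread p q r < |area p q r|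

/-- The point set obtained from `A` by replacing the abscissa of each point `p` by `u p`. -/
def shift (u : ℝ × ℝ → ℝ) (A : Set (ℝ × ℝ)) : Set (ℝ × ℝ) := (fun p => (u p, p.2)) '' A

/-- The area is linear in the abscissae with the height differences as coefficients. Hence a triple
with `spread < |area|` keeps its orientation under every such perturbation. -/
theorem abs_area_sub_le {u : ℝ × ℝ → ℝ} {p q r : ℝ × ℝ} (hp : |u p - p.1| ≤ 1)
    (hq : |u q - q.1| ≤ 1) (hr : |u r - r.1| ≤ 1) :
    |area (u p, p.2) (u q, q.2) (u r, r.2) - area p q r| ≤ spread p q r := by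
  have e : area (u p, p.2) (u q, q.2) (u r, r.2) - area p q r =
      (u p - p.1) * (q.2 - r.2) + (u q - q.1) * (r.2 - p.2) + (u r - r.1) * (p.2 - q.2) := by
    simp only [area]; ring
  rw [e]
  refine (abs_add_three _ _ _).trans ?_
  simp only [abs_mul, spread]
  gcongr
  · exact mul_le_of_le_one_left (abs_nonneg _) hp
  · exact mul_le_of_le_one_left (abs_nonneg _) hq
  · exact mul_le_of_le_one_left (abs_nonneg _) hr

theorem mem_minimizers_shift {u : ℝ × ℝ → ℝ} {A : Set (ℝ × ℝ)} {s : ℝ} {p : ℝ × ℝ} (hp : p ∈ A) :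
    (u p, p.2) ∈ minimizers (shift u A) s ↔ ∀ q ∈ A, s * u p + p.2 ≤ s * u q + q.2 := by
  constructor
  · rintro ⟨_, h⟩ q hq
    exact h (u q, q.2) ⟨q, hq, rfl⟩
  · intro h
    refine ⟨⟨p, hp, rfl⟩, ?_⟩
    rintro _ ⟨q, hq, rfl⟩
    exact h q hq

/-- At a good scale every edge of a perturbed point set is an edge of any other perturbation. -/
theorem exists_slope_transfer {A B I : Set (ℝ × ℝ)} {u v : ℝ × ℝ → ℝ} {X Y Z s : ℝ}
    (hu : ∀ p ∈ I, |u p - p.1| ≤ 1) (hv : ∀ p ∈ I, |v p - p.1| ≤ 1)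
    (hu0 : ∀ p ∈ I, 0 ≤ u p) (hv0 : ∀ p ∈ I, 0 ≤ v p) (hy0 : ∀ p ∈ I, 0 ≤ p.2)
    (hAI : A ⊆ I) (hBI : B ⊆ I) (hAB : ∀ p ∈ I, p.2 ≤ 12 * Y → p ∈ A ∧ p ∈ B)
    (hgood : GoodScale I X Y Z) (hX : 1 ≤ X) (hs : 0 < s) (hsX : s * X ≤ Y)
    (hZ : ∀ p ∈ I, p.1 ≤ 24 * Y / s + 1 → p.1 ≤ Z) (hmem : s ∈ slopes (shift u A)) :
    ∃ q ∈ B, ∃ r ∈ B, q ≠ r ∧ s = (q.2 - r.2) / (u r - u q) ∧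
      0 < (q.2 - r.2) / (v r - v q) ∧
      (v q, q.2) ∈ minimizers (shift v B) ((q.2 - r.2) / (v r - v q)) ∧
      (v r, r.2) ∈ minimizers (shift v B) ((q.2 - r.2) / (v r - v q)) ∧ v q ≠ v r ∧
      ∀ p ∈ B, (v p, p.2) ∈ minimizers (shift v B) ((q.2 - r.2) / (v r - v q)) →
        p = q ∨ p = r := by
  have hsY : s ≤ Y := le_trans (by nlinarith) hsX
  have hY : 0 < Y := hs.trans_le hsY
  obtain ⟨p₀, hp₀I, hX0, hX1, hp₀Y⟩ := hgood.exists_low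
  have hp₀A : p₀ ∈ A := (hAB p₀ hp₀I (by linarith)).1
  obtain ⟨q', hq', r', hr', hne'⟩ := hmem
  -- Comparison with the low point: its value is at most `s (2 X + 1) + Y`, and both `s X` and `s`
  -- are at most `Y`.
  have hle : ∀ p ∈ A, (u p, p.2) ∈ minimizers (shift u A) s → s * u p + p.2 ≤ 4 * Y := by
    intro p hp hm
    have h1 := (mem_minimizers_shift hp).mp hm p₀ hp₀A
    have h2 : u p₀ ≤ 2 * X + 1 := by linarith [(abs_le.mp (hu p₀ hp₀I)).2]
    nlinarith [mul_le_mul_of_nonneg_left h2 hs.le]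
  -- order the two minimisers from left to right
  obtain ⟨q, hqA, r, hrA, hq, hr, hlt⟩ : ∃ q ∈ A, ∃ r ∈ A, (u q, q.2) ∈ minimizers (shift u A) s ∧
      (u r, r.2) ∈ minimizers (shift u A) s ∧ u q < u r := by
    obtain ⟨q, hq, rfl⟩ := hq'.1
    obtain ⟨r, hr, rfl⟩ := hr'.1
    rcases lt_trichotomy (u q) (u r) with h | h | h
    · exact ⟨q, hq, r, hr, hq', hr', h⟩
    · have := minimizers_eq hq' hr'
      simp only [h] at this
      exact absurd (Prod.ext h (by simpa using this)) hne'
    · exact ⟨r, hr, q, hq, hr', hq', h⟩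
  have hqI := hAI hqA
  have hrI := hAI hrA
  have hqr : q ≠ r := by rintro rfl; exact lt_irrefl _ hlt
  have heq : s * u q + q.2 = s * u r + r.2 := minimizers_eq hq hr
  have hq4 := hle q hqA hq
  have hr4 := hle r hrA hr
  have hbox : ∀ p ∈ I, u p ≤ 24 * Y / s → p.1 ≤ Z := fun p hp h =>
    hZ p hp (by linarith [(abs_le.mp (hu p hp)).1])
  have hbox' : ∀ p ∈ I, v p ≤ 24 * Y / s → p.1 ≤ Z := fun p hp h =>
    hZ p hp (by linarith [(abs_le.mp (hv p hp)).1])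
  have hqY : q.2 ≤ 12 * Y := by linarith [mul_nonneg hs.le (hu0 q hqI)]
  have hrY : r.2 ≤ 12 * Y := by linarith [mul_nonneg hs.le (hu0 r hrI)]
  have hqZ : q.1 ≤ Z := hbox q hqI (by rw [le_div_iff₀ hs]; linarith [hy0 q hqI])
  have hrZ : r.1 ≤ Z := hbox r hrI (by rw [le_div_iff₀ hs]; linarith [hy0 r hrI])
  have hsep := hgood.separated q hqI r hrI hqr hqZ hrZ hqY hrY
  have huq := abs_le.mp (hu q hqI)
  have hur := abs_le.mp (hu r hrI)
  have hvq := abs_le.mp (hv q hqI)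
  have hvr := abs_le.mp (hv r hrI)
  have hd : 6 < r.1 - q.1 := by
    rcases lt_abs.mp hsep with h | h <;> linarith
  have hdu : 0 < u r - u q := by linarith
  have hdv : 0 < v r - v q := by linarith
  have hqr2 : 0 < q.2 - r.2 := by nlinarith [mul_pos hs hdu]
  set t := (q.2 - r.2) / (v r - v q) with ht
  have hsval : s = (q.2 - r.2) / (u r - u q) := by
    rw [eq_div_iff hdu.ne']; linarith
  have ht0 : 0 < t := div_pos hqr2 hdv
  have htv : t * (v r - v q) = q.2 - r.2 := by rw [ht]; field_simp
  have hsu : s * (u r - u q) = q.2 - r.2 := by linarith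
  -- The widths of the edge under `u` and `v` each differ from `r.1 - q.1` by at most `2`. A
  -- distance above `6` is what makes each less than twice the other, hence `s` and `t` comparable
  -- up to a factor `2`.
  have ht2 : t ≤ 2 * s := by
    by_contra hc
    push Not at hc
    have h1 : (2 * s) * (v r - v q) < t * (v r - v q) := mul_lt_mul_of_pos_right hc hdv
    have h2 : u r - u q < 2 * (v r - v q) := by linarith
    nlinarith [mul_lt_mul_of_pos_left h2 hs]
  have hst : s ≤ 2 * t := by
    by_contra hc
    push Not at hc
    have h1 : (2 * t) * (u r - u q) < s * (u r - u q) := mul_lt_mul_of_pos_right hc hdu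
    have h2 : v r - v q < 2 * (u r - u q) := by linarith
    nlinarith [mul_lt_mul_of_pos_left h2 ht0]
  have hteq : t * v q + q.2 = t * v r + r.2 := by linarith
  have hqB := (hAB q hqI hqY).2
  have hrB := (hAB r hrI hrY).2
  -- the main point: every other point lies strictly above the perturbed edge
  have key : ∀ p ∈ I, p ≠ q → p ≠ r → t * v q + q.2 < t * v p + p.2 := by
    intro p hpI hpq hpr
    by_contra hc
    push Not at hc
    -- Origin of the `12`: `t ≤ 2 s` and `v q ≤ u q + 2` give at most `2 (s u q + q.2) + 4 s ≤ 8 Y +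
    -- 4 Y`. With `s ≤ 2 t` this yields `v p ≤ 24 Y / s`, the width requested of the box.
    have h8 : t * v p + p.2 ≤ 12 * Y := by
      have h1 : v q ≤ u q + 2 := by linarith
      have h2 : t * v q ≤ 2 * s * (u q + 2) :=
        mul_le_mul ht2 h1 (hv0 q hqI) (by linarith)
      nlinarith [hy0 q hqI]
    have hpY : p.2 ≤ 12 * Y := by linarith [mul_nonneg ht0.le (hv0 p hpI)]
    have hpZ : p.1 ≤ Z := by
      refine hbox' p hpI ?_
      rw [le_div_iff₀ hs]
      have h1 := hy0 p hpI
      have h2 : v p * s ≤ v p * (2 * t) := mul_le_mul_of_nonneg_left hst (hv0 p hpI)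
      linarith
    have hpA := (hAB p hpI hpY).1
    have hcol := hgood.not_collinear p hpI q hqI r hrI hpq hqr hpr (sub_pos.mp hqr2).ne' hpZ hqZ hrZ hpY hqY hrY
    have hau := abs_le.mp (abs_area_sub_le (hu p hpI) (hu q hqI) (hu r hrI))
    have hav := abs_le.mp (abs_area_sub_le (hv p hpI) (hv q hqI) (hv r hrI))
    have eu : area (u p, p.2) (u q, q.2) (u r, r.2) =
        (u r - u q) * (s * u p + p.2 - (s * u q + q.2)) := by
      simp only [area]
      linear_combination (u q - u p) * hsu
    have ev : area (v p, p.2) (v q, q.2) (v r, r.2) =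
        (v r - v q) * (t * v p + p.2 - (t * v q + q.2)) := by
      simp only [area]
      linear_combination (v q - v p) * htv
    have hu1 := (mem_minimizers_shift hqA).mp hq p hpA
    -- The triangle would have weakly opposite orientations under `u` and `v`, although both areas
    -- are within `spread` of an area exceeding `spread` in absolute value.
    have h1 : 0 ≤ area (u p, p.2) (u q, q.2) (u r, r.2) := by
      rw [eu]; exact mul_nonneg hdu.le (by linarith)
    have h2 : area (v p, p.2) (v q, q.2) (v r, r.2) ≤ 0 := by
      rw [ev]; exact mul_nonpos_of_nonneg_of_nonpos hdv.le (by linarith)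
    rcases lt_abs.mp hcol with h | h <;> linarith
  have hmin : ∀ p ∈ B, t * v q + q.2 ≤ t * v p + p.2 := by
    intro p hp
    by_cases hpq : p = q
    · rw [hpq]
    by_cases hpr : p = r
    · rw [hpr]; exact hteq.le
    exact (key p (hBI hp) hpq hpr).le
  refine ⟨q, hqB, r, hrB, hqr, hsval, ht0, (mem_minimizers_shift hqB).mpr hmin,
    (mem_minimizers_shift hrB).mpr fun p hp => hteq ▸ hmin p hp, by linarith, fun p hp hpm => ?_⟩
  by_contra hc
  push Not at hc
  have := (mem_minimizers_shift hp).mp hpm q hqB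
  linarith [key p (hBI hp) hc.1 hc.2]

/-- If every small slope of `shift u A` belongs to a good scale, then these slopes are not more
numerous than the positive slopes of `shift v B`. -/
theorem ncard_small_slopes_le {A B I : Set (ℝ × ℝ)} {u v : ℝ × ℝ → ℝ} {σ : ℝ}
    (hu : ∀ p ∈ I, |u p - p.1| ≤ 1) (hv : ∀ p ∈ I, |v p - p.1| ≤ 1)
    (hu0 : ∀ p ∈ I, 0 ≤ u p) (hv0 : ∀ p ∈ I, 0 ≤ v p) (hy0 : ∀ p ∈ I, 0 ≤ p.2)
    (hAI : A ⊆ I) (hBI : B ⊆ I)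
    (hscale : ∀ s, 0 < s → s ≤ σ → ∃ X Y Z : ℝ, GoodScale I X Y Z ∧ 1 ≤ X ∧ s * X ≤ Y ∧
      (∀ p ∈ I, p.1 ≤ 24 * Y / s + 1 → p.1 ≤ Z) ∧ ∀ p ∈ I, p.2 ≤ 12 * Y → p ∈ A ∧ p ∈ B)
    (hfin : (slopes (shift v B)).Finite) :
    (slopes (shift u A) ∩ Ioc 0 σ).ncard ≤ (slopes (shift v B) ∩ Ioi 0).ncard := by
  have h : ∀ s ∈ slopes (shift u A) ∩ Ioc 0 σ, ∃ q ∈ B, ∃ r ∈ B, q ≠ r ∧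
      s = (q.2 - r.2) / (u r - u q) ∧ 0 < (q.2 - r.2) / (v r - v q) ∧
      (v q, q.2) ∈ minimizers (shift v B) ((q.2 - r.2) / (v r - v q)) ∧
      (v r, r.2) ∈ minimizers (shift v B) ((q.2 - r.2) / (v r - v q)) ∧ v q ≠ v r ∧
      ∀ p ∈ B, (v p, p.2) ∈ minimizers (shift v B) ((q.2 - r.2) / (v r - v q)) →
        p = q ∨ p = r := by
    rintro s ⟨hmem, hs, hsσ⟩
    obtain ⟨X, Y, Z, hg, hX, hsX, hZ, hAB⟩ := hscale s hs hsσ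
    exact exists_slope_transfer hu hv hu0 hv0 hy0 hAI hBI hAB hg hX hs hsX hZ hmem
  choose! q hq r hr hne hs hpos hmq hmr hvne hall using h
  -- Injectivity: the transferred edge has exactly the two minimisers `q s` and `r s`, so its slope
  -- determines this pair up to order, and the pair determines `s`.
  refine ncard_le_ncard_of_injOn (fun s => ((q s).2 - (r s).2) / (v (r s) - v (q s))) ?_ ?_
    (hfin.subset inter_subset_left)
  · intro s hs'
    refine ⟨⟨_, hmq s hs', _, hmr s hs', fun h => hvne s hs' (congrArg Prod.fst h)⟩, hpos s hs'⟩
  · intro s hs1 t ht1 hst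
    simp only at hst
    have h1 := hall t ht1 (q s) (hq s hs1) (by rw [← hst]; exact hmq s hs1)
    have h2 := hall t ht1 (r s) (hr s hs1) (by rw [← hst]; exact hmr s hs1)
    have h3 := hne s hs1
    rw [hs s hs1, hs t ht1]
    rcases h1 with h1 | h1 <;> rcases h2 with h2 | h2
    · exact absurd (h1.trans h2.symm) h3
    · rw [h1, h2]
    · rw [h1, h2, ← neg_sub, ← neg_sub (u (r t)), neg_div_neg_eq]
    · exact absurd (h1.trans h2.symm) h3

/-- The slopes above a threshold are few: their minimisers have bounded abscissae. -/
theorem ncard_large_slopes_le {A : Set (ℝ × ℝ)} {u : ℝ × ℝ → ℝ} {σ x₀ y₀ L : ℝ} {p₀ : ℝ × ℝ}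
    (hy0 : ∀ p ∈ A, 0 ≤ p.2) (hσ : 0 < σ) (hp₀ : p₀ ∈ A) (hx₀ : u p₀ ≤ x₀) (hy₀ : p₀.2 ≤ y₀)
    (hL : x₀ + y₀ / σ ≤ L) (hE : (u '' {p ∈ A | u p ≤ L}).Finite) :
    (slopes (shift u A) ∩ Ioi σ).ncard ≤ (u '' {p ∈ A | u p ≤ L}).ncard := by
  refine (ncard_slopes_le inter_subset_left hE ?_).2
  rintro s ⟨_, hs⟩ p ⟨⟨p, hp, rfl⟩, hmin⟩
  refine ⟨p, ⟨hp, ?_⟩, rfl⟩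
  have h1 : s * u p + p.2 ≤ s * u p₀ + p₀.2 := hmin _ ⟨p₀, hp₀, rfl⟩
  have hs0 : 0 < s := hσ.trans hs
  have h2 := hy0 p hp
  have h3 : s * (u p - u p₀) ≤ y₀ := by linarith
  have h4 : σ * (u p - u p₀) ≤ y₀ := by
    rcases le_or_gt 0 (u p - u p₀) with h | h
    · exact (mul_le_mul_of_nonneg_right (le_of_lt hs) h).trans h3
    · exact (mul_nonpos_of_nonneg_of_nonpos hσ.le h.le).trans ((hy0 p₀ hp₀).trans hy₀)
  have h5 : u p - u p₀ ≤ y₀ / σ := by rw [le_div_iff₀ hσ]; linarith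
  linarith

/-! ### Poisson counts -/

section Counts

variable {Ω : Type*} [MeasurableSpace Ω] {P : Measure Ω} {X : Ω → ℕ∞} {m : ℝ≥0∞}

theorem poisson_encard_eq_zero
    (h : HasLaw X ((poissonMeasure m.toNNReal).map (Nat.cast : ℕ → ℕ∞)) P) :
    P {ω | X ω = 0} = ENNReal.ofReal (Real.exp (-m.toReal)) := by
  rw [h.measure_eq (p := fun k => k = 0) (MeasurableSet.of_discrete),
    Measure.map_apply Measurable.of_discrete MeasurableSet.of_discrete]
  have : (Nat.cast : ℕ → ℕ∞) ⁻¹' {k | k = 0} = {0} := by ext; simp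
  rw [this, poissonMeasure_singleton]
  simp [ENNReal.coe_toNNReal_eq_toReal]

theorem poisson_encard_ne_zero [IsProbabilityMeasure P]
    (h : HasLaw X ((poissonMeasure m.toNNReal).map (Nat.cast : ℕ → ℕ∞)) P) :
    P {ω | X ω ≠ 0} = ENNReal.ofReal (1 - Real.exp (-m.toReal)) := by
  have h0 := poisson_encard_eq_zero h
  have hm : NullMeasurableSet {ω | X ω = 0} P :=
    h.aemeasurable.nullMeasurable (MeasurableSet.of_discrete (s := {0}))
  have : {ω | X ω ≠ 0} = {ω | X ω = 0}ᶜ := rfl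
  rw [this, prob_compl_eq_one_sub₀ hm, h0, ENNReal.ofReal_sub _ (Real.exp_pos _).le,
    ENNReal.ofReal_one]

theorem poisson_encard_ne_zero_le [IsProbabilityMeasure P]
    (h : HasLaw X ((poissonMeasure m.toNNReal).map (Nat.cast : ℕ → ℕ∞)) P) :
    P {ω | X ω ≠ 0} ≤ m := by
  rw [poisson_encard_ne_zero h]
  refine ENNReal.ofReal_le_of_le_toReal ?_
  linarith [Real.add_one_le_exp (-m.toReal)]

theorem poisson_two_le_encard_le [IsProbabilityMeasure P]
    (h : HasLaw X ((poissonMeasure m.toNNReal).map (Nat.cast : ℕ → ℕ∞)) P) :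
    P {ω | 2 ≤ X ω} ≤ m ^ 2 := by
  rw [h.measure_eq (p := fun k => 2 ≤ k) (MeasurableSet.of_discrete),
    Measure.map_apply Measurable.of_discrete MeasurableSet.of_discrete]
  have : (Nat.cast : ℕ → ℕ∞) ⁻¹' {k | 2 ≤ k} = ({0, 1} : Set ℕ)ᶜ := by
    ext k
    simp only [mem_preimage, mem_ofPred_eq, mem_compl_iff, mem_insert_iff, mem_singleton_iff]
    rw [show (2 : ℕ∞) = ((2 : ℕ) : ℕ∞) from rfl, Nat.cast_le]; omega
  rw [this, prob_compl_eq_one_sub MeasurableSet.of_discrete]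
  have h2 : poissonMeasure m.toNNReal {0, 1} =
      ENNReal.ofReal (Real.exp (-m.toReal) + Real.exp (-m.toReal) * m.toReal) := by
    rw [← singleton_union, measure_union (by simp) MeasurableSet.of_discrete,
      poissonMeasure_singleton, poissonMeasure_singleton,
      ← ENNReal.ofReal_add (by positivity) (by positivity)]
    simp [ENNReal.coe_toNNReal_eq_toReal]
  rw [h2, ← ENNReal.ofReal_one, ← ENNReal.ofReal_sub _ (by positivity)]
  refine ENNReal.ofReal_le_of_le_toReal ?_
  -- With `exp (-m) ≥ 1 - m`, the tail `1 - exp (-m) (1 + m)` is at most `1 - (1 - m) (1 + m) = m ^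
  -- 2`.
  rw [ENNReal.toReal_pow]
  have := Real.add_one_le_exp (-m.toReal)
  nlinarith [ENNReal.toReal_nonneg (a := m), Real.exp_pos (-m.toReal)]

theorem poisson_encard_lt_top
    (h : HasLaw X ((poissonMeasure m.toNNReal).map (Nat.cast : ℕ → ℕ∞)) P) :
    ∀ᵐ ω ∂P, X ω < ⊤ := by
  rw [h.ae_iff (p := fun k => k < ⊤) (Measurable.of_discrete),
    ae_map_iff (Measurable.of_discrete.aemeasurable) MeasurableSet.of_discrete]
  simp

/-- The tail of a Poisson count is uniformly small. -/
theorem exists_poisson_tail (m : ℝ≥0∞) {ε : ℝ≥0∞} (hε : ε ≠ 0) : ∃ K : ℕ,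
    ∀ {Ω : Type _} [MeasurableSpace Ω] {P : Measure Ω} {X : Ω → ℕ∞},
      HasLaw X ((poissonMeasure m.toNNReal).map (Nat.cast : ℕ → ℕ∞)) P →
      P {ω | (K : ℕ∞) < X ω} ≤ ε := by
  have ht : Tendsto (fun K : ℕ => poissonMeasure m.toNNReal (Ioi K)) atTop (𝓝 0) := by
    have : (⋂ K : ℕ, Ioi K) = ∅ := by
      ext k; simp only [mem_iInter, mem_Ioi, mem_empty_iff_false, iff_false, not_forall, not_lt]
      exact ⟨k, le_rfl⟩
    rw [← measure_empty (μ := poissonMeasure m.toNNReal), ← this]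
    exact tendsto_measure_iInter_atTop (fun _ => MeasurableSet.of_discrete.nullMeasurableSet)
      (fun a b hab => Ioi_subset_Ioi hab) ⟨0, measure_ne_top _ _⟩
  obtain ⟨K, hK⟩ := (ht.eventually (ge_mem_nhds (pos_iff_ne_zero.mpr hε))).exists
  refine ⟨K, fun {Ω _ P X} h => ?_⟩
  rw [h.measure_eq (p := fun k => (K : ℕ∞) < k) (MeasurableSet.of_discrete),
    Measure.map_apply Measurable.of_discrete MeasurableSet.of_discrete]
  refine le_trans (measure_mono ?_) hK
  intro k hk
  simpa using hk

end Counts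

/-! ### Poisson processes on a strip -/

/-- `Ψ` is a Poisson process on the strip `(0, N) × (0, ∞)` with intensity `λ × G`, tested on
product sets. -/
structure IsStripPoisson {Ω : Type*} [MeasurableSpace Ω] (Ψ : Ω → Set (ℝ × ℝ)) (N : ℝ)
    (G : Measure ℝ) (P : Measure Ω) : Prop where
  subset : ∀ ω, Ψ ω ⊆ Ioo 0 N ×ˢ Ioi 0
  hasLaw_count : ∀ J H : Set ℝ, MeasurableSet J → MeasurableSet H → J ⊆ Ioo 0 N →
    volume J * G H < ⊤ → HasLaw (fun ω => (Ψ ω ∩ J ×ˢ H).encard)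
      ((poissonMeasure (volume J * G H).toNNReal).map (Nat.cast : ℕ → ℕ∞)) P
  iIndepFun_count : ∀ (k : ℕ) (J H : Fin k → Set ℝ), (∀ i, MeasurableSet (J i)) →
    (∀ i, MeasurableSet (H i)) → (∀ i, J i ⊆ Ioo 0 N) → (∀ i, volume (J i) * G (H i) < ⊤) →
    Pairwise (fun i j => Disjoint (J i ×ˢ H i) (J j ×ˢ H j)) →
    iIndepFun (fun i ω => (Ψ ω ∩ J i ×ˢ H i).encard) P

/-- The points of a process whose coordinates lie in given disjoint columns: the heights are
dominated by the product measure. -/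
theorem IsStripPoisson.measure_exists_heights_le {Ω : Type*} [MeasurableSpace Ω]
    {Ψ : Ω → Set (ℝ × ℝ)} {N : ℝ} {G : Measure ℝ} {P : Measure Ω} [IsProbabilityMeasure P]
    (h : IsStripPoisson Ψ N G P) {k : ℕ} {J : Fin k → Set ℝ} {H : Set ℝ}
    (hJ : ∀ i, MeasurableSet (J i)) (hJN : ∀ i, J i ⊆ Ioo 0 N) (hJ1 : ∀ i, volume (J i) ≤ 1)
    (hdisj : Pairwise (fun i j => Disjoint (J i) (J j))) (hH : MeasurableSet H) (hGH : G H < ⊤)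
    (T : Set (Fin k → ℝ)) :
    P {ω | ∃ p : Fin k → ℝ × ℝ, (∀ i, p i ∈ Ψ ω ∧ (p i).1 ∈ J i ∧ (p i).2 ∈ H) ∧
      (fun i => (p i).2) ∈ T} ≤ Measure.pi (fun _ => G.restrict H) T := by
  -- As a function of `T` the left side is an outer measure, and `OuterMeasure.pi` is the largest
  -- outer measure bounded by the products on boxes. Only boxes need checking, where independence of
  -- the columns applies, and the event for a general `T` need not be measurable.
  let ρ : OuterMeasure (Fin k → ℝ) :=
    { measureOf := fun T => P {ω | ∃ p : Fin k → ℝ × ℝ,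
        (∀ i, p i ∈ Ψ ω ∧ (p i).1 ∈ J i ∧ (p i).2 ∈ H) ∧ (fun i => (p i).2) ∈ T}
      empty := by simp
      mono := by
        intro s t hst
        refine measure_mono ?_
        rintro ω ⟨p, hp, hpT⟩
        exact ⟨p, hp, hst hpT⟩
      iUnion_nat := by
        intro s _
        refine le_trans (measure_mono ?_) (measure_iUnion_le _)
        rintro ω ⟨p, hp, hpT⟩
        obtain ⟨n, hn⟩ := mem_iUnion.mp hpT
        exact mem_iUnion.mpr ⟨n, p, hp, hn⟩ }
  have hρ : ρ ≤ OuterMeasure.pi (fun _ => (G.restrict H).toOuterMeasure) := by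
    rw [OuterMeasure.le_pi]
    intro s _
    -- The sides of the box are arbitrary sets, so measurable hulls replace them before counting
    -- points.
    set t : Fin k → Set ℝ := fun i => toMeasurable (G.restrict H) (s i) ∩ H with ht
    have htm : ∀ i, MeasurableSet (t i) := fun i => (measurableSet_toMeasurable _ _).inter hH
    have hGt : ∀ i, G (t i) = G.restrict H (s i) := fun i => by
      rw [← measure_toMeasurable (s i), Measure.restrict_apply (measurableSet_toMeasurable _ _)]
    have hle : ∀ i, volume (J i) * G (t i) ≤ G.restrict H (s i) := fun i => by
      rw [hGt]; exact mul_le_of_le_one_left' (hJ1 i)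
    have hfin : ∀ i, volume (J i) * G (t i) < ⊤ := fun i => by
      refine (hle i).trans_lt (lt_of_le_of_lt (measure_mono (subset_univ _)) ?_)
      simpa using hGH
    have hind := h.iIndepFun_count k J t hJ htm hJN hfin
      (fun i j hij => Disjoint.set_prod_left (hdisj hij) _ _)
    have hev := hind.measure_inter_preimage_eq_mul Finset.univ (sets := fun _ => {0}ᶜ)
      (fun _ _ => MeasurableSet.of_discrete)
    calc ρ (pi univ s) ≤ P (⋂ i ∈ Finset.univ, (fun ω => (Ψ ω ∩ J i ×ˢ t i).encard) ⁻¹' {0}ᶜ) := by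
          refine measure_mono ?_
          rintro ω ⟨p, hp, hpT⟩
          simp only [Finset.mem_univ, iInter_true, mem_iInter, mem_preimage, mem_compl_iff,
            mem_singleton_iff, encard_eq_zero]
          intro i
          exact Nonempty.ne_empty ⟨p i, (hp i).1, (hp i).2.1,
            subset_toMeasurable _ _ (hpT i (mem_univ i)), (hp i).2.2⟩
      _ = ∏ i, P ((fun ω => (Ψ ω ∩ J i ×ˢ t i).encard) ⁻¹' {0}ᶜ) := hev
      _ ≤ ∏ i, (G.restrict H).toOuterMeasure (s i) := by
          refine Finset.prod_le_prod' fun i _ => ?_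
          exact (poisson_encard_ne_zero_le
            (h.hasLaw_count (J i) (t i) (hJ i) (htm i) (hJN i) (hfin i))).trans (hle i)
  refine (hρ T).trans ?_
  rw [Measure.pi]
  exact le_toMeasure_apply _ _ _

/-! ### The probability of a bad scale -/

theorem card_le_of_forall_le_add {S : Finset ℕ} {k : ℕ} (h : ∀ a ∈ S, ∀ b ∈ S, b ≤ a + k) :
    S.card ≤ k + 1 := by
  rcases S.eq_empty_or_nonempty with rfl | hne
  · simp
  · have hsub : S ⊆ Finset.Icc (S.min' hne) (S.min' hne + k) := fun b hb =>
      Finset.mem_Icc.mpr ⟨S.min'_le b hb, h _ (S.min'_mem hne) b hb⟩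
    refine (Finset.card_le_card hsub).trans ?_
    simp only [Nat.card_Icc]; omega

/-- The heights of three points in the columns `i, j, l` which are nearly collinear. -/
def collinearHeights (i j l : ℕ) : Set (Fin 3 → ℝ) :=
  {y | y 2 ≤ y 0 ∧ y 0 ≤ y 1 ∧ y 2 < y 1 ∧
    |(i : ℝ) * (y 1 - y 2) + j * (y 2 - y 0) + l * (y 0 - y 1)| ≤ 4 * (y 1 - y 2)}

theorem measurableSet_collinearHeights (i j l : ℕ) : MeasurableSet (collinearHeights i j l) := by
  have e0 := measurable_pi_apply (X := fun _ : Fin 3 => ℝ) 0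
  have e1 := measurable_pi_apply (X := fun _ : Fin 3 => ℝ) 1
  have e2 := measurable_pi_apply (X := fun _ : Fin 3 => ℝ) 2
  have e3 : MeasurableSet {y : Fin 3 → ℝ |
      |(i : ℝ) * (y 1 - y 2) + j * (y 2 - y 0) + l * (y 0 - y 1)| ≤ 4 * (y 1 - y 2)} :=
    measurableSet_le (by fun_prop) (by fun_prop)
  exact (measurableSet_le e2 e0).inter ((measurableSet_le e0 e1).inter
    ((measurableSet_lt e2 e1).inter e3))

/-- For given heights and columns `j, l`, near collinearity confines `i (y 1 - y 2)` to an interval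
of length `8 (y 1 - y 2)`, so at most nine `i` qualify. Summing over `i` then costs a constant
instead of a factor `M`. -/
theorem sum_measure_collinearHeights_le (μ : Measure (Fin 3 → ℝ)) (M j l : ℕ) :
    ∑ i ∈ Finset.range M, μ (collinearHeights i j l) ≤ 9 * μ univ := by
  classical
  calc ∑ i ∈ Finset.range M, μ (collinearHeights i j l)
      = ∑ i ∈ Finset.range M, ∫⁻ y, (collinearHeights i j l).indicator 1 y ∂μ := by
        refine Finset.sum_congr rfl fun i _ => ?_
        rw [lintegral_indicator_one (measurableSet_collinearHeights i j l)]
    _ = ∫⁻ y, ∑ i ∈ Finset.range M, (collinearHeights i j l).indicator 1 y ∂μ := by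
        rw [lintegral_finsetSum]
        exact fun i _ => measurable_one.indicator (measurableSet_collinearHeights i j l)
    _ ≤ ∫⁻ _, 9 ∂μ := by
        refine lintegral_mono fun y => ?_
        simp only [indicator_apply, Pi.one_apply, Finset.sum_boole]
        have : ((Finset.range M).filter fun i => y ∈ collinearHeights i j l).card ≤ 8 + 1 := by
          refine card_le_of_forall_le_add fun a ha b hb => ?_
          obtain ⟨-, -, h1, h2⟩ := (Finset.mem_filter.mp ha).2
          obtain ⟨-, -, -, h3⟩ := (Finset.mem_filter.mp hb).2
          have h2 := abs_le.mp h2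
          have h3 := abs_le.mp h3
          have h4 : (b : ℝ) * (y 1 - y 2) ≤ (a + 8) * (y 1 - y 2) := by linarith
          exact_mod_cast le_of_mul_le_mul_right h4 (sub_pos.mpr h1)
        exact_mod_cast this
    _ = 9 * μ univ := by rw [lintegral_const]

/-- Together with the rotation below this gives all permutations, so that a bad triple may be sorted
by height. -/
theorem abs_area_le_spread_swap {p q r : ℝ × ℝ} (h : |area p q r| ≤ spread p q r) :
    |area q p r| ≤ spread q p r := by
  have e1 : area q p r = -area p q r := by simp only [area]; ring
  have e2 : spread q p r = spread p q r := by
    simp only [spread]; rw [abs_sub_comm p.2, abs_sub_comm r.2 q.2, abs_sub_comm q.2 p.2]; ring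
  rwa [e1, e2, abs_neg]

theorem abs_area_le_spread_rotate {p q r : ℝ × ℝ} (h : |area p q r| ≤ spread p q r) :
    |area q r p| ≤ spread q r p := by
  have e1 : area q r p = area p q r := by simp only [area]; ring
  have e2 : spread q r p = spread p q r := by simp only [spread]; ring
  rwa [e1, e2]

/-- The `i`-th unit column of the strip of width `N`. -/
def column (N : ℝ) (i : ℕ) : Set ℝ := Ico (i : ℝ) (i + 1) ∩ Ioo 0 N

theorem measurableSet_column (N : ℝ) (i : ℕ) : MeasurableSet (column N i) :=
  measurableSet_Ico.inter measurableSet_Ioo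

theorem column_subset (N : ℝ) (i : ℕ) : column N i ⊆ Ioo 0 N := inter_subset_right

theorem volume_column_le (N : ℝ) (i : ℕ) : volume (column N i) ≤ 1 := by
  refine (measure_mono inter_subset_left).trans ?_
  simp

theorem mem_column_iff {N x : ℝ} {i : ℕ} (hx : x ∈ Ioo 0 N) : x ∈ column N i ↔ ⌊x⌋₊ = i := by
  rw [Nat.floor_eq_iff hx.1.le]
  exact ⟨fun h => h.1, fun h => ⟨h, hx⟩⟩

theorem disjoint_column (N : ℝ) {i j : ℕ} (h : i ≠ j) : Disjoint (column N i) (column N j) := by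
  rw [Set.disjoint_left]
  intro x hi hj
  exact h (((mem_column_iff hi.2).mp hi).symm.trans ((mem_column_iff hj.2).mp hj))

section BadScale

variable {Ω : Type*} [MeasurableSpace Ω] {Ψ : Ω → Set (ℝ × ℝ)} {N : ℝ} {G : Measure ℝ}
  {P : Measure Ω}

theorem IsStripPoisson.measure_no_low_point (h : IsStripPoisson Ψ N G P) {X Y : ℝ} (hX : 0 < X)
    (hXN : 2 * X < N) (hG : G (Iic Y) < ⊤) :
    P {ω | ¬ ∃ p ∈ Ψ ω, X ≤ p.1 ∧ p.1 ≤ 2 * X ∧ p.2 ≤ Y} =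
      ENNReal.ofReal (Real.exp (-(X * (G (Iic Y)).toReal))) := by
  have hvol : volume (Icc X (2 * X)) = ENNReal.ofReal X := by
    rw [Real.volume_Icc]; congr 1; ring
  have hlaw := h.hasLaw_count (Icc X (2 * X)) (Iic Y) measurableSet_Icc measurableSet_Iic
    (fun x hx => ⟨hX.trans_le hx.1, hx.2.trans_lt hXN⟩)
    (by rw [hvol]; exact ENNReal.mul_lt_top ENNReal.ofReal_lt_top hG)
  have := poisson_encard_eq_zero hlaw
  rw [hvol, ENNReal.toReal_mul, ENNReal.toReal_ofReal hX.le] at this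
  rw [← this]
  congr 1
  ext ω
  simp only [mem_ofPred_eq, encard_eq_zero, eq_empty_iff_forall_notMem, mem_inter_iff, mem_prod,
    mem_Icc, mem_Iic, not_exists, not_and, and_imp]

/-- If the left point of a pair at distance at most `6` has integer part `i`, both points lie in
`[i, i + 8)`, so overlapping windows of length `8` catch every close pair. -/
theorem IsStripPoisson.measure_close_pair_le [IsProbabilityMeasure P] (h : IsStripPoisson Ψ N G P) {H : ℝ} (M : ℕ)
    (hG : G (Iic H) < ⊤) :
    P (⋃ i ∈ Finset.range M, {ω | 2 ≤ (Ψ ω ∩ (Ico (i : ℝ) (i + 8) ∩ Ioo 0 N) ×ˢ Iic H).encard}) ≤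
      M * (8 * G (Iic H)) ^ 2 := by
  refine (measure_biUnion_finset_le _ _).trans ?_
  have hle : ∀ i : ℕ, volume (Ico (i : ℝ) (i + 8) ∩ Ioo 0 N) * G (Iic H) ≤ 8 * G (Iic H) := by
    intro i
    gcongr
    refine (measure_mono inter_subset_left).trans ?_
    simp
  have hbound : ∀ i ∈ Finset.range M,
      P {ω | 2 ≤ (Ψ ω ∩ (Ico (i : ℝ) (i + 8) ∩ Ioo 0 N) ×ˢ Iic H).encard} ≤
        (8 * G (Iic H)) ^ 2 := by
    intro i _
    refine (poisson_two_le_encard_le (h.hasLaw_count _ _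
      (measurableSet_Ico.inter measurableSet_Ioo) measurableSet_Iic inter_subset_right
      ((hle i).trans_lt (ENNReal.mul_lt_top (by simp) hG)))).trans ?_
    exact pow_le_pow_left' (hle i) 2
  refine (Finset.sum_le_sum hbound).trans ?_
  simp

/-- The power `M ^ 2` is essential: at scale `X`, `M` is about `X` and `G (Iic H)` about `X⁻¹`, so
the trivial `M ^ 3` would not decay. -/
theorem IsStripPoisson.measure_collinear_le [IsProbabilityMeasure P] (h : IsStripPoisson Ψ N G P) {H : ℝ} (M : ℕ)
    (hG : G (Iic H) < ⊤) :
    P (⋃ i ∈ Finset.range M, ⋃ j ∈ Finset.range M, ⋃ l ∈ Finset.range M,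
      {ω | (i ≠ j ∧ j ≠ l ∧ i ≠ l) ∧ ∃ p : Fin 3 → ℝ × ℝ,
        (∀ k, p k ∈ Ψ ω ∧ (p k).1 ∈ column N (![i, j, l] k) ∧ (p k).2 ∈ Iic H) ∧
        (fun k => (p k).2) ∈ collinearHeights i j l}) ≤
      9 * M ^ 2 * G (Iic H) ^ 3 := by
  set μ := Measure.pi (fun _ : Fin 3 => G.restrict (Iic H)) with hμ
  have hμuniv : μ univ = G (Iic H) ^ 3 := by
    have : IsFiniteMeasure (G.restrict (Iic H)) := ⟨by simpa using hG⟩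
    rw [hμ, Measure.pi_univ]
    simp
  have hone : ∀ i j l : ℕ, P {ω | (i ≠ j ∧ j ≠ l ∧ i ≠ l) ∧ ∃ p : Fin 3 → ℝ × ℝ,
        (∀ k, p k ∈ Ψ ω ∧ (p k).1 ∈ column N (![i, j, l] k) ∧ (p k).2 ∈ Iic H) ∧
        (fun k => (p k).2) ∈ collinearHeights i j l} ≤ μ (collinearHeights i j l) := by
    intro i j l
    by_cases hd : i ≠ j ∧ j ≠ l ∧ i ≠ l
    · refine (measure_mono fun ω hω => hω.2).trans ?_
      refine h.measure_exists_heights_le (J := fun k => column N (![i, j, l] k))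
        (fun k => measurableSet_column _ _) (fun k => column_subset _ _)
        (fun k => volume_column_le _ _) ?_ measurableSet_Iic hG _
      obtain ⟨h1, h2, h3⟩ := hd
      intro a b hab
      refine disjoint_column N ?_
      fin_cases a <;> fin_cases b <;> simp_all [eq_comm]
    · simp [hd]
  calc _ ≤ ∑ i ∈ Finset.range M, ∑ j ∈ Finset.range M, ∑ l ∈ Finset.range M,
        μ (collinearHeights i j l) := by
        refine (measure_biUnion_finset_le _ _).trans (Finset.sum_le_sum fun i _ => ?_)
        refine (measure_biUnion_finset_le _ _).trans (Finset.sum_le_sum fun j _ => ?_)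
        exact (measure_biUnion_finset_le _ _).trans (Finset.sum_le_sum fun l _ => hone i j l)
    _ = ∑ j ∈ Finset.range M, ∑ l ∈ Finset.range M, ∑ i ∈ Finset.range M,
        μ (collinearHeights i j l) := by
        rw [Finset.sum_comm]
        exact Finset.sum_congr rfl fun j _ => Finset.sum_comm
    _ ≤ ∑ j ∈ Finset.range M, ∑ l ∈ Finset.range M, 9 * μ univ :=
        Finset.sum_le_sum fun j _ => Finset.sum_le_sum fun l _ =>
          sum_measure_collinearHeights_le μ M j l
    _ = 9 * M ^ 2 * G (Iic H) ^ 3 := by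
        rw [hμuniv]; simp only [Finset.sum_const, Finset.card_range, nsmul_eq_mul]; ring

theorem IsStripPoisson.measure_not_goodScale_le [IsProbabilityMeasure P] (h : IsStripPoisson Ψ N G P) {X Y Z : ℝ}
    (hX : 0 < X) (hXN : 2 * X < N) (hY : 0 ≤ Y) (hG : G (Iic (12 * Y)) < ⊤) :
    P {ω | ¬ GoodScale (Ψ ω) X Y Z} ≤ ENNReal.ofReal (Real.exp (-(X * (G (Iic Y)).toReal))) +
      ((⌊Z⌋₊ + 1 : ℕ) * (8 * G (Iic (12 * Y))) ^ 2 +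
        9 * (⌊Z⌋₊ + 1 : ℕ) ^ 2 * G (Iic (12 * Y)) ^ 3) := by
  set M := ⌊Z⌋₊ + 1 with hM
  rw [← h.measure_no_low_point hX hXN
    ((measure_mono (Iic_subset_Iic.mpr (by linarith))).trans_lt hG)]
  refine le_trans ?_ (add_le_add le_rfl (add_le_add (h.measure_close_pair_le M hG)
    (h.measure_collinear_le M hG)))
  refine le_trans (measure_mono ?_) ((measure_union_le _ _).trans
    (add_le_add le_rfl (measure_union_le _ _)))
  intro ω hω
  by_contra hc
  simp only [mem_union, not_or] at hc
  obtain ⟨h1, h2, h3⟩ := hc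
  replace h1 := not_not.mp h1
  simp only [Finset.mem_range, mem_iUnion, mem_ofPred_eq, not_exists, exists_prop,
    not_and] at h2 h3
  have hfl : ∀ p ∈ Ψ ω, p.1 ≤ Z → ⌊p.1⌋₊ < M := fun p _ hpZ =>
    Nat.lt_succ_of_le (Nat.floor_mono hpZ)
  have hmem : ∀ p ∈ Ψ ω, p.1 ∈ Ioo 0 N := fun p hp => (h.subset ω hp).1
  have hsep : ∀ p ∈ Ψ ω, ∀ q ∈ Ψ ω, p ≠ q → p.1 ≤ Z → q.1 ≤ Z → p.2 ≤ 12 * Y → q.2 ≤ 12 * Y →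
      6 < |p.1 - q.1| := by
    have aux : ∀ p ∈ Ψ ω, ∀ q ∈ Ψ ω, p ≠ q → p.1 ≤ Z → q.1 ≤ Z → p.2 ≤ 12 * Y → q.2 ≤ 12 * Y →
        p.1 ≤ q.1 → 6 < |p.1 - q.1| := by
      intro p hp q hq hne hpZ hqZ hpY hqY hle
      by_contra hc
      push Not at hc
      refine h2 ⌊p.1⌋₊ (hfl p hp hpZ) ?_
      have f1 := Nat.floor_le (hmem p hp).1.le
      have f2 := Nat.lt_floor_add_one p.1
      have f3 := (abs_le.mp hc).1
      rw [← one_add_one_eq_two, ENat.add_one_le_iff (by simp), one_lt_encard_iff]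
      exact ⟨p, q, ⟨hp, ⟨⟨f1, by linarith⟩, hmem p hp⟩, hpY⟩,
        ⟨hq, ⟨⟨by linarith, by linarith⟩, hmem q hq⟩, hqY⟩, hne⟩
    intro p hp q hq hne hpZ hqZ hpY hqY
    rcases le_total p.1 q.1 with hle | hle
    · exact aux p hp q hq hne hpZ hqZ hpY hqY hle
    · rw [abs_sub_comm]; exact aux q hq p hp hne.symm hqZ hpZ hqY hpY hle
  have hfne : ∀ p ∈ Ψ ω, ∀ q ∈ Ψ ω, p ≠ q → p.1 ≤ Z → q.1 ≤ Z → p.2 ≤ 12 * Y → q.2 ≤ 12 * Y →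
      ⌊p.1⌋₊ ≠ ⌊q.1⌋₊ := by
    intro p hp q hq hne hpZ hqZ hpY hqY he
    have := hsep p hp q hq hne hpZ hqZ hpY hqY
    have f1 := Nat.floor_le (hmem p hp).1.le
    have f2 := Nat.lt_floor_add_one p.1
    have f3 := Nat.floor_le (hmem q hq).1.le
    have f4 := Nat.lt_floor_add_one q.1
    rw [he] at f1 f2
    rcases lt_abs.mp this with h | h <;> linarith
  -- For `r` lowest and `q` highest the spread is `2 (q.2 - r.2)`. Replacing abscissae by column
  -- indices costs one more spread, whence the `4` in `collinearHeights`. Separation puts the points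
  -- in distinct columns.
  have hsorted : ∀ p ∈ Ψ ω, ∀ q ∈ Ψ ω, ∀ r ∈ Ψ ω, p ≠ q → q ≠ r → p ≠ r → p.1 ≤ Z → q.1 ≤ Z →
      r.1 ≤ Z → p.2 ≤ 12 * Y → q.2 ≤ 12 * Y → r.2 ≤ 12 * Y → r.2 ≤ p.2 → p.2 ≤ q.2 → r.2 < q.2 →
      ¬ |area p q r| ≤ spread p q r := by
    intro p hp q hq r hr hpq hqr hpr hpZ hqZ hrZ hpY hqY hrY o1 o2 o3 hbad
    refine h3 ⌊p.1⌋₊ (hfl p hp hpZ) ⌊q.1⌋₊ (hfl q hq hqZ) ⌊r.1⌋₊ (hfl r hr hrZ)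
      ⟨hfne p hp q hq hpq hpZ hqZ hpY hqY, hfne q hq r hr hqr hqZ hrZ hqY hrY,
        hfne p hp r hr hpr hpZ hrZ hpY hrY⟩ ![p, q, r] ?_ ?_
    · intro k
      fin_cases k
      · exact ⟨hp, (mem_column_iff (hmem p hp)).mpr rfl, hpY⟩
      · exact ⟨hq, (mem_column_iff (hmem q hq)).mpr rfl, hqY⟩
      · exact ⟨hr, (mem_column_iff (hmem r hr)).mpr rfl, hrY⟩
    · refine ⟨o1, o2, o3, ?_⟩
      have hfloor : ∀ x ∈ Ψ ω, |(⌊x.1⌋₊ : ℝ) - x.1| ≤ 1 := fun x hx => by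
        have f1 := Nat.floor_le (hmem x hx).1.le
        have f2 := Nat.lt_floor_add_one x.1
        rw [abs_le]; constructor <;> linarith
      have h4 := abs_area_sub_le (u := fun x => (⌊x.1⌋₊ : ℝ)) (hfloor p hp) (hfloor q hq)
        (hfloor r hr)
      have h5 : spread p q r = 2 * (q.2 - r.2) := by
        simp only [spread]
        rw [abs_of_pos (sub_pos.mpr o3), abs_of_nonpos (sub_nonpos.mpr o1),
          abs_of_nonpos (sub_nonpos.mpr o2)]
        ring
      have h6 := abs_sub_abs_le_abs_sub (area (⌊p.1⌋₊, p.2) (⌊q.1⌋₊, q.2) (⌊r.1⌋₊, r.2))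
        (area p q r)
      show |area (⌊p.1⌋₊, p.2) (⌊q.1⌋₊, q.2) (⌊r.1⌋₊, r.2)| ≤ 4 * (q.2 - r.2)
      linarith
  refine hω ⟨h1, hsep, ?_⟩
  intro p hp q hq r hr hpq hqr hpr hne2 hpZ hqZ hrZ hpY hqY hrY
  by_contra hc
  push Not at hc
  have c2 := abs_area_le_spread_rotate hc
  have c3 := abs_area_le_spread_rotate c2
  rcases lt_or_gt_of_ne hne2 with o | o
  · rcases le_total p.2 q.2 with o1 | o1
    · exact hsorted q hq r hr p hp hqr hpr.symm hpq.symm hqZ hrZ hpZ hqY hrY hpY o1 o.le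
        (o1.trans_lt o) c2
    rcases le_total p.2 r.2 with o2 | o2
    · exact hsorted p hp r hr q hq hpr hqr.symm hpq hpZ hrZ hqZ hpY hrY hqY o1 o2 o
        (abs_area_le_spread_swap c3)
    · exact hsorted r hr p hp q hq hpr.symm hpq hqr.symm hrZ hpZ hqZ hrY hpY hqY o.le o2
        (o.trans_le o2) c3
  · rcases le_total p.2 r.2 with o1 | o1
    · exact hsorted r hr q hq p hp hqr.symm hpq.symm hpr.symm hrZ hqZ hpZ hrY hqY hpY o1 o.le
        (o1.trans_lt o) (abs_area_le_spread_swap c2)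
    rcases le_total p.2 q.2 with o2 | o2
    · exact hsorted p hp q hq r hr hpq hqr hpr hpZ hqZ hrZ hpY hqY hrY o1 o2 o hc
    · exact hsorted q hq p hp r hr hpq.symm hpr hqr hqZ hpZ hrZ hqY hpY hrY o.le o2
        (o.trans_le o2) (abs_area_le_spread_swap hc)

end BadScale

/-! ### The scales -/

/-- The exponent gained or lost at each scale. -/
def slack (a : ℝ) : ℝ := 1 / (2 * (2 + 3 * a))

/-- The typical height of the hull at abscissa `2 ^ k`, slightly enlarged. -/
def lowHeight (a : ℝ) (k : ℕ) : ℝ := ((2 : ℝ) ^ k) ^ (-(1 / a) + slack a)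

/-- The width of a box which contains the hull points of scale `2 ^ k`. -/
def boxWidth (a : ℝ) (k : ℕ) : ℝ :=
  (24 * (2 : ℝ) ^ (1 + 1 / a) + 1) * ((2 : ℝ) ^ k) ^ (1 + slack a)

/-- All scales from `2 ^ k₀` up to the width `N` of the strip are good. -/
def AllGood (I : Set (ℝ × ℝ)) (a N : ℝ) (k₀ : ℕ) : Prop :=
  ∀ k, k₀ ≤ k → 2 * 2 ^ k < N → GoodScale I (2 ^ k) (lowHeight a k) (boxWidth a k)

section Scales

variable {a : ℝ}

theorem slack_pos (ha : 0 < a) : 0 < slack a := by unfold slack; positivity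

/-- The three-point bound is `X ^ (2 (1 + η)) * X ^ (3 (-1 + a η)) = X ^ (-1 + (2 + 3 a) η)`. This
choice of `η` leaves `X ^ (-1/2)`. -/
theorem slack_mul (ha : 0 < a) : (2 + 3 * a) * slack a = 1 / 2 := by
  unfold slack; field_simp

theorem slack_lt (ha : 0 < a) : slack a < 1 / a := by
  unfold slack
  exact one_div_lt_one_div_of_lt ha (by linarith)

theorem one_le_two_pow_real (k : ℕ) : (1 : ℝ) ≤ 2 ^ k := one_le_pow₀ (by norm_num)

theorem lowHeight_pos (a : ℝ) (k : ℕ) : 0 < lowHeight a k := by unfold lowHeight; positivity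

theorem lowHeight_antitone (ha : 0 < a) : Antitone (lowHeight a) := by
  intro k l hkl
  refine Real.rpow_le_rpow_of_nonpos (by positivity) (pow_le_pow_right₀ (by norm_num) hkl) ?_
  linarith [slack_lt ha]

theorem tendsto_lowHeight (ha : 0 < a) : Tendsto (lowHeight a) atTop (𝓝 0) := by
  have h1 : Tendsto (fun k : ℕ => (2 : ℝ) ^ k) atTop atTop :=
    tendsto_pow_atTop_atTop_of_one_lt (by norm_num)
  have h2 := (tendsto_rpow_neg_atTop (y := 1 / a - slack a) (sub_pos.mpr (slack_lt ha))).comp h1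
  refine h2.congr fun k => ?_
  simp only [Function.comp_apply, lowHeight]
  congr 1; ring

/-- Every small slope belongs to some good scale. -/
theorem AllGood.exists_scale (ha : 0 < a) {I : Set (ℝ × ℝ)} {N : ℝ} {k₀ : ℕ}
    (h : AllGood I a N k₀) (hI : I ⊆ Ioo 0 N ×ˢ Ioi 0) (hk₀ : 2 * 2 ^ k₀ < N) {s : ℝ}
    (hsσ : s ≤ ((2 : ℝ) ^ k₀) ^ (-1 - 1 / a)) :
    ∃ k, k₀ ≤ k ∧ GoodScale I (2 ^ k) (lowHeight a k) (boxWidth a k) ∧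
      s * 2 ^ k ≤ lowHeight a k ∧
      ∀ p ∈ I, p.1 ≤ 24 * lowHeight a k / s + 1 → p.1 ≤ boxWidth a k := by
  classical
  have hη := slack_pos ha
  -- The scale of `s` is the largest `k` that still fits in the strip and satisfies `s ≤ X ^ (-1 -
  -- 1/a)`.
  set S : ℕ → Prop := fun k => k₀ ≤ k ∧ 2 * 2 ^ k < N ∧ s ≤ ((2 : ℝ) ^ k) ^ (-1 - 1 / a) with hS
  obtain ⟨n, hn⟩ : ∃ n : ℕ, N < n := exists_nat_gt N
  have hbound : ∀ k, S k → k ≤ n := by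
    rintro k ⟨-, hk, -⟩
    have h1 : (k : ℝ) < 2 ^ k := by exact_mod_cast Nat.lt_two_pow_self
    have : (k : ℝ) < n := by linarith [one_le_two_pow_real k]
    exact_mod_cast this.le
  have hSk : S (Nat.findGreatest S n) := Nat.findGreatest_spec (hbound k₀ ⟨le_rfl, hk₀, hsσ⟩)
    (show S k₀ from ⟨le_rfl, hk₀, hsσ⟩)
  set k := Nat.findGreatest S n with hk
  have hmax : ¬ S (k + 1) := fun hc => by
    have := Nat.le_findGreatest (hbound _ hc) hc
    omega
  obtain ⟨h1, h2, h3⟩ := hSk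
  set X : ℝ := 2 ^ k with hX
  have hX1 : 1 ≤ X := one_le_two_pow_real k
  have hX0 : 0 < X := by linarith
  refine ⟨k, h1, h k h1 h2, ?_, ?_⟩
  · calc s * X ≤ X ^ (-1 - 1 / a) * X := by gcongr
      _ = X ^ (-(1 / a)) := by
          rw [← Real.rpow_add_one hX0.ne']; congr 1; ring
      _ ≤ X ^ (-(1 / a) + slack a) := Real.rpow_le_rpow_of_exponent_le hX1 (by linarith)
  · intro p hp hple
    have hXη : X ≤ X ^ (1 + slack a) := by
      conv_lhs => rw [← Real.rpow_one X]
      exact Real.rpow_le_rpow_of_exponent_le hX1 (by linarith)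
    have h2b : (1 : ℝ) ≤ 2 ^ (1 + 1 / a) := Real.one_le_rpow (by norm_num) (by positivity)
    -- If the next scale fits, maximality bounds `s` from below by `(2 X) ^ (-1 - 1/a)`, which
    -- bounds `24 Y / s`. Otherwise `N ≤ 4 X` and the box covers the whole strip.
    by_cases hN : 2 * 2 ^ (k + 1) < N
    · have hs2 : ((2 : ℝ) ^ (k + 1)) ^ (-1 - 1 / a) < s := by
        by_contra hc
        exact hmax ⟨by omega, hN, not_lt.mp hc⟩
      have e : ((2 : ℝ) ^ (k + 1)) ^ (-1 - 1 / a) = (2 ^ (1 + 1 / a) * X ^ (1 + 1 / a))⁻¹ := by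
        rw [show (-1 - 1 / a : ℝ) = -(1 + 1 / a) by ring, Real.rpow_neg (by positivity),
          pow_succ, mul_comm, Real.mul_rpow (by norm_num) (by positivity)]
      rw [e] at hs2
      have hs3 : s⁻¹ ≤ 2 ^ (1 + 1 / a) * X ^ (1 + 1 / a) :=
        (inv_lt_of_inv_lt₀ (by positivity) hs2).le
      have e2 : lowHeight a k * X ^ (1 + 1 / a) = X ^ (1 + slack a) := by
        rw [lowHeight, ← Real.rpow_add hX0]; congr 1; ring
      calc p.1 ≤ 24 * lowHeight a k / s + 1 := hple
        _ ≤ 24 * lowHeight a k * (2 ^ (1 + 1 / a) * X ^ (1 + 1 / a)) + 1 := by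
            rw [div_eq_mul_inv]
            have := lowHeight_pos a k
            gcongr
        _ = 24 * 2 ^ (1 + 1 / a) * (lowHeight a k * X ^ (1 + 1 / a)) + 1 := by ring
        _ ≤ boxWidth a k := by
            rw [e2, boxWidth]; linarith
    · have h4 : p.1 < N := (hI hp).1.2
      rw [not_lt, pow_succ] at hN
      rw [boxWidth]
      nlinarith

end Scales

/-! ### Small values of the hazard measure -/

section Hazard

variable {F : Measure ℝ} {a C : ℝ}

theorem cdf_zero [IsProbabilityMeasure F] (hF : F (Iic 0) = 0) : cdf F 0 = 0 := by
  rw [cdf_eq_real, measureReal_def, hF, ENNReal.toReal_zero]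

/-- Near `0`, `F y` lies between `C/2` and `3 C/2` times `y ^ a`, and `x ≤ -log (1 - x) ≤ 2 x` for
`0 ≤ x < 1/2`. -/
theorem exists_hazardMeasure_bounds [IsProbabilityMeasure F] (hF : F (Iic 0) = 0)
    (hF_cont : Continuous (cdf F)) (hC : 0 < C)
    (hFC : (fun y : ℝ => cdf F y - C * y ^ a) =o[𝓝[>] 0] (fun y : ℝ => y ^ a)) :
    ∃ δ > 0, ∀ y, 0 < y → y < δ → hazardMeasure F (Iic y) < ⊤ ∧
      C / 2 * y ^ a ≤ (hazardMeasure F (Iic y)).toReal ∧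
      (hazardMeasure F (Iic y)).toReal ≤ 3 * C * y ^ a := by
  have h1 := hFC.def (half_pos hC)
  have h2 : ∀ᶠ y in 𝓝[>] (0 : ℝ), cdf F y < 1 / 2 := by
    have : Tendsto (cdf F) (𝓝[>] 0) (𝓝 (cdf F 0)) := hF_cont.continuousAt.mono_left nhdsWithin_le_nhds
    rw [cdf_zero hF] at this
    exact this.eventually (eventually_lt_nhds (by norm_num))
  obtain ⟨δ, hδ, hb⟩ := mem_nhdsGT_iff_exists_Ioo_subset.mp (h1.and h2)
  refine ⟨δ, hδ, fun y hy hyδ => ?_⟩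
  obtain ⟨hb1, hb2⟩ := hb ⟨hy, hyδ⟩
  have hya : 0 < y ^ a := Real.rpow_pos_of_pos hy a
  rw [Real.norm_eq_abs, Real.norm_eq_abs, abs_of_pos hya, abs_le] at hb1
  have hx0 := cdf_nonneg F y
  set x := cdf F y
  have hpos : 0 < 1 - x := by linarith
  have hlog1 : x ≤ -Real.log (1 - x) := by linarith [Real.log_le_sub_one_of_pos hpos]
  have hlog2 : -Real.log (1 - x) ≤ 2 * x := by
    have h3 := Real.one_sub_inv_le_log_of_pos hpos
    have h4 : (1 - x)⁻¹ ≤ 1 + 2 * x := by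
      rw [inv_le_iff_one_le_mul₀ hpos]; nlinarith
    linarith
  rw [hazardMeasure_Iic, if_pos (by linarith), ENNReal.toReal_ofReal (by linarith)]
  exact ⟨ENNReal.ofReal_lt_top, by linarith, by linarith⟩

end Hazard

section ScaleBound

variable {F : Measure ℝ} {a C : ℝ}

/-- The probability that the scale `2 ^ k` is bad decays geometrically. -/
theorem exists_not_goodScale_bound [IsProbabilityMeasure F] (hF : F (Iic 0) = 0)
    (hF_cont : Continuous (cdf F)) (ha : 0 < a) (hC : 0 < C)
    (hFC : (fun y : ℝ => cdf F y - C * y ^ a) =o[𝓝[>] 0] (fun y : ℝ => y ^ a)) :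
    ∃ D ρ : ℝ, 0 ≤ D ∧ 0 ≤ ρ ∧ ρ < 1 ∧ ∃ k₁ : ℕ, ∀ {Ω : Type _} [MeasurableSpace Ω]
      {P : Measure Ω} [IsProbabilityMeasure P] {Ψ : Ω → Set (ℝ × ℝ)} {N : ℝ},
      IsStripPoisson Ψ N (hazardMeasure F) P → ∀ k, k₁ ≤ k → 2 * 2 ^ k < N →
      P {ω | ¬ GoodScale (Ψ ω) (2 ^ k) (lowHeight a k) (boxWidth a k)} ≤
        ENNReal.ofReal (D * ρ ^ k) := by
  obtain ⟨δ, hδ, hb⟩ := exists_hazardMeasure_bounds hF hF_cont hC hFC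
  set η := slack a with hηdef
  have hη : 0 < η := slack_pos ha
  have hη2 : (2 + 3 * a) * η = 1 / 2 := slack_mul ha
  set κ : ℝ := 24 * (2 : ℝ) ^ (1 + 1 / a) + 1 with hκ
  have hκ1 : 1 ≤ κ := by
    have : (0 : ℝ) < 2 ^ (1 + 1 / a) := by positivity
    rw [hκ]; linarith
  set c₁ := C / 2 with hc₁
  set c₃ := 3 * C * 12 ^ a with hc₃
  have hc₁0 : 0 < c₁ := by positivity
  have hc₃0 : 0 < c₃ := by positivity
  obtain ⟨k₁, hk₁⟩ : ∃ k₁ : ℕ, ∀ k, k₁ ≤ k → 12 * lowHeight a k < δ := by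
    have h1 := (tendsto_lowHeight ha).const_mul 12
    rw [mul_zero] at h1
    exact eventually_atTop.mp (h1.eventually (eventually_lt_nhds hδ))
  -- One summand for each way to be bad: no low point, a close pair, a nearly collinear triple. All
  -- three are bounded by a multiple of `X ^ (-(a η))`.
  refine ⟨c₁⁻¹ + (2 * κ) * (8 * c₃) ^ 2 + 9 * (2 * κ) ^ 2 * c₃ ^ 3, (2 : ℝ) ^ (-(a * η)),
    by positivity, by positivity,
    Real.rpow_lt_one_of_one_lt_of_neg (by norm_num) (by nlinarith), k₁, ?_⟩
  intro Ω _ P _ Ψ N h k hk hkN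
  set X : ℝ := 2 ^ k with hX
  have hX1 : 1 ≤ X := one_le_two_pow_real k
  have hX0 : 0 < X := by linarith
  have hY0 := lowHeight_pos a k
  set Y := lowHeight a k with hY
  have h12 := hk₁ k hk
  obtain ⟨-, hlow, -⟩ := hb Y hY0 (by linarith)
  obtain ⟨hfin, -, hup⟩ := hb (12 * Y) (by linarith) h12
  have hYa : Y ^ a = X ^ (-1 + a * η) := by
    rw [hY, lowHeight, ← Real.rpow_mul (by positivity)]
    congr 1; rw [← hηdef]; field_simp
  have hρ : ((2 : ℝ) ^ (-(a * η))) ^ k = X ^ (-(a * η)) := by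
    rw [hX, ← Real.rpow_natCast, ← Real.rpow_natCast, ← Real.rpow_mul (by norm_num),
      ← Real.rpow_mul (by norm_num), mul_comm]
  set g := (hazardMeasure F (Iic (12 * Y))).toReal with hg
  have hg0 : 0 ≤ g := ENNReal.toReal_nonneg
  have hgle : g ≤ c₃ * X ^ (-1 + a * η) := by
    rw [← hYa, hc₃, mul_assoc, ← Real.mul_rpow (by norm_num) hY0.le]
    exact hup
  have hM : ((⌊boxWidth a k⌋₊ + 1 : ℕ) : ℝ) ≤ 2 * κ * X ^ (1 + η) := by
    have h1 : 1 ≤ X ^ (1 + η) := Real.one_le_rpow hX1 (by linarith)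
    have h2 : boxWidth a k = κ * X ^ (1 + η) := rfl
    push_cast
    rw [h2]
    have := Nat.floor_le (show 0 ≤ κ * X ^ (1 + η) by positivity)
    nlinarith
  set M := ⌊boxWidth a k⌋₊ + 1 with hMdef
  have hmain := h.measure_not_goodScale_le (Z := boxWidth a k) hX0 hkN hY0.le hfin
  rw [← hMdef, ← ENNReal.ofReal_toReal hfin.ne, ← hg] at hmain
  refine hmain.trans ?_
  have e1 : ((M : ℕ) : ℝ≥0∞) * (8 * ENNReal.ofReal g) ^ 2 + 9 * (M : ℕ) ^ 2 * ENNReal.ofReal g ^ 3 =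
      ENNReal.ofReal (M * (8 * g) ^ 2 + 9 * M ^ 2 * g ^ 3) := by
    rw [ENNReal.ofReal_add (by positivity) (by positivity), ENNReal.ofReal_mul (by positivity),
      ENNReal.ofReal_mul (by positivity), ENNReal.ofReal_mul (by positivity),
      ENNReal.ofReal_pow (by positivity), ENNReal.ofReal_pow (by positivity),
      ENNReal.ofReal_mul (by positivity), ENNReal.ofReal_pow (by positivity)]
    simp
  rw [e1, ← ENNReal.ofReal_add (Real.exp_pos _).le (by positivity)]
  refine ENNReal.ofReal_le_ofReal ?_
  rw [hρ, add_mul, add_mul, add_assoc]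
  refine add_le_add ?_ (add_le_add ?_ ?_)
  -- The enlarged height makes the expected number of low points at least `c₁ X ^ (a η)`, and `exp
  -- (-z) ≤ 1 / z` suffices.
  · set w := (hazardMeasure F (Iic Y)).toReal with hw
    have h1 : c₁ * X ^ (a * η) ≤ X * w := by
      calc c₁ * X ^ (a * η) = X * (c₁ * X ^ (-1 + a * η)) := by
            rw [show a * η = 1 + (-1 + a * η) by ring, Real.rpow_add hX0, Real.rpow_one]; ring_nf
        _ ≤ X * w := by rw [← hYa]; gcongr
    have h2 : 0 < c₁ * X ^ (a * η) := by positivity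
    calc Real.exp (-(X * w)) ≤ Real.exp (-(c₁ * X ^ (a * η))) := Real.exp_le_exp.mpr (by linarith)
      _ ≤ (c₁ * X ^ (a * η))⁻¹ := by
          rw [Real.exp_neg]
          exact inv_anti₀ h2 (by linarith [Real.add_one_le_exp (c₁ * X ^ (a * η))])
      _ = c₁⁻¹ * X ^ (-(a * η)) := by rw [mul_inv, Real.rpow_neg hX0.le]
  · calc (M : ℝ) * (8 * g) ^ 2
        ≤ (2 * κ * X ^ (1 + η)) * (8 * (c₃ * X ^ (-1 + a * η))) ^ 2 := by gcongr
      _ = 2 * κ * (8 * c₃) ^ 2 * X ^ ((1 + η) + (-1 + a * η) * (2 : ℕ)) := by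
          rw [Real.rpow_add hX0 (1 + η), Real.rpow_mul_natCast hX0.le]; ring
      _ ≤ 2 * κ * (8 * c₃) ^ 2 * X ^ (-(a * η)) := by
          gcongr
          -- The exponent is `-1 + η + 2 a η ≤ -a η`, because `η + 3 a η ≤ (2 + 3 a) η = 1/2`.
          push_cast; nlinarith
  · calc 9 * (M : ℝ) ^ 2 * g ^ 3
        ≤ 9 * (2 * κ * X ^ (1 + η)) ^ 2 * (c₃ * X ^ (-1 + a * η)) ^ 3 := by gcongr
      _ = 9 * (2 * κ) ^ 2 * c₃ ^ 3 * X ^ ((1 + η) * (2 : ℕ) + (-1 + a * η) * (3 : ℕ)) := by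
          rw [Real.rpow_add hX0 ((1 + η) * (2 : ℕ)), Real.rpow_mul_natCast hX0.le,
            Real.rpow_mul_natCast hX0.le]; ring
      _ ≤ 9 * (2 * κ) ^ 2 * c₃ ^ 3 * X ^ (-(a * η)) := by
          gcongr
          -- The exponent is `-1/2`, and `a η ≤ 1/6`.
          push_cast; nlinarith

/-- With probability close to `1` all scales beyond a fixed one are good, uniformly in the width
of the strip. -/
theorem exists_allGood [IsProbabilityMeasure F] (hF : F (Iic 0) = 0)
    (hF_cont : Continuous (cdf F)) (ha : 0 < a) (hC : 0 < C)
    (hFC : (fun y : ℝ => cdf F y - C * y ^ a) =o[𝓝[>] 0] (fun y : ℝ => y ^ a))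
    {ε : ℝ≥0∞} (hε : ε ≠ 0) {δ : ℝ} (hδ : 0 < δ) :
    ∃ k₀ : ℕ, 12 * lowHeight a k₀ < δ ∧ ∀ {Ω : Type _} [MeasurableSpace Ω]
      {P : Measure Ω} [IsProbabilityMeasure P] {Ψ : Ω → Set (ℝ × ℝ)} {N : ℝ},
      IsStripPoisson Ψ N (hazardMeasure F) P → P {ω | ¬ AllGood (Ψ ω) a N k₀} ≤ ε := by
  obtain ⟨D, ρ, hD, hρ0, hρ1, k₁, hk₁⟩ := exists_not_goodScale_bound hF hF_cont ha hC hFC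
  have hlim : Tendsto (fun k => ENNReal.ofReal (D * ρ ^ k * (1 - ρ)⁻¹)) atTop (𝓝 0) := by
    have h1 := ((tendsto_pow_atTop_nhds_zero_of_lt_one hρ0 hρ1).const_mul D).mul_const (1 - ρ)⁻¹
    rw [mul_zero, zero_mul] at h1
    rw [← ENNReal.ofReal_zero]
    exact (ENNReal.continuous_ofReal.tendsto 0).comp h1
  have hlow : Tendsto (fun k => 12 * lowHeight a k) atTop (𝓝 0) := by
    have h1 := (tendsto_lowHeight ha).const_mul 12
    rwa [mul_zero] at h1
  obtain ⟨k₀, h1, h2, h3⟩ := ((hlim.eventually (ge_mem_nhds (pos_iff_ne_zero.mpr hε))).and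
    ((hlow.eventually (eventually_lt_nhds hδ)).and (eventually_ge_atTop k₁))).exists
  refine ⟨k₀, h2, fun {Ω _ P _ Ψ N} h => le_trans ?_ h1⟩
  calc P {ω | ¬ AllGood (Ψ ω) a N k₀}
      ≤ P (⋃ j : ℕ, {ω | 2 * 2 ^ (k₀ + j) < N ∧
          ¬ GoodScale (Ψ ω) (2 ^ (k₀ + j)) (lowHeight a (k₀ + j)) (boxWidth a (k₀ + j))}) := by
        refine measure_mono fun ω hω => ?_
        simp only [AllGood, mem_ofPred_eq, not_forall] at hω
        obtain ⟨k, hk, hkN, hbad⟩ := hω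
        obtain ⟨j, rfl⟩ := Nat.exists_eq_add_of_le hk
        exact mem_iUnion.mpr ⟨j, hkN, hbad⟩
    _ ≤ ∑' j : ℕ, P {ω | 2 * 2 ^ (k₀ + j) < N ∧
          ¬ GoodScale (Ψ ω) (2 ^ (k₀ + j)) (lowHeight a (k₀ + j)) (boxWidth a (k₀ + j))} :=
        measure_iUnion_le _
    _ ≤ ∑' j : ℕ, ENNReal.ofReal (D * ρ ^ k₀ * ρ ^ j) := by
        refine ENNReal.tsum_le_tsum fun j => ?_
        by_cases hN : 2 * 2 ^ (k₀ + j) < N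
        · refine (measure_mono fun ω hω => hω.2).trans ((hk₁ h (k₀ + j) (by omega) hN).trans ?_)
          rw [pow_add, mul_assoc]
        · simp [hN]
    _ = ENNReal.ofReal (D * ρ ^ k₀ * (1 - ρ)⁻¹) := by
        rw [← ENNReal.ofReal_tsum_of_nonneg (fun j => by positivity)
          ((summable_geometric_of_lt_one hρ0 hρ1).mul_left _), tsum_mul_left,
          tsum_geometric_of_lt_one hρ0 hρ1]

end ScaleBound

/-! ### Rescaling the Poisson process -/

/-- The horizontal affine map `(x, y) ↦ (α x + β, y)`. -/
def horizontal (α β : ℝ) (p : ℝ × ℝ) : ℝ × ℝ := (α * p.1 + β, p.2)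

theorem horizontal_injective {α : ℝ} (hα : α ≠ 0) (β : ℝ) :
    Function.Injective (horizontal α β) := by
  intro p q h
  simp only [horizontal, Prod.mk.injEq, add_left_inj, mul_eq_mul_left_iff, hα, or_false] at h
  exact Prod.ext h.1 h.2

instance (F : Measure ℝ) : SFinite (hazardMeasure F) := by
  unfold hazardMeasure; infer_instance

theorem hazardMeasure_Iic_zero {F : Measure ℝ} [IsProbabilityMeasure F] (hF : F (Iic 0) = 0) :
    hazardMeasure F (Iic 0) = 0 := by
  rw [hazardMeasure_Iic, cdf_zero hF]
  simp

theorem hazardMeasure_inter_Ioi {F : Measure ℝ} [IsProbabilityMeasure F] (hF : F (Iic 0) = 0)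
    (H : Set ℝ) : hazardMeasure F (H ∩ Ioi 0) = hazardMeasure F H := by
  refine measure_inter_conull ?_
  have e : (Ioi (0 : ℝ))ᶜ = Iic 0 := compl_Ioi
  rw [e, hazardMeasure_Iic_zero hF]

/-- The two maps that send the unit strip onto the strip of width `n`. -/
def IsRescaling (n : ℕ) (α β : ℝ) : Prop := (α = n ∧ β = 0) ∨ (α = -n ∧ β = n)

section Rescaling

variable {F : Measure ℝ} [IsProbabilityMeasure F] {n : ℕ} {α β : ℝ}

theorem IsRescaling.ne_zero (h : IsRescaling n α β) (hn : n ≠ 0) : α ≠ 0 := by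
  have : (n : ℝ) ≠ 0 := by exact_mod_cast hn
  rcases h with ⟨rfl, -⟩ | ⟨rfl, -⟩
  · exact this
  · exact neg_ne_zero.mpr this

theorem IsRescaling.abs_eq (h : IsRescaling n α β) : |α| = n := by
  rcases h with ⟨rfl, -⟩ | ⟨rfl, -⟩ <;> simp

theorem IsRescaling.mem_Ioo (h : IsRescaling n α β) (hn : n ≠ 0) {x : ℝ} :
    α * x + β ∈ Ioo (0 : ℝ) n ↔ x ∈ Ioo (0 : ℝ) 1 := by
  have hn0 : (0 : ℝ) < n := by exact_mod_cast Nat.pos_of_ne_zero hn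
  rcases h with ⟨rfl, rfl⟩ | ⟨rfl, rfl⟩
  · simp only [mem_Ioo, add_zero]
    rw [mul_pos_iff_of_pos_left hn0, mul_lt_iff_lt_one_right hn0]
  · simp only [mem_Ioo]
    constructor
    · rintro ⟨h1, h2⟩; constructor <;> nlinarith
    · rintro ⟨h1, h2⟩; constructor <;> nlinarith

theorem IsRescaling.intensity_preimage (h : IsRescaling n α β) (hn : n ≠ 0) (hF : F (Iic 0) = 0)
    {J : Set ℝ} (hJ : J ⊆ Ioo (0 : ℝ) n) (H : Set ℝ) :
    intensity F n (((fun x => α * x + β) ⁻¹' J) ×ˢ (H ∩ Ioi 0)) =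
      volume J * hazardMeasure F H := by
  have hn0 : (n : ℝ≥0∞) ≠ 0 := by exact_mod_cast hn
  have hsub : (fun x => α * x + β) ⁻¹' J ⊆ Ioi 0 := fun x hx =>
    ((h.mem_Ioo hn).mp (hJ hx)).1
  have hvol : volume ((fun x => α * x + β) ⁻¹' J) = (n : ℝ≥0∞)⁻¹ * volume J := by
    have e : (fun x => α * x + β) ⁻¹' J = (fun x => α * x) ⁻¹' ((fun x => x + β) ⁻¹' J) := rfl
    rw [e, Real.volume_preimage_mul_left (h.ne_zero hn), measure_preimage_add_right, abs_inv,
      h.abs_eq, ENNReal.ofReal_inv_of_pos (by exact_mod_cast Nat.pos_of_ne_zero hn),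
      ENNReal.ofReal_natCast]
  rw [intensity, Measure.smul_apply, Measure.prod_prod, hazardMeasure_inter_Ioi hF,
    Measure.restrict_eq_self _ hsub, hvol, smul_eq_mul, ← mul_assoc, ← mul_assoc,
    ENNReal.mul_inv_cancel hn0 (ENNReal.natCast_ne_top n), one_mul]

/-- The preimage of a column set is `n` times shorter, which cancels the factor `n` of the
intensity. Only the width of the strip still depends on `n`, hence the uniformity of all later
bounds. -/
theorem IsRescaling.isStripPoisson (h : IsRescaling n α β) (hn : n ≠ 0) (hF : F (Iic 0) = 0)
    {Ω : Type*} [MeasurableSpace Ω] {Φ : Ω → Set (ℝ × ℝ)} {P : Measure Ω}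
    (hΦ : IsPoissonPointProcess Φ (intensity F n) P) :
    IsStripPoisson (fun ω => horizontal α β '' (Φ ω ∩ strip)) n (hazardMeasure F) P := by
  have hinj := horizontal_injective (h.ne_zero hn) β
  have hcount : ∀ J H : Set ℝ, J ⊆ Ioo (0 : ℝ) n → ∀ ω,
      (horizontal α β '' (Φ ω ∩ strip) ∩ J ×ˢ H).encard =
        (Φ ω ∩ ((fun x => α * x + β) ⁻¹' J) ×ˢ (H ∩ Ioi 0)).encard := by
    intro J H hJ ω
    rw [← image_inter_preimage, hinj.encard_image]
    congr 1
    ext p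
    simp only [strip, mem_inter_iff, mem_prod, mem_preimage, horizontal, mem_Ioi]
    constructor
    · rintro ⟨⟨h1, h2, h3⟩, h4, h5⟩; exact ⟨h1, h4, h5, h3⟩
    · rintro ⟨h1, h4, h5, h3⟩; exact ⟨⟨h1, (h.mem_Ioo hn).mp (hJ h4), h3⟩, h4, h5⟩
  have hmeas : ∀ J H : Set ℝ, MeasurableSet J → MeasurableSet H →
      MeasurableSet (((fun x => α * x + β) ⁻¹' J) ×ˢ (H ∩ Ioi (0 : ℝ))) := fun J H hJ hH =>
    (((by fun_prop : Measurable fun x : ℝ => α * x + β)) hJ).prod (hH.inter measurableSet_Ioi)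
  refine ⟨?_, ?_, ?_⟩
  · rintro ω _ ⟨p, ⟨-, h1, h2⟩, rfl⟩
    exact ⟨(h.mem_Ioo hn).mpr h1, h2⟩
  · intro J H hJ hH hJn hfin
    have e := h.intensity_preimage hn hF hJn H
    have := hΦ.hasLaw_count _ (hmeas J H hJ hH) (by rwa [e])
    simpa only [hcount J H hJn, e] using this
  · intro k J H hJ hH hJn hfin hdisj
    have := hΦ.iIndepFun_count k _ (fun i => hmeas (J i) (H i) (hJ i) (hH i))
      (fun i => by rw [h.intensity_preimage hn hF (hJn i)]; exact hfin i) (by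
        intro i j hij
        have := (hdisj hij).preimage (horizontal α β)
        refine this.mono ?_ ?_ <;> exact fun p hp => ⟨hp.1, hp.2.1⟩)
    have e : (fun i ω => (horizontal α β '' (Φ ω ∩ strip) ∩ J i ×ˢ H i).encard) =
        fun i ω => (Φ ω ∩ ((fun x => α * x + β) ⁻¹' J i) ×ˢ (H i ∩ Ioi 0)).encard := by
      funext i ω; exact hcount (J i) (H i) (hJn i) ω
    rw [e]; exact this

/-- The abscissa of the left edge of the column, in rescaled coordinates. -/
def rescaledEdge (α β : ℝ) (p : ℝ × ℝ) : ℝ :=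
  if 0 < α then (⌊p.1⌋ : ℝ) else β - ⌊β - p.1⌋

theorem IsRescaling.horizontal_toLeftEdge (h : IsRescaling n α β) (hn : n ≠ 0)
    (A : Set (ℝ × ℝ)) :
    horizontal α β '' (toLeftEdge n '' A) = shift (rescaledEdge α β) (horizontal α β '' A) := by
  have hn0 : (0 : ℝ) < n := by exact_mod_cast Nat.pos_of_ne_zero hn
  rw [shift, image_image, image_image]
  refine image_congr fun p _ => ?_
  rcases h with ⟨rfl, rfl⟩ | ⟨rfl, rfl⟩
  · simp only [horizontal, toLeftEdge, rescaledEdge, if_pos hn0, add_zero]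
    rw [mul_div_cancel₀ _ hn0.ne']
  · simp only [horizontal, toLeftEdge, rescaledEdge, if_neg (not_lt.mpr (neg_nonpos.mpr hn0.le))]
    congr 1
    rw [show (n : ℝ) - (-n * p.1 + n) = n * p.1 by ring]
    field_simp
    ring

theorem abs_rescaledEdge_sub_le (p : ℝ × ℝ) : |rescaledEdge α β p - p.1| ≤ 1 := by
  unfold rescaledEdge
  split_ifs
  · have h1 := Int.floor_le p.1
    have h2 := Int.lt_floor_add_one p.1
    rw [abs_le]; constructor <;> linarith
  · have h1 := Int.floor_le (β - p.1)
    have h2 := Int.lt_floor_add_one (β - p.1)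
    rw [abs_le]; constructor <;> linarith

/-- Integrality means that at most `L + 1` abscissae are `≤ L`, however many points the unbounded
strip contains. -/
theorem IsRescaling.rescaledEdge_eq_natCast (h : IsRescaling n α β) {p : ℝ × ℝ}
    (hp : p.1 ∈ Ioo (0 : ℝ) n) : ∃ m : ℕ, rescaledEdge α β p = m := by
  have key : ∀ z : ℤ, rescaledEdge α β p = z → 0 ≤ z → ∃ m : ℕ, rescaledEdge α β p = m :=
    fun z hz h0 => ⟨z.toNat, by rw [hz]; exact_mod_cast (Int.toNat_of_nonneg h0).symm⟩
  have hn0 : (0 : ℝ) < n := hp.1.trans hp.2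
  rcases h with ⟨rfl, rfl⟩ | ⟨rfl, rfl⟩
  · refine key ⌊p.1⌋ (by simp only [rescaledEdge, if_pos hn0]) (Int.floor_nonneg.mpr hp.1.le)
  · refine key (n - ⌊(n : ℝ) - p.1⌋) ?_ ?_
    · simp only [rescaledEdge, if_neg (not_lt.mpr (neg_nonpos.mpr hn0.le))]; push_cast; rfl
    · have : ⌊(n : ℝ) - p.1⌋ ≤ n := by
        rw [← Int.cast_le (R := ℝ)]
        exact (Int.floor_le _).trans (by push_cast; linarith [hp.1])
      omega

end Rescaling

/-! ### Comparison at all scales -/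

theorem ncard_pos_slopes_le {T : Set ℝ} (hT : T.Finite) (σ : ℝ) :
    (T ∩ Ioi 0).ncard ≤ (T ∩ Ioc 0 σ).ncard + (T ∩ Ioi σ).ncard := by
  refine (ncard_le_ncard ?_ ((hT.subset inter_subset_left).union
    (hT.subset inter_subset_left))).trans (ncard_union_le _ _)
  rintro x ⟨hx, h0⟩
  rcases le_or_gt x σ with h | h
  · exact Or.inl ⟨hx, h0, h⟩
  · exact Or.inr ⟨hx, h⟩

/-- Positive slopes up to `σ` inject in both directions, the original set being its own trivial
perturbation. Slopes above `σ` number at most `K` for `A` and, by integrality, at most `L + 1` for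
the shifted `B`. -/
theorem AllGood.abs_ncard_sub_le {a N : ℝ} {k₀ L K : ℕ} {I A B : Set (ℝ × ℝ)} {v : ℝ × ℝ → ℝ}
    (ha : 0 < a) (h : AllGood I a N k₀) (hI : I ⊆ Ioo 0 N ×ˢ Ioi 0) (hk₀ : 2 * 2 ^ k₀ < N)
    (hv : ∀ p ∈ I, |v p - p.1| ≤ 1) (hvn : ∀ p ∈ I, ∃ m : ℕ, v p = m) (hAI : A ⊆ I) (hBI : B ⊆ I)
    (hAB : ∀ p ∈ I, p.2 ≤ 12 * lowHeight a k₀ → p ∈ A ∧ p ∈ B)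
    (hL : 2 * 2 ^ k₀ + 1 + lowHeight a k₀ / ((2 : ℝ) ^ k₀) ^ (-1 - 1 / a) ≤ L)
    (hAfin : A.Finite) (hBfin : (slopes (shift v B)).Finite)
    (hK : {p ∈ A | p.1 ≤ L}.ncard ≤ K) :
    |((slopes A ∩ Ioi 0).ncard : ℝ) - ((slopes (shift v B) ∩ Ioi 0).ncard : ℝ)| ≤ K + L + 1 := by
  set σ : ℝ := ((2 : ℝ) ^ k₀) ^ (-1 - 1 / a) with hσ
  have hσ0 : 0 < σ := by positivity
  have hshift : shift Prod.fst A = A := by simp [shift]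
  have hAslopes : (slopes A).Finite := finite_slopes (hAfin.image _)
  have hu : ∀ p ∈ I, |p.1 - p.1| ≤ 1 := fun p _ => by simp
  have hu0 : ∀ p ∈ I, 0 ≤ p.1 := fun p hp => (hI hp).1.1.le
  have hv0 : ∀ p ∈ I, 0 ≤ v p := fun p hp => by
    obtain ⟨m, hm⟩ := hvn p hp; rw [hm]; positivity
  have hy0 : ∀ p ∈ I, 0 ≤ p.2 := fun p hp => (hI hp).2.le
  have hscale : ∀ s, 0 < s → s ≤ σ → ∃ X Y Z : ℝ, GoodScale I X Y Z ∧ 1 ≤ X ∧ s * X ≤ Y ∧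
      (∀ p ∈ I, p.1 ≤ 24 * Y / s + 1 → p.1 ≤ Z) ∧ ∀ p ∈ I, p.2 ≤ 12 * Y → p ∈ A ∧ p ∈ B := by
    intro s hs hsσ
    obtain ⟨k, hk, h1, h2, h3⟩ := h.exists_scale ha hI hk₀ hsσ
    refine ⟨2 ^ k, lowHeight a k, boxWidth a k, h1, one_le_two_pow_real k, h2, h3, ?_⟩
    exact fun p hp hpy => hAB p hp (hpy.trans (by linarith [lowHeight_antitone ha hk]))
  have hscale' : ∀ s, 0 < s → s ≤ σ → ∃ X Y Z : ℝ, GoodScale I X Y Z ∧ 1 ≤ X ∧ s * X ≤ Y ∧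
      (∀ p ∈ I, p.1 ≤ 24 * Y / s + 1 → p.1 ≤ Z) ∧ ∀ p ∈ I, p.2 ≤ 12 * Y → p ∈ B ∧ p ∈ A := by
    intro s hs hsσ
    obtain ⟨X, Y, Z, h1, h2, h3, h4, h5⟩ := hscale s hs hsσ
    exact ⟨X, Y, Z, h1, h2, h3, h4, fun p hp hpy => (h5 p hp hpy).symm⟩
  -- The low point of the first scale is the reference that confines minimisers of slope above `σ`
  -- to abscissae `≤ L`.
  obtain ⟨p₀, hp₀, -, hx₀, hy₀⟩ := (h k₀ le_rfl hk₀).exists_low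
  obtain ⟨hp₀A, hp₀B⟩ := hAB p₀ hp₀ (by linarith [lowHeight_pos a k₀])
  have d1 := ncard_small_slopes_le hu hv hu0 hv0 hy0 hAI hBI hscale hBfin
  have d2 := ncard_small_slopes_le hv hu hv0 hu0 hy0 hBI hAI hscale' (by rwa [hshift])
  have hEA : (Prod.fst '' {p ∈ A | p.1 ≤ (L : ℝ)}).Finite :=
    (hAfin.subset fun p hp => hp.1).image _
  have d3 := ncard_large_slopes_le (u := Prod.fst) (fun p hp => hy0 p (hAI hp)) hσ0 hp₀A hx₀ hy₀
    (by linarith) hEA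
  have hsub : v '' {p ∈ B | v p ≤ L} ⊆ (fun m : ℕ => (m : ℝ)) '' Iic L := by
    rintro _ ⟨p, ⟨hp, hpL⟩, rfl⟩
    obtain ⟨m, hm⟩ := hvn p (hBI hp)
    exact ⟨m, by rw [hm] at hpL; exact_mod_cast hpL, hm.symm⟩
  have hfinL : ((fun m : ℕ => (m : ℝ)) '' Iic L).Finite := (finite_Iic L).image _
  have hEB : (v '' {p ∈ B | v p ≤ L}).Finite := hfinL.subset hsub
  have d4 := ncard_large_slopes_le (u := v) (x₀ := 2 * 2 ^ k₀ + 1) (fun p hp => hy0 p (hBI hp)) hσ0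
    hp₀B (by linarith [(abs_le.mp (hv p₀ hp₀)).2]) hy₀ hL hEB
  have d5 : (v '' {p ∈ B | v p ≤ L}).ncard ≤ L + 1 := by
    refine (ncard_le_ncard hsub hfinL).trans ((ncard_image_le (finite_Iic L)).trans ?_)
    rw [← Finset.coe_Iic, ncard_coe_finset, Nat.card_Iic]
  have d6 : (Prod.fst '' {p ∈ A | p.1 ≤ (L : ℝ)}).ncard ≤ K :=
    (ncard_image_le (hAfin.subset fun p hp => hp.1)).trans hK
  have s1 := ncard_pos_slopes_le hAslopes σ
  have s2 := ncard_pos_slopes_le hBfin σ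
  rw [hshift] at d1 d2 d3
  have t1 : (slopes A ∩ Ioi 0).ncard ≤ (slopes (shift v B) ∩ Ioi 0).ncard + K := by omega
  have t2 : (slopes (shift v B) ∩ Ioi 0).ncard ≤ (slopes A ∩ Ioi 0).ncard + (L + 1) := by omega
  have t1' : ((slopes A ∩ Ioi 0).ncard : ℝ) ≤ (slopes (shift v B) ∩ Ioi 0).ncard + K := by
    exact_mod_cast t1
  have t2' : ((slopes (shift v B) ∩ Ioi 0).ncard : ℝ) ≤ (slopes A ∩ Ioi 0).ncard + (L + 1) := by
    exact_mod_cast t2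
  have hK0 : (0 : ℝ) ≤ K := by positivity
  have hL0 : (0 : ℝ) ≤ L := by positivity
  rw [abs_le]; constructor <;> linarith

/-! ### Stochastic boundedness of the differences -/

/-- The height of the rectangle. -/
def topHeight (F : Measure ℝ) : ℝ := quantile F (1 - Real.exp (-1))

section Top

variable {F : Measure ℝ}

theorem exp_neg_one_bounds : 0 < 1 - Real.exp (-1) ∧ 1 - Real.exp (-1) < 1 :=
  ⟨by simp, by simp [Real.exp_pos]⟩

theorem topHeight_pos [IsProbabilityMeasure F] (hF : F (Iic 0) = 0) : 0 < topHeight F := by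
  by_contra hc
  have := (quantile_le_iff F exp_neg_one_bounds.1 exp_neg_one_bounds.2).mp (not_lt.mp hc)
  rw [cdf_zero hF] at this
  linarith [exp_neg_one_bounds.1]

theorem cdf_quantile_le (hF_cont : Continuous (cdf F)) {u : ℝ} (h0 : 0 < u) (h1 : u < 1) :
    cdf F (quantile F u) ≤ u := by
  by_contra hc
  have h2 : ∀ᶠ x in 𝓝[<] (quantile F u), u < cdf F x :=
    (hF_cont.continuousAt.mono_left nhdsWithin_le_nhds).eventually
      (eventually_gt_nhds (not_le.mp hc))
  obtain ⟨x, hx, hlt⟩ := (h2.and self_mem_nhdsWithin).exists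
  have := (quantile_le_iff F h0 h1).mpr hx.le
  exact absurd (this.trans_lt (show x < quantile F u from hlt)) (lt_irrefl _)

theorem cdf_topHeight_lt_one (hF_cont : Continuous (cdf F)) : cdf F (topHeight F) < 1 :=
  (cdf_quantile_le hF_cont exp_neg_one_bounds.1 exp_neg_one_bounds.2).trans_lt
    exp_neg_one_bounds.2

theorem hazardMeasure_topHeight_lt_top (hF_cont : Continuous (cdf F)) :
    hazardMeasure F (Iic (topHeight F)) < ⊤ := by
  rw [hazardMeasure_Iic, if_pos (cdf_topHeight_lt_one hF_cont)]
  exact ENNReal.ofReal_lt_top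

theorem rectangle_eq (F : Measure ℝ) : rectangle F = Ioo 0 1 ×ˢ Ioo 0 (topHeight F) := rfl

theorem measurableSet_rectangle (F : Measure ℝ) : MeasurableSet (rectangle F) :=
  measurableSet_Ioo.prod measurableSet_Ioo

theorem rectangle_subset_strip (F : Measure ℝ) : rectangle F ⊆ strip :=
  prod_mono_right Ioo_subset_Ioi_self

theorem intensity_rectangle_lt_top (hF_cont : Continuous (cdf F)) (n : ℕ) :
    intensity F n (rectangle F) < ⊤ := by
  rw [intensity, Measure.smul_apply, rectangle_eq, Measure.prod_prod, smul_eq_mul]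
  refine ENNReal.mul_lt_top (ENNReal.natCast_lt_top n) (ENNReal.mul_lt_top ?_ ?_)
  · exact (Measure.restrict_apply_le _ _).trans_lt (by simp)
  · exact (measure_mono fun x hx => hx.2.le).trans_lt (hazardMeasure_topHeight_lt_top hF_cont)

theorem ae_finite_rectangle (hF_cont : Continuous (cdf F)) {Ω : Type*} [MeasurableSpace Ω]
    {n : ℕ} {Φ : Ω → Set (ℝ × ℝ)} {P : Measure Ω}
    (hΦ : IsPoissonPointProcess Φ (intensity F n) P) : ∀ᵐ ω ∂P, (Φ ω ∩ rectangle F).Finite := by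
  filter_upwards [poisson_encard_lt_top (hΦ.hasLaw_count _ (measurableSet_rectangle F)
    (intensity_rectangle_lt_top hF_cont n))] with ω hω
  exact encard_lt_top_iff.mp hω

end Top

/-- Only finitely many abscissae `z / n` occur, even if `A` is infinite. For `n = 0` division by
zero sends them all to `0`. -/
theorem finite_slopes_toLeftEdge {A : Set (ℝ × ℝ)} (hA : A ⊆ strip) (n : ℕ) :
    (slopes (toLeftEdge n '' A)).Finite := by
  refine finite_slopes (((finite_Icc (0 : ℤ) n).image fun z : ℤ => (z : ℝ) / n).subset ?_)
  rintro _ ⟨_, ⟨p, hp, rfl⟩, rfl⟩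
  have h1 : (0 : ℝ) ≤ n * p.1 := mul_nonneg (by positivity) (hA hp).1.1.le
  refine ⟨⌊(n : ℝ) * p.1⌋, ⟨Int.floor_nonneg.mpr h1, ?_⟩, rfl⟩
  rw [← Int.cast_le (R := ℝ)]
  refine (Int.floor_le _).trans ?_
  push_cast
  nlinarith [(hA hp).1.2, (Nat.cast_nonneg n : (0 : ℝ) ≤ n)]

theorem isBigOInProbability_one_of_bounded {Ω : ℕ → Type*} [∀ n, MeasurableSpace (Ω n)]
    {P : ∀ n, Measure (Ω n)} {X : ∀ n, Ω n → ℝ}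
    (h : ∀ ε : ℝ≥0∞, ε ≠ 0 → ∃ K : ℝ, ∀ᶠ n in atTop, P n {ω | K < |X n ω|} ≤ ε) :
    IsBigOInProbability P X (fun _ => 1) := by
  intro c hc
  rw [ENNReal.tendsto_nhds_zero]
  intro ε hε
  obtain ⟨K, hK⟩ := h ε hε.ne'
  filter_upwards [hK, hc.eventually_gt_atTop K] with n h1 h2
  refine (measure_mono fun ω hω => ?_).trans h1
  simp only [one_mul, mem_ofPred_eq] at hω ⊢
  linarith

/-- The number of slopes of a given sign, seen after a rescaling. -/
def signedSlopes (α : ℝ) (A : Set (ℝ × ℝ)) : Set ℝ := slopes A ∩ {s | 0 < s / α}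

theorem ncard_signedSlopes {α : ℝ} (hα : α ≠ 0) (β : ℝ) (A : Set (ℝ × ℝ)) :
    (slopes (horizontal α β '' A) ∩ Ioi 0).ncard = (signedSlopes α A).ncard := by
  have h1 : slopes (horizontal α β '' A) = (fun s => s / α) '' slopes A := slopes_affine A hα β
  have h2 : (fun s => s / α) '' slopes A ∩ Ioi 0 = (fun s => s / α) '' signedSlopes α A := by
    rw [← image_inter_preimage]; rfl
  rw [h1, h2]
  exact ncard_image_of_injective _ fun s t hst => by
    simpa [div_left_inj' hα] using hst

/-- The number of slopes of a given sign changes by a stochastically bounded amount. -/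
theorem exists_signedSlopes_bound {F : Measure ℝ} [IsProbabilityMeasure F] (hF : F (Iic 0) = 0)
    (hF_cont : Continuous (cdf F)) {a C : ℝ} (ha : 0 < a) (hC : 0 < C)
    (hFC : (fun y : ℝ => cdf F y - C * y ^ a) =o[𝓝[>] 0] (fun y : ℝ => y ^ a))
    {Ω : ℕ → Type*} [∀ n, MeasurableSpace (Ω n)]
    (P : ∀ n, Measure (Ω n)) [∀ n, IsProbabilityMeasure (P n)]
    (Φ : ∀ n, Ω n → Set (ℝ × ℝ)) (hΦ : ∀ n, IsPoissonPointProcess (Φ n) (intensity F n) (P n))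
    {W : Set (ℝ × ℝ)} (hRW : rectangle F ⊆ W) (hWS : W ⊆ strip) {α β : ℕ → ℝ}
    (hαβ : ∀ n, IsRescaling n (α n) (β n)) {ε : ℝ≥0∞} (hε : ε ≠ 0) :
    ∃ K : ℝ, ∀ᶠ n in atTop, P n {ω | K <
      |((signedSlopes (α n) (Φ n ω ∩ rectangle F)).ncard : ℝ) -
        ((signedSlopes (α n) (toLeftEdge n '' (Φ n ω ∩ W))).ncard : ℝ)|} ≤ ε := by
  have hε2 : ε / 2 ≠ 0 := (ENNReal.half_pos hε).ne'
  -- Taking `12 lowHeight a k₀` below the top of the rectangle ensures that all points used at good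
  -- scales belong to both sets compared.
  obtain ⟨k₀, hlow, hgood⟩ := exists_allGood hF hF_cont ha hC hFC hε2 (topHeight_pos hF)
  obtain ⟨L, hL⟩ := exists_nat_ge
    (2 * 2 ^ k₀ + 1 + lowHeight a k₀ / ((2 : ℝ) ^ k₀) ^ (-1 - 1 / a))
  obtain ⟨K, hK⟩ := exists_poisson_tail
    (volume (Ioc (0 : ℝ) L) * hazardMeasure F (Iic (topHeight F))) hε2
  refine ⟨K + L + 1, ?_⟩
  filter_upwards [eventually_gt_atTop (2 * 2 ^ k₀), eventually_gt_atTop L] with n hn hnL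
  have hn0 : n ≠ 0 := by omega
  have hnk : (2 : ℝ) * 2 ^ k₀ < n := by exact_mod_cast hn
  have hr := hαβ n
  have hα := hr.ne_zero hn0
  set f := horizontal (α n) (β n) with hf
  have hinj : Function.Injective f := horizontal_injective hα _
  have hΨ := hr.isStripPoisson hn0 hF (hΦ n)
  have hcountlaw := hΨ.hasLaw_count (Ioc 0 (L : ℝ)) (Iic (topHeight F)) measurableSet_Ioc
    measurableSet_Iic (fun x hx => ⟨hx.1, hx.2.trans_lt (by exact_mod_cast hnL)⟩)
    (ENNReal.mul_lt_top (by simp) (hazardMeasure_topHeight_lt_top hF_cont))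
  have hfin : P n {ω | ¬ (Φ n ω ∩ rectangle F).Finite} = 0 :=
    ae_iff.mp (ae_finite_rectangle hF_cont (hΦ n))
  -- Exceptional events: a bad scale, more than `K` points in `(0, L]` below the top height, and the
  -- null event of infinitely many points in the rectangle.
  refine (measure_mono ?_).trans ((measure_union_le _ _).trans
    ((add_le_add (measure_union_le _ _) le_rfl).trans
      ((add_le_add (add_le_add (hgood hΨ) (hK hcountlaw)) hfin.le).trans
        (by rw [add_zero, ENNReal.add_halves]))))
  intro ω hω
  by_contra hc
  simp only [mem_union, mem_ofPred_eq, not_or, not_not, not_lt] at hc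
  obtain ⟨⟨h1, h2⟩, h3⟩ := hc
  rw [mem_ofPred_eq] at hω
  refine absurd hω (not_lt.mpr ?_)
  have hI := hΨ.subset ω
  have hAI : f '' (Φ n ω ∩ rectangle F) ⊆ f '' (Φ n ω ∩ strip) :=
    image_mono (inter_subset_inter_right _ (hRW.trans hWS))
  have hBI : f '' (Φ n ω ∩ W) ⊆ f '' (Φ n ω ∩ strip) :=
    image_mono (inter_subset_inter_right _ hWS)
  have hAB : ∀ p ∈ f '' (Φ n ω ∩ strip), p.2 ≤ 12 * lowHeight a k₀ →
      p ∈ f '' (Φ n ω ∩ rectangle F) ∧ p ∈ f '' (Φ n ω ∩ W) := by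
    rintro _ ⟨p, ⟨hp, hpS⟩, rfl⟩ hpy
    have hpR : p ∈ rectangle F := ⟨hpS.1, hpS.2, lt_of_le_of_lt hpy hlow⟩
    exact ⟨⟨p, ⟨hp, hpR⟩, rfl⟩, ⟨p, ⟨hp, hRW hpR⟩, rfl⟩⟩
  have hslopes : (slopes (shift (rescaledEdge (α n) (β n)) (f '' (Φ n ω ∩ W)))).Finite := by
    have e : slopes (horizontal (α n) (β n) '' (toLeftEdge n '' (Φ n ω ∩ W))) = _ :=
      slopes_affine _ hα (β n)
    rw [hf, ← hr.horizontal_toLeftEdge hn0, e]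
    exact (finite_slopes_toLeftEdge (inter_subset_right.trans hWS) n).image _
  have hcard : {p ∈ f '' (Φ n ω ∩ rectangle F) | p.1 ≤ (L : ℝ)}.ncard ≤ K := by
    have hsub : {p ∈ f '' (Φ n ω ∩ rectangle F) | p.1 ≤ (L : ℝ)} ⊆
        f '' (Φ n ω ∩ strip) ∩ Ioc 0 (L : ℝ) ×ˢ Iic (topHeight F) := by
      rintro p ⟨hp, hpL⟩
      refine ⟨hAI hp, ⟨(hI (hAI hp)).1.1, hpL⟩, ?_⟩
      obtain ⟨q, hq, rfl⟩ := hp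
      exact hq.2.2.2.le
    have h4 := (encard_le_encard hsub).trans h2
    rw [ncard, ← ENat.toNat_natCast K]
    exact ENat.toNat_le_toNat h4 (ENat.natCast_ne_top K)
  have := h1.abs_ncard_sub_le ha hI hnk (v := rescaledEdge (α n) (β n))
    (fun p _ => abs_rescaledEdge_sub_le p) (fun p hp => hr.rescaledEdge_eq_natCast (hI hp).1)
    hAI hBI hAB hL (h3.image f) hslopes hcard
  rw [← hr.horizontal_toLeftEdge hn0, hf, ncard_signedSlopes hα, ncard_signedSlopes hα] at this
  exact this

theorem signedSlopes_pos {α : ℝ} (hα : 0 < α) (A : Set (ℝ × ℝ)) :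
    signedSlopes α A = slopes A ∩ Ioi 0 := by
  ext s; simp [signedSlopes, div_pos_iff_of_pos_right hα]

theorem signedSlopes_neg {α : ℝ} (hα : α < 0) (A : Set (ℝ × ℝ)) :
    signedSlopes α A = slopes A ∩ Iio 0 := by
  ext s
  simp only [signedSlopes, mem_inter_iff, mem_ofPred_eq, mem_Iio, and_congr_right_iff]
  intro _
  rw [div_pos_iff]
  constructor
  · rintro (⟨_, h⟩ | ⟨h, _⟩)
    · exact absurd h hα.not_gt
    · exact h
  · exact fun h => Or.inr ⟨h, hα⟩

section BigO

variable {F : Measure ℝ} [IsProbabilityMeasure F] {a C : ℝ}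
  {Ω : ℕ → Type*} [∀ n, MeasurableSpace (Ω n)]

theorem exists_left_bound (hF : F (Iic 0) = 0)
    (hF_cont : Continuous (cdf F)) (ha : 0 < a) (hC : 0 < C)
    (hFC : (fun y : ℝ => cdf F y - C * y ^ a) =o[𝓝[>] 0] (fun y : ℝ => y ^ a))
    (P : ∀ n, Measure (Ω n)) [∀ n, IsProbabilityMeasure (P n)]
    (Φ : ∀ n, Ω n → Set (ℝ × ℝ)) (hΦ : ∀ n, IsPoissonPointProcess (Φ n) (intensity F n) (P n))
    {W : Set (ℝ × ℝ)} (hRW : rectangle F ⊆ W) (hWS : W ⊆ strip) {ε : ℝ≥0∞} (hε : ε ≠ 0) :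
    ∃ K : ℝ, ∀ᶠ n in atTop, P n {ω | K <
      |((lowerLeftFaces (Φ n ω ∩ rectangle F)).ncard : ℝ) -
        ((lowerLeftFaces (toLeftEdge n '' (Φ n ω ∩ W))).ncard : ℝ)|} ≤ ε := by
  obtain ⟨K, hK⟩ := exists_signedSlopes_bound hF hF_cont ha hC hFC P Φ hΦ hRW hWS
    (α := fun n => n) (β := fun _ => 0) (fun n => Or.inl ⟨rfl, rfl⟩) hε
  refine ⟨K, ?_⟩
  filter_upwards [hK, eventually_gt_atTop 0] with n h hn
  have hn0 : (0 : ℝ) < n := by exact_mod_cast hn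
  simpa only [signedSlopes_pos hn0, ncard_lowerLeftFaces] using h

theorem exists_total_bound (hF : F (Iic 0) = 0)
    (hF_cont : Continuous (cdf F)) (ha : 0 < a) (hC : 0 < C)
    (hFC : (fun y : ℝ => cdf F y - C * y ^ a) =o[𝓝[>] 0] (fun y : ℝ => y ^ a))
    (P : ∀ n, Measure (Ω n)) [∀ n, IsProbabilityMeasure (P n)]
    (Φ : ∀ n, Ω n → Set (ℝ × ℝ)) (hΦ : ∀ n, IsPoissonPointProcess (Φ n) (intensity F n) (P n))
    {W : Set (ℝ × ℝ)} (hRW : rectangle F ⊆ W) (hWS : W ⊆ strip) {ε : ℝ≥0∞} (hε : ε ≠ 0) :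
    ∃ K : ℝ, ∀ᶠ n in atTop, P n {ω | K <
      |((lowerFaces (Φ n ω ∩ rectangle F)).ncard : ℝ) -
        ((lowerFaces (toLeftEdge n '' (Φ n ω ∩ W))).ncard : ℝ)|} ≤ ε := by
  have hε2 : ε / 2 ≠ 0 := (ENNReal.half_pos hε).ne'
  obtain ⟨K, hK⟩ := exists_signedSlopes_bound hF hF_cont ha hC hFC P Φ hΦ hRW hWS
    (α := fun n => n) (β := fun _ => 0) (fun n => Or.inl ⟨rfl, rfl⟩) hε2
  obtain ⟨K', hK'⟩ := exists_signedSlopes_bound hF hF_cont ha hC hFC P Φ hΦ hRW hWS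
    (α := fun n => -n) (β := fun n => n) (fun n => Or.inr ⟨rfl, rfl⟩) hε2
  -- The extra `1` accounts for a horizontal edge, which has neither sign.
  refine ⟨K + K' + 1, ?_⟩
  filter_upwards [hK, hK', eventually_gt_atTop 0] with n h h' hn
  have hn0 : (0 : ℝ) < n := by exact_mod_cast hn
  have hfin : P n {ω | ¬ (Φ n ω ∩ rectangle F).Finite} = 0 :=
    ae_iff.mp (ae_finite_rectangle hF_cont (hΦ n))
  simp only [signedSlopes_pos hn0] at h
  simp only [signedSlopes_neg (neg_neg_of_pos hn0)] at h'
  refine (measure_mono ?_).trans ((measure_union_le _ _).trans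
    ((add_le_add (measure_union_le _ _) le_rfl).trans
      ((add_le_add (add_le_add h h') hfin.le).trans
        (by rw [add_zero, ENNReal.add_halves]))))
  intro ω hω
  by_contra hc
  simp only [mem_union, mem_ofPred_eq, not_or, not_not, not_lt] at hc
  obtain ⟨⟨h1, h2⟩, h3⟩ := hc
  rw [mem_ofPred_eq] at hω
  refine absurd hω (not_lt.mpr ?_)
  rw [ncard_lowerFaces, ncard_lowerFaces]
  have s1 := ncard_split_sign (finite_slopes (h3.image Prod.fst))
  have s2 := ncard_split_sign (finite_slopes_toLeftEdge
    ((inter_subset_right : Φ n ω ∩ W ⊆ W).trans hWS) n)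
  set T := slopes (Φ n ω ∩ rectangle F)
  set T' := slopes (toLeftEdge n '' (Φ n ω ∩ W))
  have a1 : ((T ∩ Ioi 0).ncard + (T ∩ Iio 0).ncard : ℝ) ≤ T.ncard := by exact_mod_cast s1.1
  have a2 : (T.ncard : ℝ) ≤ (T ∩ Ioi 0).ncard + (T ∩ Iio 0).ncard + 1 := by exact_mod_cast s1.2
  have b1 : ((T' ∩ Ioi 0).ncard + (T' ∩ Iio 0).ncard : ℝ) ≤ T'.ncard := by exact_mod_cast s2.1
  have b2 : (T'.ncard : ℝ) ≤ (T' ∩ Ioi 0).ncard + (T' ∩ Iio 0).ncard + 1 := by exact_mod_cast s2.2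
  rw [abs_le] at h1 h2 ⊢
  constructor <;> linarith

end BigO

/-! ### Measurability of the number of slopes -/

/-- A finite set of lines has a breakpoint of its lower envelope in an interval if and only if the
envelope is not affine there. -/
theorem slopes_inter_Ioo_nonempty_iff {A : Set (ℝ × ℝ)} (hA : A.Finite) (a b : ℝ) :
    (slopes A ∩ Ioo a b).Nonempty ↔ ∃ γ δ u v : ℚ, a < γ ∧ γ < δ ∧ (δ : ℝ) < b ∧
      (∃ p ∈ A, (γ : ℝ) * p.1 + p.2 < u) ∧ (∃ p ∈ A, (δ : ℝ) * p.1 + p.2 < v) ∧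
      ¬ ∃ p ∈ A, ((γ : ℝ) + δ) / 2 * p.1 + p.2 < ((u : ℝ) + v) / 2 := by
  constructor
  · rintro ⟨s, ⟨p, hp, q, hq, hpq⟩, has, hsb⟩
    obtain ⟨γ, hγ1, hγ2⟩ := exists_rat_btwn has
    obtain ⟨δ, hδ1, hδ2⟩ := exists_rat_btwn hsb
    have hne : A.Nonempty := ⟨p, hp.1⟩
    obtain ⟨x, hxA, hx⟩ := exists_min_image A (fun r => (γ : ℝ) * r.1 + r.2) hA hne
    obtain ⟨y, hyA, hy⟩ := exists_min_image A (fun r => (δ : ℝ) * r.1 + r.2) hA hne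
    obtain ⟨z, hzA, hz⟩ := exists_min_image A (fun r => ((γ : ℝ) + δ) / 2 * r.1 + r.2) hA hne
    -- Strict concavity at the midpoint. With equality, the midpoint minimiser `z` would be optimal
    -- at `γ` and `δ` too, and then every minimiser at `s` would share its abscissa, so there would
    -- be only one.
    have hstrict : (γ * x.1 + x.2) + (δ * y.1 + y.2) < 2 * (((γ : ℝ) + δ) / 2 * z.1 + z.2) := by
      by_contra hc
      push Not at hc
      have e1 := hx z hzA
      have e2 := hy z hzA
      have key : ∀ r ∈ minimizers A s, r.1 = z.1 := by
        intro r hr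
        have f1 := hx r hr.1
        have f2 := hy r hr.1
        have f3 := hr.2 z hzA
        have g1 : (γ : ℝ) * z.1 + z.2 ≤ γ * r.1 + r.2 := by linarith
        have g2 : (δ : ℝ) * z.1 + z.2 ≤ δ * r.1 + r.2 := by linarith
        have k1 : 0 ≤ (s - γ) * (z.1 - r.1) := by linarith
        have k2 : (δ - s) * (z.1 - r.1) ≤ 0 := by linarith
        have l1 : 0 ≤ z.1 - r.1 := nonneg_of_mul_nonneg_right k1 (by linarith)
        have l2 : z.1 - r.1 ≤ 0 := by
          by_contra hcc
          push Not at hcc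
          nlinarith [mul_pos (show 0 < δ - s by linarith) hcc]
        linarith
      have h1 : p.1 = q.1 := (key p hp).trans (key q hq).symm
      have h2 := minimizers_eq hp hq
      exact hpq (Prod.ext h1 (by rw [h1] at h2; linarith))
    set d := 2 * (((γ : ℝ) + δ) / 2 * z.1 + z.2) - ((γ * x.1 + x.2) + (δ * y.1 + y.2)) with hd
    obtain ⟨u, hu1, hu2⟩ := exists_rat_btwn
      (show (γ : ℝ) * x.1 + x.2 < γ * x.1 + x.2 + d / 2 by linarith)
    obtain ⟨v, hv1, hv2⟩ := exists_rat_btwn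
      (show (δ : ℝ) * y.1 + y.2 < δ * y.1 + y.2 + d / 2 by linarith)
    refine ⟨γ, δ, u, v, hγ1, by exact_mod_cast hγ2.trans hδ1, hδ2, ⟨x, hxA, hu1⟩, ⟨y, hyA, hv1⟩, ?_⟩
    rintro ⟨w, hwA, hw⟩
    have := hz w hwA
    linarith
  · rintro ⟨γ, δ, u, v, haγ, hγδ, hδb, ⟨x, hxA, hx⟩, ⟨y, hyA, hy⟩, hm⟩
    have hγδ' : (γ : ℝ) < δ := by exact_mod_cast hγδ
    obtain ⟨p, hpA, hp⟩ := exists_min_image A (fun r => (γ : ℝ) * r.1 + r.2) hA ⟨x, hxA⟩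
    have hpm : ((u : ℝ) + v) / 2 ≤ ((γ : ℝ) + δ) / 2 * p.1 + p.2 := by
      by_contra hc
      exact hm ⟨p, hpA, not_le.mp hc⟩
    have hpδ : (v : ℝ) < δ * p.1 + p.2 := by linarith [hp x hxA]
    -- the crossing parameter of `p` with a point `r` that beats `p` at `δ`
    set τ : ℝ × ℝ → ℝ := fun r => (p.2 - r.2) / (r.1 - p.1) with hτ
    set B := {r ∈ A | (δ : ℝ) * r.1 + r.2 < δ * p.1 + p.2} with hB
    have hx1 : ∀ r ∈ B, r.1 < p.1 := by
      intro r hr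
      have := hp r hr.1
      have h2 := hr.2
      by_contra hc
      push Not at hc
      nlinarith [mul_le_mul_of_nonneg_right hγδ'.le (sub_nonneg.mpr hc)]
    have hcross : ∀ r ∈ B, τ r * (r.1 - p.1) = p.2 - r.2 := by
      intro r hr
      have := hx1 r hr
      rw [hτ]
      exact div_mul_cancel₀ _ (by linarith)
    -- `p` is optimal at `γ` but beaten at `δ`. The first parameter at which a competitor catches up
    -- is a breakpoint.
    obtain ⟨q, hqB, hq⟩ := exists_min_image B τ (hA.subset fun r hr => hr.1)
      ⟨y, hyA, by linarith⟩
    have hq1 := hx1 q hqB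
    have hqc := hcross q hqB
    have hγτ : (γ : ℝ) ≤ τ q := by
      have := hp q hqB.1
      by_contra hc
      push Not at hc
      nlinarith [mul_pos (sub_pos.mpr hc) (sub_pos.mpr hq1)]
    have hτδ : τ q < δ := by
      have := hqB.2
      by_contra hc
      push Not at hc
      nlinarith [mul_nonneg (sub_nonneg.mpr hc) (sub_pos.mpr hq1).le]
    have hpmin : p ∈ minimizers A (τ q) := by
      refine ⟨hpA, fun r hr => ?_⟩
      by_contra hc
      push Not at hc
      have h1 := hp r hr
      have hr1 : r.1 < p.1 := by
        by_contra hcc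
        push Not at hcc
        nlinarith [mul_nonneg (sub_nonneg.mpr hγτ) (sub_nonneg.mpr hcc)]
      have hrB : r ∈ B := by
        refine ⟨hr, ?_⟩
        nlinarith [mul_pos (sub_pos.mpr hτδ) (sub_pos.mpr hr1)]
      have h2 := hcross r hrB
      have h3 := hq r hrB
      nlinarith [mul_nonneg (sub_nonneg.mpr h3) (sub_pos.mpr hr1).le]
    have hval : τ q * q.1 + q.2 = τ q * p.1 + p.2 := by linarith
    refine ⟨τ q, ⟨p, hpmin, q, ⟨hqB.1, fun r hr => hval.le.trans (hpmin.2 r hr)⟩, ?_⟩,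
      by linarith, by linarith⟩
    rintro rfl
    exact lt_irrefl _ hq1

/-- A lower bound on the number of elements of a finite set of reals is detected by disjoint
rational intervals. -/
theorem le_ncard_iff_exists_intervals {T : Set ℝ} (hT : T.Finite) (k : ℕ) :
    k ≤ T.ncard ↔ ∃ a b : Fin k → ℚ, (Pairwise fun i j =>
      Disjoint (Ioo (a i : ℝ) (b i)) (Ioo (a j : ℝ) (b j))) ∧
      ∀ i, (T ∩ Ioo (a i : ℝ) (b i)).Nonempty := by
  constructor
  · intro hk
    obtain ⟨S, hST, hS⟩ := exists_subset_card_eq hk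
    have hSfin : S.Finite := hT.subset hST
    have : Finite S := hSfin
    have hcard : Nat.card S = k := hS
    let e : Fin k ≃ S := (finCongr hcard.symm).trans (Finite.equivFin S).symm
    obtain ⟨U, hU, hdisj⟩ := hSfin.t2_separation
    have hint : ∀ x : ℝ, ∃ a b : ℚ, (a : ℝ) < x ∧ x < b ∧ Ioo (a : ℝ) b ⊆ U x := by
      intro x
      obtain ⟨l, u, hx, hsub⟩ := mem_nhds_iff_exists_Ioo_subset.mp ((hU x).2.mem_nhds (hU x).1)
      obtain ⟨a, ha1, ha2⟩ := exists_rat_btwn hx.1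
      obtain ⟨b, hb1, hb2⟩ := exists_rat_btwn hx.2
      exact ⟨a, b, ha2, hb1, (Ioo_subset_Ioo ha1.le hb2.le).trans hsub⟩
    choose a b ha hb hab using hint
    refine ⟨fun i => a (e i), fun i => b (e i), fun i j hij => ?_, fun i =>
      ⟨e i, hST (e i).2, ha _, hb _⟩⟩
    have hne : ((e i : S) : ℝ) ≠ e j := fun h => hij (e.injective (Subtype.ext h))
    exact (hdisj (e i).2 (e j).2 hne).mono (hab _) (hab _)
  · rintro ⟨a, b, hdisj, hne⟩
    choose t ht using hne
    have hinj : Function.Injective t := by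
      intro i j hij
      by_contra hc
      exact Set.disjoint_left.mp (hdisj hc) (ht i).2 (hij ▸ (ht j).2)
    have h1 : (range t).ncard = k := by
      rw [← image_univ, ncard_image_of_injective _ hinj, ncard_univ, Nat.card_fin]
    rw [← h1]
    exact ncard_le_ncard (by rintro _ ⟨i, rfl⟩; exact (ht i).1) hT

/-- The number of slopes of a random finite set is measurable. -/
theorem measurable_ncard_slopes {Ω : Type*} [MeasurableSpace Ω] {A : Ω → Set (ℝ × ℝ)}
    (hfin : ∀ ω, (A ω).Finite)
    (hmeas : ∀ s t : ℝ, MeasurableSet {ω | ∃ p ∈ A ω, s * p.1 + p.2 < t}) :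
    Measurable fun ω => (slopes (A ω)).ncard := by
  have hhit : ∀ a b : ℝ, MeasurableSet {ω | (slopes (A ω) ∩ Ioo a b).Nonempty} := by
    intro a b
    simp only [slopes_inter_Ioo_nonempty_iff (hfin _)]
    have hm : ∀ s t : ℝ, Measurable fun ω => ∃ p ∈ A ω, s * p.1 + p.2 < t := fun s t =>
      measurableSet_setOfPred.mp (hmeas s t)
    refine measurableSet_setOfPred.mpr (.exists fun γ => .exists fun δ => .exists fun u =>
      .exists fun v => ?_)
    exact measurable_const.and (measurable_const.and (measurable_const.and
      ((hm _ _).and ((hm _ _).and (hm _ _).not))))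
  refine measurable_of_Ici fun k => ?_
  have : (fun ω => (slopes (A ω)).ncard) ⁻¹' Ici k = ⋃ a : Fin k → ℚ, ⋃ b : Fin k → ℚ,
      {ω | (Pairwise fun i j => Disjoint (Ioo (a i : ℝ) (b i)) (Ioo (a j : ℝ) (b j))) ∧
      ∀ i, (slopes (A ω) ∩ Ioo (a i : ℝ) (b i)).Nonempty} := by
    ext ω
    simp only [mem_preimage, mem_Ici, mem_iUnion, mem_ofPred_eq]
    exact le_ncard_iff_exists_intervals (finite_slopes ((hfin ω).image _)) k
  rw [this]
  refine .iUnion fun a => .iUnion fun b => measurableSet_setOfPred.mpr (measurable_const.and ?_)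
  exact .forall fun i => measurableSet_setOfPred.mp (hhit _ _)

/-! ### Tropical zeros -/

/-- The first `n` points of the graph of the sequence `c`. -/
def graphPoints (n : ℕ) (c : ℕ → ℝ) : Set (ℝ × ℝ) := (fun i : ℕ => ((i : ℝ), c i)) '' Iio n

theorem finite_graphPoints (n : ℕ) (c : ℕ → ℝ) : (graphPoints n c).Finite :=
  (finite_Iio n).image _

/-- Point-line duality: the monomial `c i + i x` is the linear form with parameter `x` evaluated at
`(i, c i)`. Degree `n` means `n + 1` points. -/
theorem tropicalZeros_eq (n : ℕ) (c : ℕ → ℝ) :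
    tropicalZeros n c = slopes (graphPoints (n + 1) c) := by
  have hmin : ∀ i, i ≤ n → ∀ x : ℝ, c i + i * x = tropicalPoly n c x ↔
      ((i : ℝ), c i) ∈ minimizers (graphPoints (n + 1) c) x := by
    intro i hi x
    have hmem : ∀ k, k ≤ n → ((k : ℝ), c k) ∈ graphPoints (n + 1) c := fun k hk =>
      ⟨k, Nat.lt_succ_of_le hk, rfl⟩
    constructor
    · intro h
      refine ⟨hmem i hi, ?_⟩
      rintro _ ⟨k, hk, rfl⟩
      have : tropicalPoly n c x ≤ c k + k * x := Finset.inf'_le _ (Finset.mem_range.mpr hk)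
      simp only
      linarith [mul_comm x (i : ℝ), mul_comm x (k : ℝ)]
    · rintro ⟨-, h⟩
      refine le_antisymm (Finset.le_inf' _ _ fun k hk => ?_)
        (Finset.inf'_le _ (Finset.mem_range.mpr (Nat.lt_succ_of_le hi)))
      have := h _ (hmem k (Nat.lt_succ_iff.mp (Finset.mem_range.mp hk)))
      simp only at this
      linarith [mul_comm x (i : ℝ), mul_comm x (k : ℝ)]
  ext x
  constructor
  · rintro ⟨i, hi, j, hj, hij, h1, h2⟩
    refine ⟨_, (hmin i hi x).mp h1, _, (hmin j hj x).mp h2, fun h => hij ?_⟩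
    have h1 : (i : ℝ) = j := congrArg Prod.fst h
    exact_mod_cast h1
  · rintro ⟨_, hp, _, hq, hpq⟩
    obtain ⟨i, hi, rfl⟩ := hp.1
    obtain ⟨j, hj, rfl⟩ := hq.1
    have hi' := Nat.lt_succ_iff.mp hi
    have hj' := Nat.lt_succ_iff.mp hj
    exact ⟨i, hi', j, hj', fun h => hpq (by rw [h]), (hmin i hi' x).mpr hp, (hmin j hj' x).mpr hq⟩

theorem measurable_ncard_slopes_graphPoints {Ω : Type*} [MeasurableSpace Ω] {c : ℕ → Ω → ℝ}
    (n : ℕ) (hc : ∀ i < n, Measurable (c i)) :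
    Measurable fun ω => (slopes (graphPoints n fun i => c i ω)).ncard := by
  refine measurable_ncard_slopes (fun ω => finite_graphPoints n _) fun s t => ?_
  have : {ω | ∃ p ∈ graphPoints n (fun i => c i ω), s * p.1 + p.2 < t} =
      ⋃ i ∈ Iio n, {ω | s * i + c i ω < t} := by
    ext ω
    simp [graphPoints]
  rw [this]
  refine MeasurableSet.biUnion (to_countable _) fun i hi => ?_
  exact measurableSet_lt ((hc i hi).const_add _) measurable_const

/-! ### Measurability for the Poisson process -/

/-- The process is controlled only through its counts. The event that some point lies in a
half-plane is a nonzero count, hence null measurable, and `measurable_ncard_slopes` needs no other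
events. -/
theorem aemeasurable_ncard_slopes_rectangle {F : Measure ℝ} (hF_cont : Continuous (cdf F))
    {Ω : Type*} [MeasurableSpace Ω] {n : ℕ} {Φ : Ω → Set (ℝ × ℝ)} {P : Measure Ω}
    (hΦ : IsPoissonPointProcess Φ (intensity F n) P) :
    AEMeasurable (fun ω => (slopes (Φ ω ∩ rectangle F)).ncard) P := by
  classical
  set A : Ω → Set (ℝ × ℝ) := fun ω =>
    if (Φ ω ∩ rectangle F).Finite then Φ ω ∩ rectangle F else ∅ with hA
  have hfin : ∀ ω, (A ω).Finite := by
    intro ω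
    simp only [hA]
    split_ifs with h
    · exact h
    · exact finite_empty
  have hae : ∀ᵐ ω ∂P, A ω = Φ ω ∩ rectangle F := by
    filter_upwards [ae_finite_rectangle hF_cont hΦ] with ω hω
    simp only [hA, if_pos hω]
  have hmeas : ∀ s t : ℝ, NullMeasurableSet {ω | ∃ p ∈ A ω, s * p.1 + p.2 < t} P := by
    intro s t
    have hB : MeasurableSet (rectangle F ∩ {p : ℝ × ℝ | s * p.1 + p.2 < t}) :=
      (measurableSet_rectangle F).inter (measurableSet_lt (by fun_prop) (by fun_prop))
    have hlaw := hΦ.hasLaw_count _ hB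
      ((measure_mono inter_subset_left).trans_lt (intensity_rectangle_lt_top hF_cont n))
    refine (hlaw.aemeasurable.nullMeasurable (MeasurableSet.of_discrete (s := {0}ᶜ))).congr ?_
    filter_upwards [hae] with ω hω
    apply propext
    change (Φ ω ∩ (rectangle F ∩ {p : ℝ × ℝ | s * p.1 + p.2 < t})).encard ∈ ({0}ᶜ : Set ℕ∞) ↔
      ∃ p ∈ A ω, s * p.1 + p.2 < t
    rw [hω, mem_compl_singleton_iff, encard_ne_zero]
    exact ⟨fun ⟨p, h1, h2, h3⟩ => ⟨p, ⟨h1, h2⟩, h3⟩, fun ⟨p, ⟨h1, h2⟩, h3⟩ => ⟨p, h1, h2, h3⟩⟩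
  -- The measurability criterion is applied on the completed σ-algebra, after emptying the set on
  -- the null event where it is infinite.
  have hnull : NullMeasurable (fun ω => (slopes (A ω)).ncard) P :=
    measurable_ncard_slopes (Ω := NullMeasurableSpace Ω P) hfin hmeas
  refine hnull.aemeasurable.congr ?_
  filter_upwards [hae] with ω hω
  rw [hω]

/-! ### Column minima -/

/-- The lowest height in a column. -/
def columnMin (N : ℝ) (i : ℕ) (A : Set (ℝ × ℝ)) : ℝ := sInf (Prod.snd '' {p ∈ A | p.1 ∈ column N i})

/-- A point vertically above another never minimises `s x + y`. -/
theorem slopes_eq_of_subset {A B : Set (ℝ × ℝ)} (hBA : B ⊆ A)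
    (h : ∀ p ∈ A, ∃ q ∈ B, q.1 = p.1 ∧ q.2 ≤ p.2) : slopes A = slopes B := by
  have hmin : ∀ s, minimizers A s = minimizers B s := by
    intro s
    ext p
    constructor
    · rintro ⟨hp, hpm⟩
      obtain ⟨q, hq, h1, h2⟩ := h p hp
      have h3 := hpm q (hBA hq)
      rw [h1] at h3
      have : q = p := Prod.ext h1 (by linarith)
      exact ⟨this ▸ hq, fun r hr => hpm r (hBA hr)⟩
    · rintro ⟨hp, hpm⟩
      refine ⟨hBA hp, fun r hr => ?_⟩
      obtain ⟨q, hq, h1, h2⟩ := h r hr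
      have := hpm q hq
      rw [h1] at this
      linarith
  ext s
  simp only [slopes, hmin]

theorem slopes_shift_floor {n : ℕ} {A : Set (ℝ × ℝ)} (hA : A ⊆ Ioo 0 (n : ℝ) ×ˢ Ioi 0)
    (h : ∀ i < n, IsLeast (Prod.snd '' {p ∈ A | p.1 ∈ column n i}) (columnMin n i A)) :
    slopes (shift (rescaledEdge n 0) A) = slopes (graphPoints n fun i => columnMin n i A) := by
  have hedge : ∀ p ∈ A, ∃ i < n, p.1 ∈ column n i ∧ rescaledEdge n 0 p = i := by
    intro p hp
    have hp1 := (hA hp).1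
    have hn : (0 : ℝ) < n := hp1.1.trans hp1.2
    refine ⟨⌊p.1⌋₊, (Nat.floor_lt hp1.1.le).mpr hp1.2, (mem_column_iff hp1).mpr rfl, ?_⟩
    rw [rescaledEdge, if_pos hn, natCast_floor_eq_intCast_floor hp1.1.le]
  refine slopes_eq_of_subset ?_ ?_
  · rintro _ ⟨i, hi, rfl⟩
    obtain ⟨p, ⟨hp, hpi⟩, hpm⟩ := (h i hi).1
    obtain ⟨j, -, hpj, hj⟩ := hedge p hp
    have : i = j := by
      rw [← (mem_column_iff (hA hp).1).mp hpi, (mem_column_iff (hA hp).1).mp hpj]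
    exact ⟨p, hp, by simp only [hj, ← this, hpm]⟩
  · rintro _ ⟨p, hp, rfl⟩
    obtain ⟨i, hi, hpi, he⟩ := hedge p hp
    exact ⟨_, ⟨i, hi, rfl⟩, he.symm, (h i hi).2 ⟨p, ⟨hp, hpi⟩, rfl⟩⟩

theorem volume_column {n i : ℕ} (hi : i < n) : volume (column n i) = 1 := by
  refine le_antisymm (volume_column_le _ _) ?_
  have h1 : volume (Ioo (i : ℝ) (i + 1)) = 1 := by simp
  rw [← h1]
  refine measure_mono fun x hx => ⟨⟨hx.1.le, hx.2⟩, (Nat.cast_nonneg i).trans_lt hx.1, ?_⟩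
  have : (i : ℝ) + 1 ≤ n := by exact_mod_cast hi
  exact hx.2.trans_le this

section ColumnLaw

variable {F : Measure ℝ} {Ω : Type*} [MeasurableSpace Ω] {P : Measure Ω}
  {Ψ : Ω → Set (ℝ × ℝ)} {n i : ℕ}

theorem hasLaw_column (h : IsStripPoisson Ψ n (hazardMeasure F) P) (hi : i < n) {t : ℝ}
    (ht : cdf F t < 1) :
    HasLaw (fun ω => (Ψ ω ∩ column n i ×ˢ Iic t).encard) ((poissonMeasure
      (ENNReal.ofReal (-Real.log (1 - cdf F t))).toNNReal).map (Nat.cast : ℕ → ℕ∞)) P := by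
  have e : volume (column n i) * hazardMeasure F (Iic t) =
      ENNReal.ofReal (-Real.log (1 - cdf F t)) := by
    rw [volume_column hi, one_mul, hazardMeasure_Iic, if_pos ht]
  have := h.hasLaw_count (column n i) (Iic t) (measurableSet_column _ _) measurableSet_Iic
    (column_subset _ _) (by rw [e]; exact ENNReal.ofReal_lt_top)
  rwa [e] at this

theorem exp_hazard {t : ℝ} (ht : cdf F t < 1) :
    Real.exp (-(ENNReal.ofReal (-Real.log (1 - cdf F t))).toReal) = 1 - cdf F t := by
  rw [ENNReal.toReal_ofReal, neg_neg, Real.exp_log (by linarith)]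
  exact neg_nonneg.mpr (Real.log_nonpos (by linarith) (by linarith [cdf_nonneg F t]))

/-- Levels that exhaust the support of `F`. -/
def level (F : Measure ℝ) (m : ℕ) : ℝ := quantile F (1 - 1 / (m + 2))

theorem level_bounds (m : ℕ) : (0 : ℝ) < 1 - 1 / (m + 2) ∧ (1 : ℝ) - 1 / (m + 2) < 1 := by
  have h : (0 : ℝ) < 1 / (m + 2) := by positivity
  have h' : (1 : ℝ) / (m + 2) < 1 := by
    rw [div_lt_one (by positivity)]
    linarith [(Nat.cast_nonneg m : (0 : ℝ) ≤ m)]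
  constructor <;> linarith

theorem cdf_level_lt_one (hF_cont : Continuous (cdf F)) (m : ℕ) : cdf F (level F m) < 1 :=
  (cdf_quantile_le hF_cont (level_bounds m).1 (level_bounds m).2).trans_lt (level_bounds m).2

theorem le_cdf_level (m : ℕ) : 1 - 1 / ((m : ℝ) + 2) ≤ cdf F (level F m) :=
  (quantile_le_iff F (level_bounds m).1 (level_bounds m).2).mp le_rfl

/-- Below each level the column holds finitely many points, and it is empty there with probability
`1 - F (level) ≤ 1 / (m + 2)`. So almost surely some level is occupied and the infimum is attained.
-/
theorem ae_isLeast_columnMin (hF_cont : Continuous (cdf F))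
    (h : IsStripPoisson Ψ n (hazardMeasure F) P) (hi : i < n) :
    ∀ᵐ ω ∂P, IsLeast (Prod.snd '' {p ∈ Ψ ω | p.1 ∈ column n i}) (columnMin n i (Ψ ω)) ∧
      cdf F (columnMin n i (Ψ ω)) < 1 := by
  have hfin : ∀ᵐ ω ∂P, ∀ m, (Ψ ω ∩ column n i ×ˢ Iic (level F m)).Finite := by
    rw [ae_all_iff]
    intro m
    filter_upwards [poisson_encard_lt_top (hasLaw_column h hi (cdf_level_lt_one hF_cont m))]
      with ω hω
    exact encard_lt_top_iff.mp hω
  have hne : ∀ᵐ ω ∂P, ∃ m, (Ψ ω ∩ column n i ×ˢ Iic (level F m)).encard ≠ 0 := by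
    rw [ae_iff]
    have hlim : Tendsto (fun m : ℕ => ENNReal.ofReal (1 / ((m : ℝ) + 2))) atTop (𝓝 0) := by
      rw [← ENNReal.ofReal_zero]
      refine (ENNReal.continuous_ofReal.tendsto 0).comp ?_
      have h1 : Tendsto (fun m : ℕ => (m : ℝ) + 2) atTop atTop :=
        tendsto_atTop_add_const_right _ _ tendsto_natCast_atTop_atTop
      simpa only [one_div, Function.comp_def] using tendsto_inv_atTop_zero.comp h1
    refine le_antisymm (ge_of_tendsto' hlim fun m => ?_) zero_le
    calc P {ω | ¬ ∃ m, (Ψ ω ∩ column n i ×ˢ Iic (level F m)).encard ≠ 0}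
        ≤ P {ω | (Ψ ω ∩ column n i ×ˢ Iic (level F m)).encard = 0} := by
          refine measure_mono fun ω hω => ?_
          by_contra hc
          exact hω ⟨m, hc⟩
      _ ≤ ENNReal.ofReal (1 / ((m : ℝ) + 2)) := by
          rw [poisson_encard_eq_zero (hasLaw_column h hi (cdf_level_lt_one hF_cont m)),
            exp_hazard (cdf_level_lt_one hF_cont m)]
          exact ENNReal.ofReal_le_ofReal (by linarith [le_cdf_level (F := F) m])
  filter_upwards [hfin, hne] with ω hω1 ⟨m, hm⟩
  obtain ⟨p, ⟨hp, hpc, hpl⟩, hmin⟩ :=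
    exists_min_image _ Prod.snd (hω1 m) (encard_ne_zero.mp hm)
  have hleast : IsLeast (Prod.snd '' {p ∈ Ψ ω | p.1 ∈ column n i}) p.2 := by
    refine ⟨⟨p, ⟨hp, hpc⟩, rfl⟩, ?_⟩
    rintro _ ⟨q, ⟨hq, hqc⟩, rfl⟩
    rcases le_or_gt q.2 (level F m) with h1 | h1
    · exact hmin q ⟨hq, hqc, h1⟩
    · exact (show p.2 ≤ level F m from hpl).trans h1.le
  have e : columnMin n i (Ψ ω) = p.2 := hleast.csInf_eq
  rw [e]
  exact ⟨hleast, (monotone_cdf F hpl).trans_lt (cdf_level_lt_one hF_cont m)⟩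

/-- The heights tested for the event that a column minimum is at most `t`. -/
def testHeights (F : Measure ℝ) (t : ℝ) : Set ℝ := {y | y ≤ t ∧ cdf F t < 1}

/-- The counts for which a column minimum is at most `t`. -/
def testCounts (F : Measure ℝ) (t : ℝ) : Set ℕ∞ := {k | k ≠ 0 ∨ 1 ≤ cdf F t}

theorem testHeights_of_lt {t : ℝ} (ht : cdf F t < 1) : testHeights F t = Iic t := by
  ext y; simp [testHeights, ht]

theorem testHeights_of_le {t : ℝ} (ht : 1 ≤ cdf F t) : testHeights F t = ∅ := by
  ext y; simp [testHeights, ht]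

theorem testCounts_of_lt {t : ℝ} (ht : cdf F t < 1) : testCounts F t = {k | k ≠ 0} := by
  ext y; simp [testCounts, ht]

theorem testCounts_of_le {t : ℝ} (ht : 1 ≤ cdf F t) : testCounts F t = univ := by
  ext y; simp [testCounts, ht]

theorem measurableSet_testHeights (t : ℝ) : MeasurableSet (testHeights F t) := by
  rcases lt_or_ge (cdf F t) 1 with ht | ht
  · rw [testHeights_of_lt ht]; exact measurableSet_Iic
  · rw [testHeights_of_le ht]; exact MeasurableSet.empty

theorem hazardMeasure_testHeights_lt_top (t : ℝ) : hazardMeasure F (testHeights F t) < ⊤ := by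
  rcases lt_or_ge (cdf F t) 1 with ht | ht
  · rw [testHeights_of_lt ht, hazardMeasure_Iic, if_pos ht]; exact ENNReal.ofReal_lt_top
  · rw [testHeights_of_le ht]; simp

theorem volume_mul_testHeights_lt_top (i : ℕ) (t : ℝ) :
    volume (column n i) * hazardMeasure F (testHeights F t) < ⊤ :=
  ENNReal.mul_lt_top ((volume_column_le _ _).trans_lt ENNReal.one_lt_top)
    (hazardMeasure_testHeights_lt_top t)

/-- Where `F t = 1` the hazard is infinite and the count has no Poisson law. There the minimum is
almost surely at most `t`, so the test set is empty and every count passes. This keeps one formula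
valid for all `t`. -/
theorem columnMin_le_ae_eq (hF_cont : Continuous (cdf F))
    (h : IsStripPoisson Ψ n (hazardMeasure F) P) (hi : i < n) (t : ℝ) :
    ∀ᵐ ω ∂P, columnMin n i (Ψ ω) ≤ t ↔
      (Ψ ω ∩ column n i ×ˢ testHeights F t).encard ∈ testCounts F t := by
  filter_upwards [ae_isLeast_columnMin hF_cont h hi] with ω ⟨h1, h2⟩
  rcases lt_or_ge (cdf F t) 1 with ht | ht
  · rw [testHeights_of_lt ht, testCounts_of_lt ht, mem_ofPred_eq, encard_ne_zero]
    constructor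
    · intro hle
      obtain ⟨p, ⟨hp, hpc⟩, hpm⟩ := h1.1
      exact ⟨p, hp, hpc, hpm.le.trans hle⟩
    · rintro ⟨p, hp, hpc, hpt⟩
      exact (h1.2 ⟨p, ⟨hp, hpc⟩, rfl⟩).trans hpt
  · rw [testCounts_of_le ht]
    refine iff_of_true ?_ (mem_univ _)
    by_contra hc
    exact absurd (ht.trans (monotone_cdf F (not_le.mp hc).le)) (not_le.mpr h2)

theorem measure_testCounts [IsProbabilityMeasure F] [IsProbabilityMeasure P]
    (h : IsStripPoisson Ψ n (hazardMeasure F) P) (hi : i < n) (t : ℝ) :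
    P {ω | (Ψ ω ∩ column n i ×ˢ testHeights F t).encard ∈ testCounts F t} = F (Iic t) := by
  rw [← ofReal_cdf F t]
  rcases lt_or_ge (cdf F t) 1 with ht | ht
  · rw [testHeights_of_lt ht, testCounts_of_lt ht]
    have := poisson_encard_ne_zero (hasLaw_column h hi ht)
    rw [exp_hazard ht, sub_sub_cancel] at this
    exact this
  · rw [testCounts_of_le ht, le_antisymm (cdf_le_one F t) ht]
    simp

/-- The column minima are independent with distribution `F`. -/
theorem hasLaw_columnMin [IsProbabilityMeasure F] [IsProbabilityMeasure P]
    (hF_cont : Continuous (cdf F)) (h : IsStripPoisson Ψ n (hazardMeasure F) P) :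
    HasLaw (fun ω (i : Fin n) => columnMin n i (Ψ ω)) (Measure.pi fun _ => F) P := by
  have hcount : ∀ (i : Fin n) t, AEMeasurable
      (fun ω => (Ψ ω ∩ column n i ×ˢ testHeights F t).encard) P := fun i t =>
    (h.hasLaw_count _ _ (measurableSet_column _ _) (measurableSet_testHeights t)
      (column_subset _ _) (volume_mul_testHeights_lt_top _ t)).aemeasurable
  have hmeas : ∀ i : Fin n, AEMeasurable (fun ω => columnMin n i (Ψ ω)) P := by
    intro i
    have : NullMeasurable (fun ω => columnMin n i (Ψ ω)) P := by
      refine measurable_of_Iic (δ := NullMeasurableSpace Ω P) fun t => ?_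
      refine NullMeasurableSet.congr ((hcount i t).nullMeasurable
        (MeasurableSet.of_discrete (s := testCounts F t))) ?_
      filter_upwards [columnMin_le_ae_eq hF_cont h i.2 t] with ω hω
      exact propext hω.symm
    exact this.aemeasurable
  have hjoint : AEMeasurable (fun ω (i : Fin n) => columnMin n i (Ψ ω)) P :=
    aemeasurable_pi_lambda _ hmeas
  refine ⟨hjoint, ?_⟩
  symm
  -- The joint law is tested on products of half-lines, where the disjoint columns give independence
  -- and `measure_testCounts` the factors.
  refine Measure.pi_eq_generateFrom (C := fun _ => range Iic)
    (fun _ => ((BorelSpace.measurable_eq (α := ℝ)).trans (borel_eq_generateFrom_Iic ℝ)).symm)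
    (fun _ => isPiSystem_Iic)
    (fun _ => ⟨fun k => Iic (k : ℝ), fun k => ⟨k, rfl⟩, fun k => measure_lt_top _ _, ?_⟩) ?_
  · exact iUnion_eq_univ_iff.mpr fun x => exists_nat_ge x
  · intro s hs
    choose t ht using hs
    obtain rfl : (fun i => Iic (t i)) = s := funext ht
    rw [Measure.map_apply_of_aemeasurable hjoint
      (MeasurableSet.univ_pi fun _ => measurableSet_Iic)]
    have hind := (h.iIndepFun_count n (fun i => column n i) (fun i => testHeights F (t i))
      (fun i => measurableSet_column _ _) (fun i => measurableSet_testHeights _)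
      (fun i => column_subset _ _) (fun i => volume_mul_testHeights_lt_top _ _)
      (fun i j hij => Disjoint.set_prod_left
        (disjoint_column _ fun hc => hij (Fin.ext hc)) _ _)).measure_inter_preimage_eq_mul
      Finset.univ (sets := fun i => testCounts F (t i)) (fun _ _ => MeasurableSet.of_discrete)
    have hae : ((fun ω (i : Fin n) => columnMin n i (Ψ ω)) ⁻¹' univ.pi fun i => Iic (t i)) =ᵐ[P]
        ⋂ i ∈ Finset.univ, (fun ω => (Ψ ω ∩ column n (i : Fin n) ×ˢ
          testHeights F (t i)).encard) ⁻¹' testCounts F (t i) := by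
      refine eventuallyEq_set.mpr ?_
      filter_upwards [ae_all_iff.mpr fun i : Fin n => columnMin_le_ae_eq hF_cont h i.2 (t i)]
        with ω hω
      simp only [mem_preimage, mem_univ_pi, mem_Iic, hω, Finset.mem_univ, iInter_true, mem_iInter]
    rw [measure_congr hae, hind]
    exact Finset.prod_congr rfl fun i _ => measure_testCounts h i.2 (t i)

end ColumnLaw

/-! ### Adding one monomial to a tropical polynomial -/

theorem graphPoints_succ (n : ℕ) (c : ℕ → ℝ) :
    graphPoints (n + 1) c = insert ((n : ℝ), c n) (graphPoints n c) := by
  have : Iio (n + 1) = insert n (Iio n) := by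
    ext i
    simp only [mem_Iio, mem_insert_iff]
    omega
  rw [graphPoints, this, image_insert_eq]
  rfl

/-- If the last coefficient is not small and some of the previous `K` coefficients is smaller, the
last monomial changes the number of zeros by a bounded amount. -/
theorem abs_ncard_slopes_graphPoints_succ_sub_le {n K j : ℕ} {c : ℕ → ℝ} {ε : ℝ} (hε : 0 < ε)
    (hc : ∀ i < n, 0 ≤ c i) (hn : ε ≤ c n) (hjn : j < n) (hjK : n ≤ j + K) (hj : c j ≤ ε / 2) :
    |((slopes (graphPoints (n + 1) c)).ncard : ℝ) - ((slopes (graphPoints n c)).ncard : ℝ)| ≤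
      2 * K + 1 := by
  set A := graphPoints n c with hA
  set z : ℝ × ℝ := ((n : ℝ), c n) with hz
  have hfinA : (slopes A).Finite := finite_slopes ((finite_graphPoints n c).image _)
  have hfinA' : (slopes (insert z A)).Finite :=
    finite_slopes (((finite_graphPoints n c).insert _).image _)
  have hjA : ((j : ℝ), c j) ∈ A := ⟨j, hjn, rfl⟩
  have hlt : ∀ p ∈ A, p.1 < n := by
    rintro _ ⟨i, hi, rfl⟩
    simpa using hi
  rw [graphPoints_succ]
  -- At a new slope the rightmost point `z` ties with an older point. For any larger parameter that
  -- older point beats `z`, so there is only one new slope.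
  have h1 : (slopes (insert z A) \ slopes A).ncard ≤ 1 := by
    have key : ∀ s ∈ slopes (insert z A) \ slopes A, z ∈ minimizers (insert z A) s ∧
        ∃ p ∈ A, p ∈ minimizers (insert z A) s := by
      rintro s ⟨⟨p, hp, q, hq, hpq⟩, hs⟩
      have hres : ∀ r ∈ minimizers (insert z A) s, r ∈ A → r ∈ minimizers A s := fun r hr hrA =>
        ⟨hrA, fun x hx => hr.2 x (mem_insert_of_mem _ hx)⟩
      rcases hp.1 with rfl | hpA
      · rcases hq.1 with rfl | hqA
        · exact absurd rfl hpq
        · exact ⟨hp, q, hqA, hq⟩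
      · rcases hq.1 with rfl | hqA
        · exact ⟨hq, p, hpA, hp⟩
        · exact absurd ⟨p, hres p hp hpA, q, hres q hq hqA, hpq⟩ hs
    have hle : ∀ s ∈ slopes (insert z A) \ slopes A, ∀ t ∈ slopes (insert z A) \ slopes A,
        s ≤ t := by
      intro s hs t ht
      by_contra hc
      push Not at hc
      obtain ⟨p, hpA, hp⟩ := (key t ht).2
      have e1 := minimizers_eq (key t ht).1 hp
      have e2 := (key s hs).1.2 p (mem_insert_of_mem _ hpA)
      nlinarith [mul_pos (sub_pos.mpr hc) (sub_pos.mpr (hlt p hpA))]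
    rw [ncard_le_one (hfinA'.subset sdiff_subset)]
    exact fun s hs t ht => le_antisymm (hle s hs t ht) (hle t ht s hs)
  -- At a lost slope `z` strictly beats the old minimisers, hence also `j`, which forces `s K <
  -- -ε/2`. A minimiser `i` with `i + K < j` would then need `c i < 0`, so the old minimisers lie
  -- among the last `2 K` indices.
  have h2 : (slopes A \ slopes (insert z A)).ncard ≤ 2 * K := by
    have hE : ((fun i : ℕ => (i : ℝ)) '' Ico (n - 2 * K) n).ncard ≤ 2 * K := by
      refine (ncard_image_le (finite_Ico _ _)).trans ?_
      rw [← Finset.coe_Ico, ncard_coe_finset, Nat.card_Ico]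
      omega
    refine (ncard_slopes_le sdiff_subset ((finite_Ico (n - 2 * K) n).image _) ?_).2.trans hE
    rintro s ⟨hs, hs'⟩ p hp
    have hbeat : s * n + c n < s * p.1 + p.2 := by
      by_contra hc
      push Not at hc
      have hres : ∀ r ∈ minimizers A s, r ∈ minimizers (insert z A) s := by
        intro r hr
        refine ⟨mem_insert_of_mem _ hr.1, ?_⟩
        rintro x (rfl | hx)
        · exact (minimizers_eq hr hp).le.trans hc
        · exact hr.2 x hx
      exact hs' (Set.Nontrivial.mono hs hres)
    have hpj := hp.2 _ hjA
    obtain ⟨i, hi, rfl⟩ := hp.1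
    simp only at hbeat hpj
    have hi' : i < n := hi
    refine ⟨i, ⟨?_, hi'⟩, rfl⟩
    have hci := hc i hi'
    have hnj : (0 : ℝ) < n - j := by
      have : (j : ℝ) < n := by exact_mod_cast hjn
      linarith
    have hnjK : (n : ℝ) - j ≤ K := by
      have : (n : ℝ) ≤ j + K := by exact_mod_cast hjK
      linarith
    have hs1 : s * (n - j) < -(ε / 2) := by linarith
    have hs0 : s < 0 := by
      by_contra hcc
      push Not at hcc
      nlinarith [mul_nonneg hcc hnj.le]
    have hsK : s * K ≤ s * (n - j) := mul_le_mul_of_nonpos_left hnjK hs0.le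
    have hji : j ≤ i + K := by
      by_contra hcc
      push Not at hcc
      have h5 : (K : ℝ) ≤ j - i := by
        have : (i : ℝ) + K ≤ j := by exact_mod_cast hcc.le
        linarith
      have h6 : s * (j - i) ≤ s * K := mul_le_mul_of_nonpos_left h5 hs0.le
      linarith
    omega
  have t1 := ncard_le_ncard_sdiff_add_ncard (slopes (insert z A)) (slopes A) hfinA
  have t2 := ncard_le_ncard_sdiff_add_ncard (slopes A) (slopes (insert z A)) hfinA'
  have t1' : ((slopes (insert z A)).ncard : ℝ) ≤ 1 + (slopes A).ncard := by
    exact_mod_cast t1.trans (by omega)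
  have t2' : ((slopes A).ncard : ℝ) ≤ 2 * K + (slopes (insert z A)).ncard := by
    exact_mod_cast t2.trans (by omega)
  have hK : (0 : ℝ) ≤ K := by positivity
  rw [abs_le]
  constructor <;> linarith

section Coefficients

variable {F : Measure ℝ} {a C : ℝ} {Ω : Type*} [MeasurableSpace Ω]
  {P : Measure Ω} {c : ℕ → Ω → ℝ}

theorem cdf_pos (hC : 0 < C)
    (hFC : (fun y : ℝ => cdf F y - C * y ^ a) =o[𝓝[>] 0] (fun y : ℝ => y ^ a)) {x : ℝ}
    (hx : 0 < x) : 0 < cdf F x := by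
  obtain ⟨y, h1, h2⟩ := ((hFC.def (half_pos hC)).and (Ioo_mem_nhdsGT hx)).exists
  have hya : 0 < y ^ a := Real.rpow_pos_of_pos h2.1 a
  rw [Real.norm_eq_abs, Real.norm_eq_abs, abs_of_pos hya, abs_le] at h1
  have : 0 < C * y ^ a := mul_pos hC hya
  exact (show 0 < cdf F y by linarith).trans_le (monotone_cdf F h2.2.le)

/-- By continuity at `0` the last coefficient exceeds some `e > 0` with high probability. As `F (e /
2) > 0`, independence makes it unlikely that `K` previous coefficients all exceed `e / 2`. -/
theorem exists_graphPoints_succ_bound [IsProbabilityMeasure F] (hF : F (Iic 0) = 0)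
    (hF_cont : Continuous (cdf F)) (hC : 0 < C)
    (hFC : (fun y : ℝ => cdf F y - C * y ^ a) =o[𝓝[>] 0] (fun y : ℝ => y ^ a))
    (hc_law : ∀ i, HasLaw (c i) F P) (hc_indep : iIndepFun c P) {ε : ℝ≥0∞} (hε : ε ≠ 0) :
    ∃ K : ℝ, ∀ᶠ n in atTop, P {ω | K <
      |((slopes (graphPoints (n + 1) fun i => c i ω)).ncard : ℝ) -
        ((slopes (graphPoints n fun i => c i ω)).ncard : ℝ)|} ≤ ε := by
  have hε2 : 0 < ε / 2 := ENNReal.half_pos hε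
  obtain ⟨e, he0, he⟩ : ∃ e : ℝ, 0 < e ∧ F (Iic e) ≤ ε / 2 := by
    have h0 : Tendsto (cdf F) (𝓝[>] 0) (𝓝 (cdf F 0)) :=
      hF_cont.continuousAt.mono_left nhdsWithin_le_nhds
    rw [cdf_zero hF] at h0
    have h1 : Tendsto (fun x => ENNReal.ofReal (cdf F x)) (𝓝[>] 0) (𝓝 0) := by
      rw [← ENNReal.ofReal_zero]
      exact (ENNReal.continuous_ofReal.tendsto 0).comp h0
    obtain ⟨e, he, he0⟩ := ((h1.eventually (ge_mem_nhds hε2)).and self_mem_nhdsWithin).exists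
    exact ⟨e, he0, by rwa [← ofReal_cdf F e]⟩
  have hlt : F (Ioi (e / 2)) < 1 := by
    rw [← compl_Iic, prob_compl_eq_one_sub measurableSet_Iic, ← ofReal_cdf F]
    exact ENNReal.sub_lt_self ENNReal.one_ne_top one_ne_zero
      (ENNReal.ofReal_pos.mpr (cdf_pos hC hFC (half_pos he0))).ne'
  obtain ⟨K, hK⟩ := ((ENNReal.tendsto_pow_atTop_nhds_zero_of_lt_one hlt).eventually
    (ge_mem_nhds hε2)).exists
  refine ⟨2 * K + 1, ?_⟩
  filter_upwards [eventually_ge_atTop K] with n hn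
  have hneg : P {ω | ¬ ∀ i, 0 ≤ c i ω} = 0 := by
    rw [← ae_iff, ae_all_iff]
    intro i
    rw [ae_iff]
    refine measure_mono_null (t := {ω | c i ω ∈ Iic 0}) (fun ω hω => (not_le.mp hω).le) ?_
    rw [(hc_law i).measure_eq (p := fun x => x ∈ Iic (0 : ℝ)) measurableSet_Iic]
    exact hF
  have hlast : P {ω | c n ω ∈ Iic e} ≤ ε / 2 := by
    rw [(hc_law n).measure_eq (p := fun x => x ∈ Iic e) measurableSet_Iic]
    exact he
  have hprev : P (⋂ i ∈ Finset.Ico (n - K) n, c i ⁻¹' Ioi (e / 2)) ≤ ε / 2 := by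
    rw [hc_indep.measure_inter_preimage_eq_mul _ fun _ _ => measurableSet_Ioi]
    have : ∀ i ∈ Finset.Ico (n - K) n, P (c i ⁻¹' Ioi (e / 2)) = F (Ioi (e / 2)) := fun i _ =>
      (hc_law i).measure_eq (p := fun x => x ∈ Ioi (e / 2)) measurableSet_Ioi
    rw [Finset.prod_congr rfl this, Finset.prod_const, Nat.card_Ico, Nat.sub_sub_self hn]
    exact hK
  refine (measure_mono ?_).trans ((measure_union_le _ _).trans
    ((add_le_add (measure_union_le _ _) le_rfl).trans
      ((add_le_add (add_le_add hlast hprev) hneg.le).trans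
        (by rw [add_zero, ENNReal.add_halves]))))
  intro ω hω
  by_contra hcon
  simp only [mem_union, not_or] at hcon
  obtain ⟨⟨h1, hj⟩, h2⟩ := hcon
  replace h2 : ∀ i, 0 ≤ c i ω := not_not.mp h2
  simp only [mem_ofPred_eq, mem_Iic, not_le, mem_iInter, mem_preimage, mem_Ioi, not_forall, not_lt,
    Finset.mem_Ico] at h1 hj
  obtain ⟨j, ⟨hj1, hj2⟩, hj3⟩ := hj
  rw [mem_ofPred_eq] at hω
  exact absurd hω (not_lt.mpr (abs_ncard_slopes_graphPoints_succ_sub_le he0 (fun i _ => h2 i) h1.le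
    hj2 (by omega) hj3))

end Coefficients

/-! ### The law of the number of faces of the discretised process -/

/-- The number of zeros as a function of finitely many coefficients. -/
def zeroCount (n : ℕ) (x : Fin n → ℝ) : ℝ :=
  ((slopes (graphPoints n fun i => if h : i < n then x ⟨i, h⟩ else 0)).ncard : ℝ)

theorem measurable_zeroCount (n : ℕ) : Measurable (zeroCount n) := by
  have h1 : Measurable fun x : Fin n → ℝ =>
      (slopes (graphPoints n fun i => if h : i < n then x ⟨i, h⟩ else 0)).ncard := by
    refine measurable_ncard_slopes_graphPoints
      (c := fun i (x : Fin n → ℝ) => if h : i < n then x ⟨i, h⟩ else 0) n fun i hi => ?_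
    simp only [hi, dite_true]
    exact measurable_pi_apply _
  exact (measurable_from_nat (f := fun k : ℕ => (k : ℝ))).comp h1

theorem zeroCount_eq (n : ℕ) (c : ℕ → ℝ) :
    zeroCount n (fun i => c i) = ((slopes (graphPoints n c)).ncard : ℝ) := by
  have : graphPoints n (fun i => if i < n then c i else 0) = graphPoints n c :=
    image_congr fun i hi => by simp only [if_pos (show i < n from hi)]
  rw [zeroCount]
  simp only [dite_eq_ite, this]

theorem hasLaw_coefficients {F : Measure ℝ} {Ω : Type*} [MeasurableSpace Ω] {P : Measure Ω}
    [IsProbabilityMeasure P] {c : ℕ → Ω → ℝ} (hc_law : ∀ i, HasLaw (c i) F P)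
    (hc_indep : iIndepFun c P) (n : ℕ) :
    HasLaw (fun ω (i : Fin n) => c i ω) (Measure.pi fun _ => F) P := by
  refine ⟨aemeasurable_pi_lambda _ fun i => (hc_law i).aemeasurable, ?_⟩
  have h1 : iIndepFun (fun (i : Fin n) => c i) P := hc_indep.precomp Fin.val_injective
  rw [(iIndepFun_iff_map_fun_eq_pi_map (f := fun (i : Fin n) => c i)
    fun i => (hc_law i).aemeasurable).mp h1]
  simp only [(hc_law _).map_eq]

section Law

variable {F : Measure ℝ} {Ω : Type*} [MeasurableSpace Ω]
  {P : Measure Ω} [IsProbabilityMeasure P]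

theorem hasLaw_graphPoints {c : ℕ → Ω → ℝ} (hc_law : ∀ i, HasLaw (c i) F P)
    (hc_indep : iIndepFun c P) (n : ℕ) :
    HasLaw (fun ω => ((slopes (graphPoints n fun i => c i ω)).ncard : ℝ))
      ((Measure.pi fun _ : Fin n => F).map (zeroCount n)) P := by
  have h1 : HasLaw (zeroCount n) ((Measure.pi fun _ : Fin n => F).map (zeroCount n))
    (Measure.pi fun _ : Fin n => F) := ⟨(measurable_zeroCount n).aemeasurable, rfl⟩
  have := h1.fun_comp (hasLaw_coefficients hc_law hc_indep n)
  have e : (fun ω => zeroCount n fun i : Fin n => c i ω) =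
      fun ω => ((slopes (graphPoints n fun i => c i ω)).ncard : ℝ) :=
    funext fun ω => zeroCount_eq n fun i => c i ω
  rwa [e] at this

variable [IsProbabilityMeasure F]

/-- The faces are those of the graph of the `n` column minima, which are distributed as `n`
independent coefficients. -/
theorem hasLaw_lowerFaces_toLeftEdge (hF : F (Iic 0) = 0) (hF_cont : Continuous (cdf F)) {n : ℕ}
    (hn : n ≠ 0) {Φ : Ω → Set (ℝ × ℝ)} (hΦ : IsPoissonPointProcess Φ (intensity F n) P) :
    HasLaw (fun ω => ((lowerFaces (toLeftEdge n '' (Φ ω ∩ strip))).ncard : ℝ))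
      ((Measure.pi fun _ : Fin n => F).map (zeroCount n)) P := by
  have hr : IsRescaling n (n : ℝ) 0 := Or.inl ⟨rfl, rfl⟩
  have hΨ := hr.isStripPoisson hn hF hΦ
  have h1 : HasLaw (zeroCount n) ((Measure.pi fun _ : Fin n => F).map (zeroCount n))
    (Measure.pi fun _ : Fin n => F) := ⟨(measurable_zeroCount n).aemeasurable, rfl⟩
  refine (h1.fun_comp (hasLaw_columnMin hF_cont hΨ)).congr ?_
  filter_upwards [ae_all_iff.mpr fun i : Fin n => ae_isLeast_columnMin hF_cont hΨ i.2] with ω hω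
  rw [zeroCount_eq n fun i => columnMin n i _,
    ← slopes_shift_floor (hΨ.subset ω) fun i hi => (hω ⟨i, hi⟩).1,
    ← hr.horizontal_toLeftEdge hn]
  have e : slopes (horizontal n 0 '' (toLeftEdge n '' (Φ ω ∩ strip))) =
      (fun s => s / (n : ℝ)) '' slopes (toLeftEdge n '' (Φ ω ∩ strip)) :=
    slopes_affine _ (hr.ne_zero hn) 0
  rw [e, ncard_image_of_injective, ncard_lowerFaces]
  exact fun s t hst => by simpa [div_left_inj' (hr.ne_zero hn)] using hst

end Law

/-! ### Convergence in distribution -/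

section Distribution

variable {L : Measure ℝ} [IsProbabilityMeasure L]

theorem tendstoInDistribution_of_map_eq {Ω Ω' : ℕ → Type*} [∀ n, MeasurableSpace (Ω n)]
    [∀ n, MeasurableSpace (Ω' n)] {P : ∀ n, Measure (Ω n)} [∀ n, IsProbabilityMeasure (P n)]
    {P' : ∀ n, Measure (Ω' n)} [∀ n, IsProbabilityMeasure (P' n)] {X : ∀ n, Ω n → ℝ}
    {X' : ∀ n, Ω' n → ℝ} (hX' : ∀ n, AEMeasurable (X' n) (P' n))
    (hlaw : ∀ᶠ n in atTop, (P n).map (X n) = (P' n).map (X' n))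
    (h : TendstoInDistribution X atTop (id : ℝ → ℝ) P L) :
    TendstoInDistribution X' atTop (id : ℝ → ℝ) P' L := by
  refine ⟨hX', h.aemeasurable_limit, h.tendsto.congr' ?_⟩
  filter_upwards [hlaw] with n hn
  exact Subtype.ext hn

/-- A stochastically bounded difference does not change the limit in distribution after division
by a sequence tending to infinity. -/
theorem tendstoInDistribution_of_isBigOInProbability_sub {Ω : ℕ → Type*}
    [∀ n, MeasurableSpace (Ω n)] {P : ∀ n, Measure (Ω n)} [∀ n, IsProbabilityMeasure (P n)]
    {U V : ∀ n, Ω n → ℝ} (hV : ∀ n, AEMeasurable (V n) (P n)) (hU : ∀ n, AEMeasurable (U n) (P n))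
    (hUV : IsBigOInProbability P (fun n ω => U n ω - V n ω) (fun _ => 1)) {m s : ℕ → ℝ}
    (hs : Tendsto s atTop atTop)
    (h : TendstoInDistribution (fun n ω => (U n ω - m n) / s n) atTop (id : ℝ → ℝ) P L) :
    TendstoInDistribution (fun n ω => (V n ω - m n) / s n) atTop (id : ℝ → ℝ) P L := by
  -- The variables live on different spaces, so they are lifted to the product space, where
  -- convergence in measure and Slutsky's theorem make sense.
  have hev := fun n => measurePreserving_eval_infinitePi P n
  have hVm : ∀ n, AEMeasurable (fun ω => (V n ω - m n) / s n) (P n) := fun n =>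
    ((hV n).sub_const _).div_const _
  have hUm : ∀ n, AEMeasurable (fun ω => (U n ω - m n) / s n) (P n) := fun n =>
    ((hU n).sub_const _).div_const _
  have hV' : ∀ n, AEMeasurable (fun x : ∀ k, Ω k => (V n (x n) - m n) / s n)
      (Measure.infinitePi P) := fun n => (hVm n).comp_quasiMeasurePreserving
        (hev n).quasiMeasurePreserving
  have hU' : ∀ n, AEMeasurable (fun x : ∀ k, Ω k => (U n (x n) - m n) / s n)
      (Measure.infinitePi P) := fun n => (hUm n).comp_quasiMeasurePreserving
        (hev n).quasiMeasurePreserving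
  have hmap : ∀ n (f : Ω n → ℝ), AEMeasurable f (P n) →
      (Measure.infinitePi P).map (fun x => f (x n)) = (P n).map f := by
    intro n f hf
    rw [← (hev n).map_eq] at hf ⊢
    exact (AEMeasurable.map_map_of_aemeasurable hf (hev n).measurable.aemeasurable).symm
  have h1 : TendstoInDistribution (fun n (x : ∀ k, Ω k) => (U n (x n) - m n) / s n) atTop
      (id : ℝ → ℝ) (fun _ => Measure.infinitePi P) L :=
    tendstoInDistribution_of_map_eq hU' (.of_forall fun n => (hmap n _ (hUm n)).symm) h
  refine tendstoInDistribution_of_map_eq hVm (.of_forall fun n => hmap n _ (hVm n))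
    (tendstoInDistribution_of_tendstoInMeasure_sub _ _ h1 ?_ hV')
  rw [tendstoInMeasure_iff_norm]
  intro ε hε
  refine tendsto_of_tendsto_of_tendsto_of_le_of_le' tendsto_const_nhds
    -- The definition of `O_P(1)` is used with the sequence `c n = ε s n`.
    (hUV (fun n => ε * s n) (hs.const_mul_atTop hε)) (.of_forall fun n => zero_le) ?_
  filter_upwards [hs.eventually_gt_atTop 0] with n hn
  have hpre : {x : ∀ k, Ω k | ε ≤ ‖((fun n (x : ∀ k, Ω k) => (V n (x n) - m n) / s n) -
      fun n (x : ∀ k, Ω k) => (U n (x n) - m n) / s n) n x - (0 : ℕ → (∀ k, Ω k) → ℝ) n x‖} ⊆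
      Function.eval n ⁻¹' {ω | 1 * (ε * s n) ≤ |U n ω - V n ω|} := by
    intro x hx
    simp only [mem_ofPred_eq, Pi.sub_apply, Pi.zero_apply, sub_zero, Real.norm_eq_abs] at hx
    rw [← sub_div, abs_div, abs_of_pos hn, le_div_iff₀ hn, sub_sub_sub_cancel_right,
      abs_sub_comm] at hx
    simpa using hx
  refine (measure_mono hpre).trans ?_
  have hnull : NullMeasurableSet {ω | 1 * (ε * s n) ≤ |U n ω - V n ω|} (P n) :=
    nullMeasurableSet_le aemeasurable_const ((hU n).sub (hV n)).abs
  rw [(hev n).measure_preimage hnull]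

end Distribution

theorem IsBigOInProbability.sub_comm {Ω : ℕ → Type*} [∀ n, MeasurableSpace (Ω n)]
    {P : ∀ n, Measure (Ω n)} {X Y : ∀ n, Ω n → ℝ} {b : ℕ → ℝ}
    (h : IsBigOInProbability P (fun n ω => X n ω - Y n ω) b) :
    IsBigOInProbability P (fun n ω => Y n ω - X n ω) b := by
  intro c hc
  simp only [fun n ω => abs_sub_comm (Y n ω) (X n ω)]
  exact h c hc

/-! ### Transfer of limit laws between zeros and hull faces -/

section Main

variable {F : Measure ℝ} [IsProbabilityMeasure F] {a C : ℝ} {Ω : ℕ → Type*}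
  [∀ n, MeasurableSpace (Ω n)] {P : ∀ n, Measure (Ω n)} [∀ n, IsProbabilityMeasure (P n)]
  {Φ : ∀ n, Ω n → Set (ℝ × ℝ)} {Ω' : Type*} [MeasurableSpace Ω'] {P' : Measure Ω'}
  [IsProbabilityMeasure P'] {c : ℕ → Ω' → ℝ}

/-- The number of zeros of the tropical polynomial and the number of faces of the Poisson hull have
the same limits in distribution. -/
theorem tendstoInDistribution_zeros_iff (hF : F (Iic 0) = 0) (hF_cont : Continuous (cdf F))
    (ha : 0 < a) (hC : 0 < C)
    (hFC : (fun y : ℝ => cdf F y - C * y ^ a) =o[𝓝[>] 0] (fun y : ℝ => y ^ a))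
    (hΦ : ∀ n, IsPoissonPointProcess (Φ n) (intensity F n) (P n))
    (hc_law : ∀ i, HasLaw (c i) F P') (hc_indep : iIndepFun c P')
    (L : Measure ℝ) [IsProbabilityMeasure L] {m s : ℕ → ℝ} (hs : Tendsto s atTop atTop) :
    TendstoInDistribution
        (fun n ω => (((tropicalZeros n (fun i => c i ω)).ncard : ℝ) - m n) / s n)
        atTop (id : ℝ → ℝ) (fun _ => P') L ↔
      TendstoInDistribution
        (fun n ω => (((lowerFaces (Φ n ω ∩ rectangle F)).ncard : ℝ) - m n) / s n)
        atTop (id : ℝ → ℝ) P L := by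
  simp only [tropicalZeros_eq]
  set Z : ∀ _ : ℕ, Ω' → ℝ := fun n ω => ((slopes (graphPoints (n + 1) fun i => c i ω)).ncard : ℝ)
    with hZ
  set Z' : ∀ _ : ℕ, Ω' → ℝ := fun n ω => ((slopes (graphPoints n fun i => c i ω)).ncard : ℝ)
    with hZ'
  set U : ∀ n, Ω n → ℝ := fun n ω => ((lowerFaces (Φ n ω ∩ rectangle F)).ncard : ℝ) with hU
  -- The rescaling degenerates at `n = 0`; a constant value there keeps `V n` measurable for every
  -- `n` without affecting limits.
  set V : ∀ n, Ω n → ℝ := fun n ω =>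
    if n = 0 then 0 else ((lowerFaces (toLeftEdge n '' (Φ n ω ∩ strip))).ncard : ℝ) with hV
  have hVn : ∀ n, n ≠ 0 →
      V n = fun ω => ((lowerFaces (toLeftEdge n '' (Φ n ω ∩ strip))).ncard : ℝ) := fun n hn => by
    simp only [hV, if_neg hn]
  have mZ : ∀ n, AEMeasurable (Z n) P' := fun n => (hasLaw_graphPoints hc_law hc_indep _).aemeasurable
  have mZ' : ∀ n, AEMeasurable (Z' n) P' := fun n =>
    (hasLaw_graphPoints hc_law hc_indep _).aemeasurable
  have mU : ∀ n, AEMeasurable (U n) (P n) := fun n => by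
    simp only [hU, ncard_lowerFaces]
    exact (measurable_from_nat (f := fun k : ℕ => (k : ℝ))).comp_aemeasurable
      (aemeasurable_ncard_slopes_rectangle hF_cont (hΦ n))
  have mV : ∀ n, AEMeasurable (V n) (P n) := fun n => by
    rcases eq_or_ne n 0 with rfl | hn
    · simp only [hV, if_true]; exact aemeasurable_const
    · rw [hVn n hn]
      exact (hasLaw_lowerFaces_toLeftEdge hF hF_cont hn (hΦ n)).aemeasurable
  have hZZ' : IsBigOInProbability (fun _ => P') (fun n ω => Z n ω - Z' n ω) (fun _ => 1) :=
    isBigOInProbability_one_of_bounded fun ε hε =>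
      exists_graphPoints_succ_bound hF hF_cont hC hFC hc_law hc_indep hε
  have hUV : IsBigOInProbability P (fun n ω => U n ω - V n ω) (fun _ => 1) :=
    isBigOInProbability_one_of_bounded fun ε hε => by
      obtain ⟨K, hK⟩ := exists_total_bound hF hF_cont ha hC hFC P Φ hΦ (rectangle_subset_strip F)
        subset_rfl hε
      refine ⟨K, ?_⟩
      filter_upwards [hK, eventually_ne_atTop 0] with n h hn
      simpa only [hVn n hn] using h
  have hlaw : ∀ᶠ n in atTop, P'.map (fun ω => (Z' n ω - m n) / s n) =
      (P n).map (fun ω => (V n ω - m n) / s n) := by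
    filter_upwards [eventually_ne_atTop 0] with n hn
    have e1 : P'.map (Z' n) = (P n).map (V n) := by
      rw [hVn n hn, (hasLaw_lowerFaces_toLeftEdge hF hF_cont hn (hΦ n)).map_eq]
      exact (hasLaw_graphPoints hc_law hc_indep n).map_eq
    have hf : Measurable fun x : ℝ => (x - m n) / s n := by fun_prop
    have e2 := AEMeasurable.map_map_of_aemeasurable hf.aemeasurable (mZ' n)
    have e3 := AEMeasurable.map_map_of_aemeasurable hf.aemeasurable (mV n)
    rw [e1] at e2
    exact e2.symm.trans e3
  have affine : ∀ {n : ℕ}, AEMeasurable (V n) (P n) →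
      AEMeasurable (fun ω => (V n ω - m n) / s n) (P n) := fun h => (h.sub_const _).div_const _
  -- The chain is `Z` to `Z'` (one monomial fewer), `Z'` to `V` (equal laws), `V` to `U` (comparison
  -- of hulls).
  constructor
  · intro h
    have h1 := tendstoInDistribution_of_isBigOInProbability_sub mZ' mZ hZZ' hs h
    have h2 := tendstoInDistribution_of_map_eq (fun n => affine (mV n)) hlaw h1
    exact tendstoInDistribution_of_isBigOInProbability_sub mU mV hUV.sub_comm hs h2
  · intro h
    have h1 := tendstoInDistribution_of_isBigOInProbability_sub mV mU hUV hs h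
    have h2 := tendstoInDistribution_of_map_eq
      (fun n => ((mZ' n).sub_const (m n)).div_const (s n)) (hlaw.mono fun _ h => h.symm) h1
    exact tendstoInDistribution_of_isBigOInProbability_sub mZ mZ' hZZ'.sub_comm hs h2

end Main

end TropicalHull

end

/-! ### The main theorem -/

theorem mainTheorem5
    (F : Measure ℝ) [IsProbabilityMeasure F] (hF : F (Iic 0) = 0)
    (hF_cont : Continuous (cdf F))
    (a C : ℝ) (ha : 0 < a) (hC : 0 < C)
    (hFC : (fun y : ℝ => cdf F y - C * y ^ a) =o[𝓝[>] 0] (fun y : ℝ => y ^ a))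
    {Ω : ℕ → Type*} [∀ n, MeasurableSpace (Ω n)]
    (P : ∀ n, Measure (Ω n)) [∀ n, IsProbabilityMeasure (P n)]
    (Φ : ∀ n, Ω n → Set (ℝ × ℝ))
    (hΦ : ∀ n, TropicalHull.IsPoissonPointProcess (Φ n) (TropicalHull.intensity F n) (P n))
    {Ω' : Type*} [MeasurableSpace Ω'] (P' : Measure Ω') [IsProbabilityMeasure P']
    (c : ℕ → Ω' → ℝ) (hc_law : ∀ i, HasLaw (c i) F P') (hc_indep : iIndepFun c P') :
    (∀ W ∈ ({TropicalHull.rectangle F, TropicalHull.strip} : Set (Set (ℝ × ℝ))),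
      (∀ n, ∀ᵐ ω ∂(P n),
        (TropicalHull.lowerFaces (Φ n ω ∩ TropicalHull.rectangle F)).Finite ∧
        (TropicalHull.lowerFaces (TropicalHull.toLeftEdge n '' (Φ n ω ∩ W))).Finite) ∧
      TropicalHull.IsBigOInProbability P
        (fun n ω =>
          ((TropicalHull.lowerLeftFaces (Φ n ω ∩ TropicalHull.rectangle F)).ncard : ℝ) -
          ((TropicalHull.lowerLeftFaces (TropicalHull.toLeftEdge n '' (Φ n ω ∩ W))).ncard : ℝ))
        (fun _ => 1) ∧
      TropicalHull.IsBigOInProbability P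
        (fun n ω =>
          ((TropicalHull.lowerFaces (Φ n ω ∩ TropicalHull.rectangle F)).ncard : ℝ) -
          ((TropicalHull.lowerFaces (TropicalHull.toLeftEdge n '' (Φ n ω ∩ W))).ncard : ℝ))
        (fun _ => 1)) ∧
    (∀ (L : Measure ℝ) [IsProbabilityMeasure L] (m s : ℕ → ℝ), Tendsto s atTop atTop →
      (TendstoInDistribution
          (fun n ω =>
            (((TropicalHull.tropicalZeros n (fun i => c i ω)).ncard : ℝ) - m n) / s n)
          atTop (id : ℝ → ℝ) (fun _ => P') L ↔
        TendstoInDistribution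
          (fun n ω =>
            (((TropicalHull.lowerFaces (Φ n ω ∩ TropicalHull.rectangle F)).ncard : ℝ) - m n) / s n)
          atTop (id : ℝ → ℝ) P L)) := by
  refine ⟨fun W hW => ?_, fun L _ m s hs =>
    TropicalHull.tendstoInDistribution_zeros_iff hF hF_cont ha hC hFC hΦ hc_law hc_indep L hs⟩
  -- Both choices of `W` enter only through these inclusions.
  obtain ⟨hRW, hWS⟩ : TropicalHull.rectangle F ⊆ W ∧ W ⊆ TropicalHull.strip := by
    rcases hW with rfl | rfl
    · exact ⟨subset_rfl, TropicalHull.rectangle_subset_strip F⟩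
    · exact ⟨TropicalHull.rectangle_subset_strip F, subset_rfl⟩
  refine ⟨fun n => ?_,
    TropicalHull.isBigOInProbability_one_of_bounded fun ε hε =>
      TropicalHull.exists_left_bound hF hF_cont ha hC hFC P Φ hΦ hRW hWS hε,
    TropicalHull.isBigOInProbability_one_of_bounded fun ε hε =>
      TropicalHull.exists_total_bound hF hF_cont ha hC hFC P Φ hΦ hRW hWS hε⟩
  filter_upwards [TropicalHull.ae_finite_rectangle hF_cont (hΦ n)] with ω hω
  exact ⟨TropicalHull.finite_lowerFaces (TropicalHull.finite_slopes (hω.image _)),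
    TropicalHull.finite_lowerFaces
      (TropicalHull.finite_slopes_toLeftEdge (inter_subset_right.trans hWS) n)⟩
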